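/- Let $n\ge 1$ be an integer, let $R,d>0$ with $R>\frac{d\sqrt{n-1}}{\pi}$, and let $0<\alpha<1$. Let $\mathscr C=\{(q,z)\in\mathbb R^n\times\mathbb R : |q|=R,\ 0\le z\le d\}$ be the cylinder of radius $R$ and length $d$ in $\mathbb R^{n+1}$, with Laplace–Beltrami operator $\Delta$ and surface measure $\mu_0$. Let $h^{\alpha}(\mathscr C)$ be the space of (complex-valued) $u\in C^{\alpha}(\mathscr C)$ with $\lim_{r\to0}\sup_{0<|x-y|<r}|u(x)-u(y)|/|x-y|^{\alpha}=0$, with the $C^\alpha$ norm, and let $h^{2+\alpha}_{\partial/\partial z}(\mathscr C)$ be the space of $u\in C^2(\mathscr C)$ (up to the boundary) whose second derivatives are in $h^{\alpha}$ and which satisfy $\frac{\partial u}{\partial z}=0$ at $z=0$ and $z=d$. Consider the operator $$\partial G(0)u=\Big(\frac{n-1}{R^2}+\Delta\Big)u-\frac{n-1}{R^2}\,\frac{1}{\mu_0(\mathscr C)}\int_{\mathscr C}u\,d\mu_0$$ (the linearisation, at the cylinder, of the speed of the volume preserving mean curvature flow of graphs over $\mathscr C$) as an unbounded operator in $h^{\alpha}(\mathscr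 C)$ with domain $h^{2+\alpha}_{\partial/\partial z}(\mathscr C)$. Its spectrum is the set of $\mu\in\mathbb C$ for which $\mu-\partial G(0)$ is not a bijection from the domain onto $h^{\alpha}(\mathscr C)$ with inverse bounded in the norm of $h^\alpha(\mathscr C)$. Then the spectrum of $\partial G(0)$ coincides with its set of eigenvalues; it is countably infinite, each of its points is isolated in it, and all of its points are real and non-positive. The spectrum is exactly the set of the numbers $$\lambda_{l,m}=-\Big(\frac{m^2\pi^2}{d^2}+\frac{l(l+n-2)-(n-1)}{R^2}\Big),\qquad l,m\in\mathbb N\cup\{0\},\ (l,m)\neq(0,0),$$ where, if $n=1$, only $l\in\{0,1\}$ is allowed. The eigenvalue $0$ has multiplicity $n+1$, that is, the kernel of $\partial G(0)$ has dimension $n+1$. -/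

import Mathlib

open MeasureTheory Set
open scoped NNReal

noncomputable section

namespace CylinderFlow

/-! ### Little-Hölder functions -/

section LittleHolder

variable {X : Type*} [MetricSpace X]
variable {F : Type*} [NormedAddCommGroup F]

/-- `f` is little-Hölder of exponent `α`: bounded, `α`-Hölder, and
`sup_{0 < |x - y| < r} |f x - f y| / |x - y| ^ α → 0` as `r → 0`. -/
def IsLittleHolder (α : ℝ≥0) (f : X → F) : Prop :=
  (∃ C : ℝ, ∀ x, ‖f x‖ ≤ C) ∧ MemHolder α f ∧
    ∀ ε : ℝ, 0 < ε → ∃ r : ℝ, 0 < r ∧ ∀ x y, dist x y < r →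
      ‖f x - f y‖ ≤ ε * dist x y ^ (α : ℝ)

theorem IsLittleHolder.zero (α : ℝ≥0) : IsLittleHolder α (0 : X → F) := by
  refine ⟨⟨0, fun x => by simp⟩, memHolder_zero, fun ε hε => ⟨1, one_pos, fun x y _ => ?_⟩⟩
  simp only [Pi.zero_apply, sub_zero, norm_zero]
  positivity

theorem IsLittleHolder.add {α : ℝ≥0} {f g : X → F} (hf : IsLittleHolder α f)
    (hg : IsLittleHolder α g) : IsLittleHolder α (f + g) := by
  obtain ⟨⟨C, hC⟩, hf1, hf2⟩ := hf
  obtain ⟨⟨D, hD⟩, hg1, hg2⟩ := hg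
  refine ⟨⟨C + D, fun x => (norm_add_le _ _).trans (add_le_add (hC x) (hD x))⟩,
    hf1.add hg1, fun ε hε => ?_⟩
  obtain ⟨r, hr, h1⟩ := hf2 (ε / 2) (by positivity)
  obtain ⟨s, hs, h2⟩ := hg2 (ε / 2) (by positivity)
  refine ⟨min r s, lt_min hr hs, fun x y hxy => ?_⟩
  have e : (f + g) x - (f + g) y = (f x - f y) + (g x - g y) := by
    simp only [Pi.add_apply]; abel
  rw [e]
  refine (norm_add_le _ _).trans ?_
  have := h1 x y (hxy.trans_le (min_le_left _ _))
  have := h2 x y (hxy.trans_le (min_le_right _ _))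
  linarith

theorem IsLittleHolder.clm_comp [NormedSpace ℝ F] {F' : Type*} [NormedAddCommGroup F']
    [NormedSpace ℝ F'] {α : ℝ≥0} {f : X → F} (hf : IsLittleHolder α f)
    (L : F →L[ℝ] F') : IsLittleHolder α (fun x => L (f x)) := by
  obtain ⟨⟨C, hC⟩, ⟨K, hK⟩, hf2⟩ := hf
  refine ⟨⟨‖L‖ * C, fun x => (L.le_opNorm _).trans
    (mul_le_mul_of_nonneg_left (hC x) (norm_nonneg _))⟩, ?_, fun ε hε => ?_⟩
  · have h := (L.lipschitz.holderWith).comp hK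
    rw [one_mul] at h
    exact ⟨_, h⟩
  · obtain ⟨r, hr, h⟩ := hf2 (ε / (‖L‖ + 1)) (by positivity)
    refine ⟨r, hr, fun x y hxy => ?_⟩
    rw [← map_sub]
    refine (L.le_opNorm _).trans ?_
    have h0 := h x y hxy
    have h1 : ‖L‖ * ‖f x - f y‖ ≤ (‖L‖ + 1) * (ε / (‖L‖ + 1) * dist x y ^ (α : ℝ)) :=
      mul_le_mul (by linarith) h0 (norm_nonneg _) (by positivity)
    refine h1.trans (le_of_eq ?_)
    field_simp

theorem IsLittleHolder.const_smul {α : ℝ≥0} {f : X → ℂ} (hf : IsLittleHolder α f) (c : ℂ) :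
    IsLittleHolder α (c • f) :=
  hf.clm_comp ((ContinuousLinearMap.mul ℂ ℂ c).restrictScalars ℝ)

theorem IsLittleHolder.const (α : ℝ≥0) (c : F) : IsLittleHolder α (fun _ : X => c) := by
  refine ⟨⟨‖c‖, fun x => le_rfl⟩, memHolder_const, fun ε hε => ⟨1, one_pos, fun x y _ => ?_⟩⟩
  simp only [sub_self, norm_zero]
  positivity

theorem IsLittleHolder.continuous {α : ℝ≥0} {f : X → F} (hf : IsLittleHolder α f) :
    Continuous f := by
  refine Metric.continuous_iff.2 fun y ε hε => ?_
  obtain ⟨r, hr, h⟩ := hf.2.2 (ε / 2) (by positivity)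
  refine ⟨min r 1, by positivity, fun x hxy => ?_⟩
  rw [dist_eq_norm]
  refine (h x y (hxy.trans_le (min_le_left _ _))).trans_lt ?_
  have : dist x y ^ (α : ℝ) ≤ 1 :=
    Real.rpow_le_one dist_nonneg (hxy.le.trans (min_le_right _ _)) α.2
  nlinarith

variable (X) in
/-- The complex vector space of little-Hölder functions `X → ℂ`. -/
def littleHolderSubmodule (α : ℝ≥0) : Submodule ℂ (X → ℂ) where
  carrier := {f | IsLittleHolder α f}
  zero_mem' := IsLittleHolder.zero α
  add_mem' := fun hf hg => hf.add hg
  smul_mem' := fun c _ hf => hf.const_smul c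

variable (X) in
/-- The (complexified) little-Hölder space `h^α(X)`, to be normed by the `C^α` norm. -/
def LittleHolder (α : ℝ≥0) : Type _ := littleHolderSubmodule X α

instance (α : ℝ≥0) : AddCommGroup (LittleHolder X α) :=
  inferInstanceAs (AddCommGroup (littleHolderSubmodule X α))

instance (α : ℝ≥0) : Module ℂ (LittleHolder X α) :=
  inferInstanceAs (Module ℂ (littleHolderSubmodule X α))

/-- The function underlying an element of `h^α(X)`. -/
def LittleHolder.toFun {α : ℝ≥0} : LittleHolder X α →ₗ[ℂ] (X → ℂ) :=
  (littleHolderSubmodule X α).subtype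

theorem LittleHolder.toFun_injective {α : ℝ≥0} :
    Function.Injective (LittleHolder.toFun (X := X) (α := α)) :=
  Subtype.val_injective

theorem LittleHolder.isLittleHolder {α : ℝ≥0} (f : LittleHolder X α) :
    IsLittleHolder α (LittleHolder.toFun f) :=
  f.2

/-- The element of `h^α(X)` with a given underlying function. -/
def LittleHolder.mk {α : ℝ≥0} (f : X → ℂ) (hf : IsLittleHolder α f) : LittleHolder X α :=
  ⟨f, hf⟩

/-- The Hölder norm `sup |f| + sup_{x ≠ y} |f x - f y| / |x - y| ^ α`. -/
instance (α : ℝ≥0) : Norm (LittleHolder X α) where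
  norm f := (⨆ x, ‖LittleHolder.toFun f x‖) + nnHolderNorm α (LittleHolder.toFun f)

theorem LittleHolder.norm_def {α : ℝ≥0} (f : LittleHolder X α) :
    ‖f‖ = (⨆ x, ‖LittleHolder.toFun f x‖) + nnHolderNorm α (LittleHolder.toFun f) :=
  rfl

theorem LittleHolder.bddAbove {α : ℝ≥0} (f : LittleHolder X α) :
    BddAbove (range fun x => ‖LittleHolder.toFun f x‖) := by
  obtain ⟨C, hC⟩ := f.isLittleHolder.1
  exact ⟨C, by rintro _ ⟨x, rfl⟩; exact hC x⟩

theorem LittleHolder.normCore (α : ℝ≥0) : NormedSpace.Core ℂ (LittleHolder X α) where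
  norm_nonneg f := add_nonneg (Real.iSup_nonneg fun _ => norm_nonneg _) (NNReal.coe_nonneg _)
  norm_smul c f := by
    rw [norm_def, norm_def, map_smul, f.isLittleHolder.2.1.nnHolderNorm_smul, mul_add,
      Real.mul_iSup_of_nonneg (norm_nonneg c)]
    simp
  norm_triangle f g := by
    rw [norm_def, norm_def, norm_def, map_add]
    have h1 : (⨆ x, ‖(toFun f + toFun g) x‖) ≤ (⨆ x, ‖toFun f x‖) + ⨆ x, ‖toFun g x‖ := by
      refine Real.iSup_le (fun x => (norm_add_le _ _).trans
        (add_le_add (le_ciSup f.bddAbove x) (le_ciSup g.bddAbove x))) ?_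
      exact add_nonneg (Real.iSup_nonneg fun _ => norm_nonneg _)
        (Real.iSup_nonneg fun _ => norm_nonneg _)
    have h2 : ((nnHolderNorm α (toFun f + toFun g) : ℝ≥0) : ℝ) ≤
        nnHolderNorm α (toFun f) + nnHolderNorm α (toFun g) := by
      exact_mod_cast f.isLittleHolder.2.1.nnHolderNorm_add_le g.isLittleHolder.2.1
    linarith
  norm_eq_zero_iff f := by
    constructor
    · intro h
      have h1 : (0 : ℝ) ≤ nnHolderNorm α (toFun f) := NNReal.coe_nonneg _
      rw [norm_def] at h
      apply toFun_injective
      funext x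
      have h2 := le_ciSup f.bddAbove x
      rw [map_zero, Pi.zero_apply, ← norm_le_zero_iff]
      linarith
    · rintro rfl
      rw [norm_def, map_zero]
      simp

instance (α : ℝ≥0) : NormedAddCommGroup (LittleHolder X α) :=
  NormedAddCommGroup.ofCore (LittleHolder.normCore α)

instance (α : ℝ≥0) : NormedSpace ℂ (LittleHolder X α) :=
  NormedSpace.ofCore (LittleHolder.normCore α)

end LittleHolder

/-! ### Spectrum of an unbounded operator -/

section Spectrum

variable {X : Type*} [NormedAddCommGroup X] [NormedSpace ℂ X]

/-- `μ - T`, from the domain of `T` to `X`. -/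
def shifted (T : X →ₗ.[ℂ] X) (μ : ℂ) : T.domain →ₗ[ℂ] X :=
  μ • T.domain.subtype - T.toFun

/-- `μ` is in the resolvent set of `T` if `μ - T` is a bijection from the domain of `T` onto `X`
whose inverse is bounded with respect to the norm of `X`. -/
def resolventSet (T : X →ₗ.[ℂ] X) : Set ℂ :=
  {μ | Function.Bijective (shifted T μ) ∧
    ∃ C : ℝ, ∀ u : T.domain, ‖(u : X)‖ ≤ C * ‖shifted T μ u‖}

/-- The spectrum: the complement of the resolvent set. -/
def spectrum (T : X →ₗ.[ℂ] X) : Set ℂ := (resolventSet T)ᶜ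

/-- The eigenspace of `T` for `μ`. -/
def eigenspace (T : X →ₗ.[ℂ] X) (μ : ℂ) : Submodule ℂ T.domain := LinearMap.ker (shifted T μ)

/-- `μ` is an eigenvalue of `T`: there is a nonzero `u` in the domain with `T u = μ u`. -/
def IsEigenvalue (T : X →ₗ.[ℂ] X) (μ : ℂ) : Prop := eigenspace T μ ≠ ⊥

end Spectrum

/-! ### The cylinder -/

/-- `ℝ^{n+1} = ℝ^n × ℝ` with its Euclidean structure. -/
abbrev Ambient (n : ℕ) : Type := WithLp 2 (EuclideanSpace ℝ (Fin n) × ℝ)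

/-- The cylinder `{(q, z) : |q| = R, 0 ≤ z ≤ d}` in `ℝ^{n+1}`. -/
def cylinder (n : ℕ) (R d : ℝ) : Set (Ambient n) := {x | ‖x.fst‖ = R ∧ x.snd ∈ Icc 0 d}

/-- The slab `0 ≤ z ≤ d` with the axis removed. -/
def slab (n : ℕ) (d : ℝ) : Set (Ambient n) := {x | x.fst ≠ 0 ∧ x.snd ∈ Icc 0 d}

/-- The radial projection `(x, z) ↦ (R x / |x|, z)`, which on a neighbourhood of the cylinder is
the nearest-point projection. -/
def radialProj (n : ℕ) (R : ℝ) (x : Ambient n) : Ambient n :=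
  WithLp.toLp 2 ((R / ‖x.fst‖) • x.fst, x.snd)

open Classical in
/-- The extension of a function on the cylinder to the slab that is constant along the normals
of the cylinder (and zero where the radial projection is not on the cylinder). Tangential
derivatives of `u` are derivatives of this extension; its first derivative on the cylinder is the
tangential gradient of `u`, and the trace of its second derivative is the Laplace-Beltrami
operator. -/
def normalExt {n : ℕ} {R d : ℝ} (u : cylinder n R d → ℂ) (x : Ambient n) : ℂ :=
  if h : radialProj n R x ∈ cylinder n R d then u ⟨radialProj n R x, h⟩ else 0

theorem normalExt_add {n : ℕ} {R d : ℝ} (u v : cylinder n R d → ℂ) :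
    normalExt (u + v) = normalExt u + normalExt v := by
  funext x
  by_cases h : radialProj n R x ∈ cylinder n R d <;> simp [normalExt, h]

theorem normalExt_smul {n : ℕ} {R d : ℝ} (c : ℂ) (u : cylinder n R d → ℂ) :
    normalExt (c • u) = c • normalExt u := by
  funext x
  by_cases h : radialProj n R x ∈ cylinder n R d <;> simp [normalExt, h]

theorem normalExt_coe {n : ℕ} {R d : ℝ} (hR : 0 < R) (u : cylinder n R d → ℂ)
    (p : cylinder n R d) : normalExt u p = u p := by
  have e : radialProj n R p = p := by
    have h : ‖(p : Ambient n).fst‖ = R := p.2.1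
    unfold radialProj
    rw [h, div_self hR.ne', one_smul]
    rfl
  have h : radialProj n R p ∈ cylinder n R d := by rw [e]; exact p.2
  rw [normalExt, dif_pos h]
  exact congrArg u (Subtype.ext e)

theorem mem_slab {n : ℕ} {R d : ℝ} (hR : 0 < R) (p : cylinder n R d) :
    (p : Ambient n) ∈ slab n d :=
  ⟨fun h => by
    have h1 := p.2.1
    rw [h, norm_zero] at h1
    exact hR.ne h1, p.2.2⟩

theorem uniqueDiffOn_slab (n : ℕ) {d : ℝ} (hd : 0 < d) : UniqueDiffOn ℝ (slab n d) := by
  have h1 : UniqueDiffOn ℝ ((WithLp.prodContinuousLinearEquiv 2 ℝ (EuclideanSpace ℝ (Fin n)) ℝ) ⁻¹'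
      ({0}ᶜ ×ˢ Icc 0 d)) := by
    rw [ContinuousLinearEquiv.uniqueDiffOn_preimage_iff]
    exact isOpen_compl_singleton.uniqueDiffOn.prod (uniqueDiffOn_Icc hd)
  exact h1

/-- `u` is of class `h^{2+α}` on the cylinder: `u` is `C²` up to the boundary and its second
derivatives are in `h^α`. -/
def IsLittleHolderTwo {n : ℕ} {R d : ℝ} (α : ℝ≥0) (u : cylinder n R d → ℂ) : Prop :=
  ContDiffOn ℝ 2 (normalExt u) (slab n d) ∧
    IsLittleHolder α
      (fun p : cylinder n R d => iteratedFDerivWithin ℝ 2 (normalExt u) (slab n d) p)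

/-- The derivative `∂u/∂z` along the axis. -/
def axialDeriv {n : ℕ} {R d : ℝ} (u : cylinder n R d → ℂ) (p : cylinder n R d) : ℂ :=
  fderivWithin ℝ (normalExt u) (slab n d) p (WithLp.toLp 2 (0, 1))

/-- The Neumann condition `∂u/∂z = 0` for `z = 0` and `z = d`. -/
def IsNeumann {n : ℕ} {R d : ℝ} (u : cylinder n R d → ℂ) : Prop :=
  ∀ p : cylinder n R d, (p : Ambient n).snd = 0 ∨ (p : Ambient n).snd = d → axialDeriv u p = 0

/-- The Laplace-Beltrami operator of the cylinder. -/
def laplaceBeltrami {n : ℕ} {R d : ℝ} (u : cylinder n R d → ℂ) (p : cylinder n R d) : ℂ :=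
  InnerProductSpace.laplacianWithin (normalExt u) (slab n d) p

/-- The point `(R ω, z)` of the cylinder. -/
def cylinderPoint {n : ℕ} {R d : ℝ} (hR : 0 < R)
    (p : Metric.sphere (0 : EuclideanSpace ℝ (Fin n)) 1 × Icc (0 : ℝ) d) : cylinder n R d :=
  ⟨WithLp.toLp 2 (R • (p.1 : EuclideanSpace ℝ (Fin n)), (p.2 : ℝ)), by
    refine ⟨?_, p.2.2⟩
    have h : ‖(p.1 : EuclideanSpace ℝ (Fin n))‖ = 1 := by simp
    simp [norm_smul, h, abs_of_pos hR]⟩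

/-- Lebesgue measure on `[0, d]`. -/
def segmentMeasure (d : ℝ) : Measure (Icc (0 : ℝ) d) := Measure.comap Subtype.val volume

instance (d : ℝ) : IsFiniteMeasure (segmentMeasure d) :=
  ⟨by
    rw [segmentMeasure, comap_subtype_coe_apply measurableSet_Icc, image_univ,
      Subtype.range_coe]
    exact measure_Icc_lt_top⟩

/-- The mean value of `u` over the cylinder, with respect to the surface measure. -/
def mean {n : ℕ} {R d : ℝ} (hR : 0 < R) (u : cylinder n R d → ℂ) : ℂ :=
  ⨍ p, u (cylinderPoint hR p)
    ∂((volume : Measure (EuclideanSpace ℝ (Fin n))).toSphere.prod (segmentMeasure d))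

theorem continuous_cylinderPoint {n : ℕ} {R d : ℝ} (hR : 0 < R) :
    Continuous (cylinderPoint (n := n) (d := d) hR) := by
  refine Continuous.subtype_mk ?_ _
  exact (WithLp.prod_continuous_toLp 2 _ _).comp (by fun_prop)

theorem integrable_cylinderPoint {n : ℕ} {R d : ℝ} (hR : 0 < R) {α : ℝ≥0}
    {u : cylinder n R d → ℂ} (hu : IsLittleHolder α u) :
    Integrable (fun p => u (cylinderPoint hR p))
      ((volume : Measure (EuclideanSpace ℝ (Fin n))).toSphere.prod
        (segmentMeasure d)) := by
  obtain ⟨C, hC⟩ := hu.1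
  exact Integrable.of_bound
    (hu.continuous.comp (continuous_cylinderPoint hR)).aestronglyMeasurable C
    (Filter.Eventually.of_forall fun p => hC _)

theorem mean_add {n : ℕ} {R d : ℝ} (hR : 0 < R) {α : ℝ≥0} {u v : cylinder n R d → ℂ}
    (hu : IsLittleHolder α u) (hv : IsLittleHolder α v) :
    mean hR (u + v) = mean hR u + mean hR v := by
  simp only [mean, average_eq, Pi.add_apply]
  rw [integral_add (integrable_cylinderPoint hR hu) (integrable_cylinderPoint hR hv), smul_add]

theorem mean_smul {n : ℕ} {R d : ℝ} (hR : 0 < R) (c : ℂ) (u : cylinder n R d → ℂ) :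
    mean hR (c • u) = c * mean hR u := by
  simp only [mean, average_eq, Pi.smul_apply, smul_eq_mul]
  rw [integral_const_mul, mul_smul_comm]

theorem IsLittleHolderTwo.contDiffWithinAt {n : ℕ} {R d : ℝ} (hR : 0 < R) {α : ℝ≥0}
    {u : cylinder n R d → ℂ} (hu : IsLittleHolderTwo α u) (p : cylinder n R d) :
    ContDiffWithinAt ℝ 2 (normalExt u) (slab n d) p :=
  hu.1 p (mem_slab hR p)

theorem IsLittleHolderTwo.laplace {n : ℕ} {R d : ℝ} (hR : 0 < R) (hd : 0 < d) {α : ℝ≥0}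
    {u : cylinder n R d → ℂ} (hu : IsLittleHolderTwo α u) :
    IsLittleHolder α (laplaceBeltrami u) := by
  let b := stdOrthonormalBasis ℝ (Ambient n)
  let L : (ContinuousMultilinearMap ℝ (fun _ : Fin 2 => Ambient n) ℂ) →L[ℝ] ℂ :=
    ∑ i, ContinuousMultilinearMap.apply ℝ (fun _ : Fin 2 => Ambient n) ℂ ![b i, b i]
  have h := hu.2.clm_comp L
  have e : laplaceBeltrami u =
      fun p : cylinder n R d => L (iteratedFDerivWithin ℝ 2 (normalExt u) (slab n d) p) := by
    funext p
    rw [laplaceBeltrami,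
      InnerProductSpace.laplacianWithin_eq_iteratedFDerivWithin_orthonormalBasis _
        (uniqueDiffOn_slab n hd) (mem_slab hR p) b]
    simp [L]
  rw [e]
  exact h

theorem IsLittleHolderTwo.add {n : ℕ} {R d : ℝ} (hR : 0 < R) (hd : 0 < d) {α : ℝ≥0}
    {u v : cylinder n R d → ℂ} (hu : IsLittleHolderTwo α u) (hv : IsLittleHolderTwo α v) :
    IsLittleHolderTwo α (u + v) := by
  refine ⟨by rw [normalExt_add]; exact hu.1.add hv.1, ?_⟩
  convert hu.2.add hv.2 using 1
  funext p
  rw [normalExt_add]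
  exact iteratedFDerivWithin_add_apply (hu.contDiffWithinAt hR p) (hv.contDiffWithinAt hR p)
    (uniqueDiffOn_slab n hd) (mem_slab hR p)

theorem IsLittleHolderTwo.smul {n : ℕ} {R d : ℝ} (hR : 0 < R) (hd : 0 < d) {α : ℝ≥0} (c : ℂ)
    {u : cylinder n R d → ℂ} (hu : IsLittleHolderTwo α u) : IsLittleHolderTwo α (c • u) := by
  refine ⟨by rw [normalExt_smul]; exact hu.1.const_smul c, ?_⟩
  have h := hu.2.clm_comp (ContinuousLinearMap.compContinuousMultilinearMapL ℝ
    (fun _ : Fin 2 => Ambient n) ℂ ℂ ((ContinuousLinearMap.mul ℂ ℂ c).restrictScalars ℝ))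
  convert h using 1
  funext p
  rw [normalExt_smul, iteratedFDerivWithin_const_smul_apply (hu.contDiffWithinAt hR p)
    (uniqueDiffOn_slab n hd) (mem_slab hR p)]
  ext m
  simp

theorem IsLittleHolderTwo.zero {n : ℕ} {R d : ℝ} (α : ℝ≥0) :
    IsLittleHolderTwo α (0 : cylinder n R d → ℂ) := by
  have e : normalExt (0 : cylinder n R d → ℂ) = 0 := by
    simpa using normalExt_smul 0 (0 : cylinder n R d → ℂ)
  refine ⟨by rw [e]; exact contDiffOn_const, ?_⟩
  rw [e]
  have h : (fun p : cylinder n R d =>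
      iteratedFDerivWithin ℝ 2 (0 : Ambient n → ℂ) (slab n d) p) = 0 := by
    funext p
    simp
  rw [h]
  exact IsLittleHolder.zero α

theorem axialDeriv_add {n : ℕ} {R d : ℝ} (hR : 0 < R) (hd : 0 < d) {α : ℝ≥0}
    {u v : cylinder n R d → ℂ} (hu : IsLittleHolderTwo α u) (hv : IsLittleHolderTwo α v)
    (p : cylinder n R d) : axialDeriv (u + v) p = axialDeriv u p + axialDeriv v p := by
  rw [axialDeriv, normalExt_add, fderivWithin_add
    (uniqueDiffOn_slab n hd p (mem_slab hR p))
    ((hu.contDiffWithinAt hR p).differentiableWithinAt (by norm_num))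
    ((hv.contDiffWithinAt hR p).differentiableWithinAt (by norm_num))]
  rfl

theorem axialDeriv_smul {n : ℕ} {R d : ℝ} (hR : 0 < R) (hd : 0 < d) {α : ℝ≥0} (c : ℂ)
    {u : cylinder n R d → ℂ} (hu : IsLittleHolderTwo α u)
    (p : cylinder n R d) : axialDeriv (c • u) p = c * axialDeriv u p := by
  rw [axialDeriv, normalExt_smul, fderivWithin_const_smul
    (uniqueDiffOn_slab n hd p (mem_slab hR p))
    ((hu.contDiffWithinAt hR p).differentiableWithinAt (by norm_num))]
  rfl

/-- The space `h^{2+α}_{∂/∂z}` of `h^{2+α}` functions satisfying the Neumann condition, as a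
subspace of `h^α`. -/
def neumannDomain {n : ℕ} {R d : ℝ} (hR : 0 < R) (hd : 0 < d) (α : ℝ≥0) :
    Submodule ℂ (LittleHolder (cylinder n R d) α) where
  carrier := {u | IsLittleHolderTwo α (LittleHolder.toFun u) ∧ IsNeumann (LittleHolder.toFun u)}
  zero_mem' := by
    refine ⟨by rw [map_zero]; exact IsLittleHolderTwo.zero α, fun p _ => ?_⟩
    have h := axialDeriv_smul hR hd 0 (IsLittleHolderTwo.zero (n := n) (R := R) (d := d) α) p
    rw [map_zero]
    simpa using h
  add_mem' := by
    rintro u v ⟨hu, hu'⟩ ⟨hv, hv'⟩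
    refine ⟨by rw [map_add]; exact hu.add hR hd hv, fun p hp => ?_⟩
    rw [map_add, axialDeriv_add hR hd hu hv, hu' p hp, hv' p hp, add_zero]
  smul_mem' := by
    rintro c u ⟨hu, hu'⟩
    refine ⟨by rw [map_smul]; exact hu.smul hR hd c, fun p hp => ?_⟩
    rw [map_smul, axialDeriv_smul hR hd c hu, hu' p hp, mul_zero]

/-- The function
`((n-1)/R² + Δ) u - ((n-1)/R²) ⨍ u`. -/
def linearisationFun {n : ℕ} {R d : ℝ} (hR : 0 < R) (u : cylinder n R d → ℂ)
    (p : cylinder n R d) : ℂ :=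
  ((n : ℂ) - 1) / (R : ℂ) ^ 2 * u p + laplaceBeltrami u p
    - ((n : ℂ) - 1) / (R : ℂ) ^ 2 * mean hR u

theorem isLittleHolder_linearisationFun {n : ℕ} {R d : ℝ} (hR : 0 < R) (hd : 0 < d) {α : ℝ≥0}
    {u : cylinder n R d → ℂ} (hu : IsLittleHolder α u) (hu2 : IsLittleHolderTwo α u) :
    IsLittleHolder α (linearisationFun hR u) := by
  have h := ((hu.const_smul (((n : ℂ) - 1) / (R : ℂ) ^ 2)).add (hu2.laplace hR hd)).add
    (IsLittleHolder.const α (-(((n : ℂ) - 1) / (R : ℂ) ^ 2 * mean hR u)))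
  convert h using 1
  funext p
  simp only [linearisationFun, Pi.add_apply, Pi.smul_apply, smul_eq_mul]
  ring

/-- The linearisation at the cylinder of the speed of the volume preserving mean curvature flow,
`u ↦ ((n-1)/R² + Δ) u - ((n-1)/R²) ⨍ u`, as an operator in `h^α` with domain
`h^{2+α}_{∂/∂z}`. -/
def linearisation (n : ℕ) {R d : ℝ} (hR : 0 < R) (hd : 0 < d) (α : ℝ≥0) :
    LittleHolder (cylinder n R d) α →ₗ.[ℂ] LittleHolder (cylinder n R d) α where
  domain := neumannDomain hR hd α
  toFun :=
    { toFun := fun u => LittleHolder.mk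
        (linearisationFun hR (LittleHolder.toFun (u : LittleHolder (cylinder n R d) α)))
        (isLittleHolder_linearisationFun hR hd (LittleHolder.isLittleHolder _) u.2.1)
      map_add' := by
        intro u v
        apply LittleHolder.toFun_injective
        funext p
        change linearisationFun hR (LittleHolder.toFun (u : LittleHolder (cylinder n R d) α)
            + LittleHolder.toFun (v : LittleHolder (cylinder n R d) α)) p
          = linearisationFun hR (LittleHolder.toFun (u : LittleHolder (cylinder n R d) α)) p
            + linearisationFun hR (LittleHolder.toFun (v : LittleHolder (cylinder n R d) α)) p
        have h := (u.2.1.contDiffWithinAt hR p).laplacianWithin_add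
          (v.2.1.contDiffWithinAt hR p) (uniqueDiffOn_slab n hd) (mem_slab hR p)
        simp only [linearisationFun, laplaceBeltrami, normalExt_add, h,
          mean_add hR (LittleHolder.isLittleHolder (u : LittleHolder (cylinder n R d) α))
            (LittleHolder.isLittleHolder (v : LittleHolder (cylinder n R d) α)), Pi.add_apply]
        ring
      map_smul' := by
        intro c u
        apply LittleHolder.toFun_injective
        funext p
        change linearisationFun hR
            (c • LittleHolder.toFun (u : LittleHolder (cylinder n R d) α)) p
          = c * linearisationFun hR (LittleHolder.toFun (u : LittleHolder (cylinder n R d) α)) p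
        have h := InnerProductSpace.laplacianWithin_smul c (u.2.1.contDiffWithinAt hR p)
          (uniqueDiffOn_slab n hd) (mem_slab hR p)
        simp only [linearisationFun, laplaceBeltrami, normalExt_smul, h,
          mean_smul, Pi.smul_apply, smul_eq_mul]
        ring }

/-- `λ_{l,m} = -(m²π²/d² + (l(l+n-2) - (n-1))/R²)`. -/
def lam (n : ℕ) (R d : ℝ) (l m : ℕ) : ℝ :=
  -((m : ℝ) ^ 2 * Real.pi ^ 2 / d ^ 2
    + ((l : ℝ) * ((l : ℝ) + (n : ℝ) - 2) - ((n : ℝ) - 1)) / R ^ 2)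

end CylinderFlow

end

/-! The cylinder is half of the closed model S^{n-1} × S^1. Even reflection at the two ends turns
Neumann functions into even functions on this double, and there the eigenfunctions of Δ are the
modes h(ω) w^m, with h harmonic and homogeneous of degree l. The mean sees only the constant mode,
so on modes the operator is multiplication by `symbol`: it is 0 at (0,0) and (n-1)/R² - `freq`
elsewhere, which is λ_{l,|m|}. The value 0 of the constant mode is again λ_{1,0}, so omitting (0,0)
loses nothing. What has to be proved is that the operator in h^α has no further spectrum, and this
needs Schauder theory for u - Δu = f on the cylinder.

The estimates are made on finite sums of modes, where the heat semigroup and (1-Δ)^{-1} are explicit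
multipliers, with constants independent of the number of modes. The Killing fields X_a of the model
commute with Δ and are normalised so that ∑ X_a² = Δ. Hence the parabolic maximum principle
`IsHeatSolution.nonpos` applies to Bernstein's quantity |u|² + 2t ∑|X_a u|² without curvature or
commutator terms. A barrier made of modes of degree at most one localises the estimate
(`heat_barrier`). It gives the decay of the first derivatives of the heat flow of Hölder data, and
the semigroup law then gives the second and third ones. Integrating e^{-t} e^{tΔ} over time yields
`schauder_bound`.

Even sums of modes are dense in h^α (`exists_even_restr_near`): Stone–Weierstrass approximates
uniformly, and a short heat flow then controls the Hölder seminorm of the error. This is where the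
little-Hölder condition enters. Passing to limits gives `exists_solution`. Uniqueness is the
elliptic maximum principle, in which the Neumann condition replaces the missing side at the ends.

For general μ, a bound for u and (μ-L)u bounds u - Δu, hence the Lipschitz constant of u, and
bounded Lipschitz families are relatively compact in h^α. So if μ is not an eigenvalue, μ - L is
bounded below (`exists_norm_le_shifted`). Being closed, it then has closed range; the range contains
all even modes, by division by μ - `symbol`, and is therefore everything. Conversely, symmetry of Δ
makes an eigenfunction orthogonal to every mode with a different symbol, so by density each
eigenvalue is a value of `symbol`.

The condition on R says exactly that λ_{0,1} < 0. It follows that no λ_{l,m} is positive and that 0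
occurs only for the constants and for l = 1, m = 0, that is, for the n coordinate functions:
dimension n + 1. Since only finitely many λ_{l,m} lie above any bound, the spectrum is discrete. -/

noncomputable section

namespace CylinderFlow

/-! ### Harmonic polynomials -/

section Harmonic

open MvPolynomial

variable {n : ℕ}

/-- The commutator of two derivations is a derivation, so it suffices that it kills the variables.
-/
theorem pderiv_comm (i j : Fin n) (p : MvPolynomial (Fin n) ℂ) :
    pderiv i (pderiv j p) = pderiv j (pderiv i p) := by
  have h : ⁅(pderiv i : Derivation ℂ (MvPolynomial (Fin n) ℂ) (MvPolynomial (Fin n) ℂ)),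
      (pderiv j : Derivation ℂ (MvPolynomial (Fin n) ℂ) (MvPolynomial (Fin n) ℂ))⁆ = 0 := by
    refine MvPolynomial.derivation_ext fun k => ?_
    rw [Derivation.commutator_apply]
    simp only [pderiv_X, Pi.single_apply]
    split_ifs <;> simp
  have := congrArg (fun D => D p) h
  simpa [Derivation.commutator_apply, sub_eq_zero] using this

/-- The Laplacian on polynomials. -/
def polyLaplacian (n : ℕ) : MvPolynomial (Fin n) ℂ →ₗ[ℂ] MvPolynomial (Fin n) ℂ :=
  ∑ i, (pderiv i).toLinearMap ∘ₗ (pderiv i).toLinearMap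

theorem polyLaplacian_apply (p : MvPolynomial (Fin n) ℂ) :
    polyLaplacian n p = ∑ i, pderiv i (pderiv i p) := by
  simp [polyLaplacian]

/-- The infinitesimal rotation `x_i ∂_j - x_j ∂_i` on polynomials. -/
def rotDeriv (i j : Fin n) : MvPolynomial (Fin n) ℂ →ₗ[ℂ] MvPolynomial (Fin n) ℂ :=
  (X (R := ℂ) i • pderiv (R := ℂ) j - X (R := ℂ) j • pderiv i :
    Derivation ℂ (MvPolynomial (Fin n) ℂ) (MvPolynomial (Fin n) ℂ)).toLinearMap

theorem rotDeriv_apply (i j : Fin n) (p : MvPolynomial (Fin n) ℂ) :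
    rotDeriv i j p = X i * pderiv j p - X j * pderiv i p := by
  simp [rotDeriv]

/-- Harmonic homogeneous polynomials of degree `l`. -/
def Harm (n l : ℕ) : Submodule ℂ (MvPolynomial (Fin n) ℂ) :=
  homogeneousSubmodule (Fin n) ℂ l ⊓ LinearMap.ker (polyLaplacian n)

theorem mem_Harm {l : ℕ} {p : MvPolynomial (Fin n) ℂ} :
    p ∈ Harm n l ↔ p.IsHomogeneous l ∧ ∑ i, pderiv i (pderiv i p) = 0 := by
  simp [Harm, polyLaplacian_apply]

theorem pderiv_X_mul (k i : Fin n) (p : MvPolynomial (Fin n) ℂ) :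
    pderiv k (X i * p) = (if i = k then p else 0) + X i * pderiv k p := by
  rw [Derivation.leibniz, pderiv_X, smul_eq_mul, smul_eq_mul, Pi.single_apply, add_comm]
  split_ifs <;> simp

theorem isHomogeneous_X_mul_pderiv {l : ℕ} {p : MvPolynomial (Fin n) ℂ} (hp : p.IsHomogeneous l)
    (i j : Fin n) : (X i * pderiv j p).IsHomogeneous l := by
  rcases l with _ | l
  · rw [← totalDegree_zero_iff_isHomogeneous, totalDegree_eq_zero_iff_eq_C] at hp
    rw [hp, pderiv_C, mul_zero]
    exact isHomogeneous_zero _ _ _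
  · have h := (isHomogeneous_X ℂ i).mul (hp.pderiv (i := j))
    rwa [Nat.add_sub_cancel, add_comm 1 l] at h

/-- For harmonic p one has Δ(x_a ∂_b p) = 2 ∂_a ∂_b p, which is symmetric in a and b and so cancels
in the antisymmetric combination. -/
theorem rotDeriv_mem_Harm {l : ℕ} {p : MvPolynomial (Fin n) ℂ} (hp : p ∈ Harm n l)
    (i j : Fin n) : rotDeriv i j p ∈ Harm n l := by
  rw [mem_Harm] at hp ⊢
  rw [rotDeriv_apply]
  refine ⟨(isHomogeneous_X_mul_pderiv hp.1 i j).sub (isHomogeneous_X_mul_pderiv hp.1 j i), ?_⟩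
  have key : ∀ a b : Fin n, ∑ k, pderiv k (pderiv k (X a * pderiv b p))
      = 2 * pderiv a (pderiv b p) := by
    intro a b
    have h1 : ∀ k, pderiv k (pderiv k (X a * pderiv b p))
        = (if a = k then 2 * pderiv k (pderiv b p) else 0)
          + X a * pderiv b (pderiv k (pderiv k p)) := by
      intro k
      rw [pderiv_X_mul, map_add, pderiv_X_mul, pderiv_comm k b, pderiv_comm k b]
      by_cases h : a = k
      · simp only [if_pos h, pderiv_comm b k]; ring
      · simp only [if_neg h, map_zero]; ring
    rw [Finset.sum_congr rfl fun k _ => h1 k, Finset.sum_add_distrib, ← Finset.mul_sum,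
      ← map_sum, hp.2]
    simp
  simp only [map_sub, Finset.sum_sub_distrib, key]
  rw [pderiv_comm i j, sub_self]

/-- The Casimir operator of the rotations acts on harmonic homogeneous polynomials of degree `l`
as multiplication by `-2 l (l + n - 2)`. -/
theorem sum_rotDeriv_rotDeriv {l : ℕ} {p : MvPolynomial (Fin n) ℂ} (hp : p ∈ Harm n l) :
    ∑ i, ∑ j, rotDeriv i j (rotDeriv i j p)
      = (-(2 * (l : ℂ) * ((l : ℂ) + (n : ℂ) - 2))) • p := by
  rw [mem_Harm] at hp
  have hE : ∑ i, X i * pderiv i p = (l : MvPolynomial (Fin n) ℂ) * p := by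
    simpa using hp.1.sum_X_mul_pderiv
  -- Euler's identity for ∂_j p, obtained by differentiating the one for p. The factor l - 1 is thus
  -- a ring element, and l = 0 needs no separate case.
  have hE2 : ∀ j, ∑ i, X i * pderiv i (pderiv j p)
      = ((l : MvPolynomial (Fin n) ℂ) - 1) * pderiv j p := by
    intro j
    have h := congrArg (pderiv j) hE
    rw [map_sum, Derivation.leibniz, Derivation.map_natCast, smul_zero, add_zero, smul_eq_mul] at h
    simp only [pderiv_X_mul, Finset.sum_add_distrib, Finset.sum_ite_eq', Finset.mem_univ, if_true]
      at h
    rw [sub_mul, one_mul, ← h]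
    rw [add_sub_cancel_left]
    exact Finset.sum_congr rfl fun i _ => by rw [pderiv_comm]
  -- After cancellation the right side is x_i²∂_j²p + x_j²∂_i²p - 2x_i x_j ∂_i∂_j p - x_i∂_i p -
  -- x_j∂_j p, plus 2x_i∂_i p on the diagonal. Summed with Euler's identity and Δp = 0 this is
  -- -2l(l-1) - 2nl + 2l = -2l(l+n-2) times p.
  have h1 : ∀ i j : Fin n, rotDeriv i j (rotDeriv i j p)
      = ((X i * pderiv i p) + X j * pderiv j p) + X i * X i * pderiv j (pderiv j p)
        + X j * X j * pderiv i (pderiv i p) - 2 * (X i * (X j * pderiv j (pderiv i p)))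
        - (X i * pderiv i p + X j * pderiv j p)
        + (if i = j then 4 * (X i * pderiv i p) else 0)
        - 2 * (X i * pderiv i p) - 2 * (X j * pderiv j p) + (X i * pderiv i p)
        + (X j * pderiv j p) - (if i = j then 2 * (X i * pderiv i p) else 0) := by
    intro i j
    rw [rotDeriv_apply, rotDeriv_apply]
    simp only [map_sub, pderiv_X_mul, pderiv_comm i j]
    by_cases h : i = j
    · subst h
      simp only [if_true]
      ring
    · simp only [if_neg h, if_neg (Ne.symm h), if_true]
      ring
  simp only [h1, Finset.sum_add_distrib, Finset.sum_sub_distrib, ← Finset.mul_sum, hE2, hE,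
    Finset.sum_const, Finset.card_univ, Fintype.card_fin, nsmul_eq_mul, Finset.sum_ite_eq,
    Finset.mem_univ, if_true, hp.2, mul_zero, ← Finset.sum_mul]
  simp only [mul_left_comm (X _) ((l : MvPolynomial (Fin n) ℂ) - 1),
    mul_left_comm (X _) (n : MvPolynomial (Fin n) ℂ), ← Finset.mul_sum, hE]
  rw [smul_eq_C_mul]
  simp only [map_neg, map_mul, map_sub, map_add, map_natCast, map_ofNat]
  ring

/-- `∑ x_i²`. -/
def sqNorm (n : ℕ) : MvPolynomial (Fin n) ℂ := ∑ i, X i * X i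

theorem isHomogeneous_sqNorm : (sqNorm n).IsHomogeneous 2 :=
  IsHomogeneous.sum _ _ _ fun i _ => (isHomogeneous_X ℂ i).mul (isHomogeneous_X ℂ i)

/-- The cross term 2∇|x|²·∇q = 4 x·∇q equals 4l q by Euler's identity. The lemma makes Δ explicitly
invertible on multiples of |x|². -/
theorem polyLaplacian_sqNorm_mul {l : ℕ} {q : MvPolynomial (Fin n) ℂ} (hq : q.IsHomogeneous l) :
    polyLaplacian n (sqNorm n * q)
      = ((2 * n + 4 * l : ℕ) : MvPolynomial (Fin n) ℂ) * q + sqNorm n * polyLaplacian n q := by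
  have hE : ∑ i, X i * pderiv i q = (l : MvPolynomial (Fin n) ℂ) * q := by
    simpa using hq.sum_X_mul_pderiv
  have hs : ∀ k, pderiv k (sqNorm n) = 2 * X k := by
    intro k
    simp only [sqNorm, map_sum, pderiv_X_mul, pderiv_X, Pi.single_apply, Finset.sum_add_distrib,
      mul_ite, mul_one, mul_zero, Finset.sum_ite_eq', Finset.mem_univ, if_true]
    simp [two_mul]
  have h1 : ∀ k, pderiv k (pderiv k (sqNorm n * q))
      = 2 * q + 4 * (X k * pderiv k q) + sqNorm n * pderiv k (pderiv k q) := by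
    intro k
    have h2 : pderiv k (2 * X k : MvPolynomial (Fin n) ℂ) = 2 := by
      rw [two_mul, map_add, pderiv_X_self]; norm_num
    simp only [Derivation.leibniz, map_add, smul_eq_mul, hs, h2]
    ring
  rw [polyLaplacian_apply, polyLaplacian_apply, Finset.sum_congr rfl fun k _ => h1 k]
  simp only [Finset.sum_add_distrib, ← Finset.mul_sum, hE, Finset.sum_const, Finset.card_univ,
    Fintype.card_fin, nsmul_eq_mul]
  push_cast
  ring

/-- Homogeneous polynomials of degree `l` of the form `|x|^{2j} h` with `h` harmonic. -/
def harmonicMultiples (n l : ℕ) : Set (MvPolynomial (Fin n) ℂ) :=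
  {q | q.IsHomogeneous l ∧ (∃ c : ℕ, sqNorm n * polyLaplacian n q
      = (c : MvPolynomial (Fin n) ℂ) * q) ∧
    ∃ k j : ℕ, ∃ h ∈ Harm n k, q = sqNorm n ^ j * h}

/-- Every homogeneous polynomial is a sum of polynomials `|x|^{2j} h` with `h` harmonic. -/
theorem mem_span_harmonicMultiples (hn : 1 ≤ n) (l : ℕ) (p : MvPolynomial (Fin n) ℂ)
    (hp : p.IsHomogeneous l) : p ∈ Submodule.span ℂ (harmonicMultiples n l) := by
  have harm : ∀ l, ∀ p ∈ Harm n l, p ∈ Submodule.span ℂ (harmonicMultiples n l) := by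
    intro l p hp
    have h := LinearMap.mem_ker.1 hp.2
    exact Submodule.subset_span ⟨(mem_Harm.1 hp).1, ⟨0, by simp [h]⟩, l, 0, p, hp, by simp⟩
  induction l using Nat.strong_induction_on generalizing p with
  | _ l ih =>
  by_cases hl : l < 2
  · refine harm l p ⟨hp, LinearMap.mem_ker.2 ?_⟩
    rw [polyLaplacian_apply]
    refine Finset.sum_eq_zero fun i _ => ?_
    have h := hp.pderiv (i := i)
    have : l - 1 = 0 := by omega
    rw [this, ← totalDegree_zero_iff_isHomogeneous, totalDegree_eq_zero_iff_eq_C] at h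
    rw [h, pderiv_C]
  · obtain ⟨k, rfl⟩ : ∃ k, l = k + 2 := ⟨l - 2, by omega⟩
    have hlap : (polyLaplacian n p).IsHomogeneous k := by
      rw [polyLaplacian_apply]
      exact IsHomogeneous.sum _ _ _ fun i _ => (hp.pderiv (i := i)).pderiv (i := i)
    have h1 := ih k (by omega) _ hlap
    -- Surjectivity of Δ from degree k + 2 to degree k. If |x|²Δq = c q, then Δ(|x|² q) = (2n + 4k +
    -- c) q, so |x|² q is a preimage up to a scalar and has the same property with constant 2n + 4k
    -- + c. As c is a natural number and n ≥ 1, the scalar never vanishes.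
    have h2 : ∀ q ∈ Submodule.span ℂ (harmonicMultiples n k),
        ∃ q' ∈ Submodule.span ℂ (harmonicMultiples n (k + 2)), q'.IsHomogeneous (k + 2) ∧
          polyLaplacian n q' = q := by
      intro q hq
      induction hq using Submodule.span_induction with
      | mem q hq =>
        obtain ⟨hq1, ⟨c, hc⟩, a, j, h, hh, rfl⟩ := hq
        set q := sqNorm n ^ j * h
        have e := polyLaplacian_sqNorm_mul hq1
        rw [hc, ← add_mul, ← Nat.cast_add] at e
        have hN : ((2 * n + 4 * k + c : ℕ) : ℂ) ≠ 0 := by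
          exact_mod_cast (by omega : 2 * n + 4 * k + c ≠ 0)
        have hom : (sqNorm n * q).IsHomogeneous (k + 2) := by
          rw [add_comm]; exact isHomogeneous_sqNorm.mul hq1
        refine ⟨(((2 * n + 4 * k + c : ℕ) : ℂ)⁻¹) • (sqNorm n * q), Submodule.smul_mem _ _
          (Submodule.subset_span ⟨hom, ⟨2 * n + 4 * k + c, ?_⟩, a, j + 1, h, hh, ?_⟩), ?_, ?_⟩
        · rw [e]; ring
        · simp only [q]; ring
        · exact (homogeneousSubmodule (Fin n) ℂ (k + 2)).smul_mem _ hom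
        · rw [map_smul, e, smul_eq_C_mul, ← map_natCast (C (σ := Fin n) (R := ℂ)), ← mul_assoc,
            ← C_mul, inv_mul_cancel₀ hN, C_1, one_mul]
      | zero => exact ⟨0, Submodule.zero_mem _, isHomogeneous_zero _ _ _, map_zero _⟩
      | add x y _ _ hx hy =>
        obtain ⟨x', hx1, hx2, hx3⟩ := hx
        obtain ⟨y', hy1, hy2, hy3⟩ := hy
        exact ⟨x' + y', Submodule.add_mem _ hx1 hy1, hx2.add hy2, by rw [map_add, hx3, hy3]⟩
      | smul c x _ hx =>
        obtain ⟨x', hx1, hx2, hx3⟩ := hx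
        exact ⟨c • x', Submodule.smul_mem _ _ hx1,
          (homogeneousSubmodule (Fin n) ℂ (k + 2)).smul_mem _ hx2, by rw [map_smul, hx3]⟩
    obtain ⟨q', hq1, hq2, hq3⟩ := h2 _ h1
    have h3 : p - q' ∈ Submodule.span ℂ (harmonicMultiples n (k + 2)) :=
      harm _ _ ⟨hp.sub hq2, LinearMap.mem_ker.2 (by rw [map_sub, hq3, sub_self])⟩
    simpa using Submodule.add_mem _ h3 hq1

/-- In dimension one there are no rotations, so the Casimir operator is 0; on degree l it is also
multiplication by -2l(l-1), which is nonzero for l ≥ 2. -/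
theorem Harm_one_eq_zero {l : ℕ} (hl : 2 ≤ l) {p : MvPolynomial (Fin 1) ℂ} (hp : p ∈ Harm 1 l) :
    p = 0 := by
  have h := sum_rotDeriv_rotDeriv hp
  have h0 : ∀ q, rotDeriv (0 : Fin 1) 0 q = 0 := fun q => by rw [rotDeriv_apply, sub_self]
  simp only [Finset.univ_unique, Fin.default_eq_zero, Fin.isValue, Finset.sum_singleton, h0] at h
  have h2 : (2 : ℝ) ≤ l := by exact_mod_cast hl
  refine (smul_eq_zero.1 h.symm).resolve_left ?_
  have : (-(2 * (l : ℝ) * ((l : ℝ) + (1 : ℕ) - 2))) ≠ 0 := by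
    push_cast
    nlinarith
  exact_mod_cast this

/-- For n ≥ 2 the power (x_0 + i x_1)^l is harmonic, because 1 + i² = 0, and equals 1 at the first
basis vector. For n = 1 the polynomials 1 and x serve. -/
theorem exists_mem_Harm_eval_ne_zero (hn : 1 ≤ n) (l : ℕ) (hl : n = 1 → l ≤ 1) :
    ∃ h ∈ Harm n l, eval (fun i => if i = (⟨0, hn⟩ : Fin n) then (1 : ℂ) else 0) h ≠ 0 := by
  have hX : ∀ i : Fin n, X (R := ℂ) i ∈ Harm n 1 := fun i => by
    refine mem_Harm.2 ⟨isHomogeneous_X ℂ i, Finset.sum_eq_zero fun j _ => ?_⟩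
    rw [pderiv_X, Pi.single_apply]
    split_ifs <;> simp
  by_cases h1 : n = 1
  · have h2 : l = 0 ∨ l = 1 := by have := hl h1; omega
    rcases h2 with rfl | rfl
    · exact ⟨1, mem_Harm.2 ⟨isHomogeneous_one _ _, by simp⟩, by simp⟩
    · exact ⟨X ⟨0, hn⟩, hX _, by simp⟩
  · set a : Fin n := ⟨0, hn⟩
    set b : Fin n := ⟨1, by omega⟩
    have hab : a ≠ b := by simp [a, b]
    set f : MvPolynomial (Fin n) ℂ := X a + C Complex.I * X b
    have hf : f.IsHomogeneous 1 := (isHomogeneous_X ℂ a).add (by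
      simpa using (isHomogeneous_C (Fin n) Complex.I).mul (isHomogeneous_X ℂ b))
    have hd : ∀ i, pderiv i f = C ((if a = i then 1 else 0) + Complex.I * if b = i then 1 else 0) := by
      intro i
      simp only [f, map_add, pderiv_C_mul, pderiv_X, Pi.single_apply, C_mul]
      split_ifs <;> simp
    have hpow : ∀ (k : ℕ) (i : Fin n), pderiv i (f ^ k)
        = C ((if a = i then 1 else 0) + Complex.I * if b = i then 1 else 0)
          * ((k : MvPolynomial (Fin n) ℂ) * f ^ (k - 1)) := by
      intro k i
      rw [Derivation.leibniz_pow, hd, nsmul_eq_mul, smul_eq_mul]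
      ring
    refine ⟨f ^ l, mem_Harm.2 ⟨by simpa using hf.pow l, ?_⟩, ?_⟩
    · have h2 : ∀ i, pderiv i (pderiv i (f ^ l))
          = ((l * (l - 1) : ℕ) : MvPolynomial (Fin n) ℂ) * f ^ (l - 2) * (C ((if a = i then 1 else 0)
            - if b = i then 1 else 0)) := by
        intro i
        rw [hpow, pderiv_C_mul, Derivation.leibniz, hpow, Derivation.map_natCast, smul_zero,
          add_zero, smul_eq_mul]
        have : l - 1 - 1 = l - 2 := by omega
        rw [this]
        have e2 : (C ((if a = i then 1 else 0) - if b = i then 1 else 0) : MvPolynomial (Fin n) ℂ)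
            = C ((if a = i then 1 else 0) + Complex.I * if b = i then 1 else 0) *
              C ((if a = i then 1 else 0) + Complex.I * if b = i then 1 else 0) := by
          rw [← C_mul]
          congr 1
          by_cases ha : a = i
          · have hb : b ≠ i := fun h => hab (ha.trans h.symm)
            simp [ha, hb]
          · by_cases hb : b = i <;> simp [ha, hb]
        rw [e2]
        push_cast
        ring
      rw [Finset.sum_congr rfl fun i _ => h2 i, ← Finset.mul_sum, ← map_sum]
      simp
    · simp [f, Ne.symm hab]

end Harmonic

/-! ### Finite sums of modes on the closed model `S^{n-1} × S¹` -/

section Modes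

/-- The closed model of the cylinder, the product of the unit sphere and the unit circle. -/
abbrev Model (n : ℕ) : Type := Metric.sphere (0 : EuclideanSpace ℝ (Fin n)) 1 × Circle

/-- Formal finite sums of terms `h(ω) w^m`, with `h` harmonic and homogeneous of degree `l`. -/
abbrev Modes (n : ℕ) : Type := DirectSum (ℕ × ℤ) fun i => Harm n i.1

variable {n : ℕ}

theorem continuous_eval_coe (h : MvPolynomial (Fin n) ℂ) :
    Continuous fun x : EuclideanSpace ℝ (Fin n) => MvPolynomial.eval (fun k => (x k : ℂ)) h := by
  have h1 : Continuous fun x : EuclideanSpace ℝ (Fin n) => fun k => (x k : ℂ) := by fun_prop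
  exact (MvPolynomial.continuous_eval h).comp h1

theorem continuous_circle_coe : Continuous fun w : Circle => (w : ℂ) := continuous_induced_dom

/-- The function `h(ω) w^m` on the model. -/
def evalMode (i : ℕ × ℤ) : Harm n i.1 →ₗ[ℂ] C(Model n, ℂ) where
  toFun h := ⟨fun p => MvPolynomial.eval (fun k => ((p.1 : EuclideanSpace ℝ (Fin n)) k : ℂ)) h.1
      * ((p.2 ^ i.2 : Circle) : ℂ),
    ((continuous_eval_coe h.1).comp (continuous_subtype_val.comp continuous_fst)).mul
      (continuous_circle_coe.comp (Continuous.zpow (continuous_snd (Y := Circle)) i.2))⟩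
  map_add' h h' := by
    ext p
    simp [add_mul]
  map_smul' c h := by
    ext p
    simp [mul_assoc, MvPolynomial.smul_eval]

/-- The function on the model given by a sum of modes. -/
def ev : Modes n →ₗ[ℂ] C(Model n, ℂ) := DirectSum.toModule ℂ _ _ evalMode

theorem ev_lof (i : ℕ × ℤ) (h : Harm n i.1) (p : Model n) :
    ev (DirectSum.lof ℂ _ (fun i : ℕ × ℤ => Harm n i.1) i h) p
      = MvPolynomial.eval (fun k => ((p.1 : EuclideanSpace ℝ (Fin n)) k : ℂ)) h.1
        * ((p.2 ^ i.2 : Circle) : ℂ) := by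
  rw [ev, DirectSum.toModule_lof]
  rfl

theorem Modes.induction {P : Modes n → Prop} (v : Modes n)
    (mode : ∀ i h, P (DirectSum.lof ℂ _ (fun i : ℕ × ℤ => Harm n i.1) i h))
    (add : ∀ u v, P u → P v → P (u + v)) : P v := by
  refine DirectSum.induction_on v ?_ (fun i x => mode i x) add
  simpa using mode (0, 0) 0

/-- Multiplication of each mode by a scalar. -/
def scale (c : ℕ × ℤ → ℂ) : Modes n →ₗ[ℂ] Modes n :=
  DirectSum.lmap fun i => c i • LinearMap.id

theorem scale_lof (c : ℕ × ℤ → ℂ) (i : ℕ × ℤ) (h : Harm n i.1) :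
    scale c (DirectSum.lof ℂ _ (fun i : ℕ × ℤ => Harm n i.1) i h)
      = c i • DirectSum.lof ℂ _ (fun i : ℕ × ℤ => Harm n i.1) i h := by
  rw [scale, DirectSum.lmap_lof]
  simp

theorem scale_scale (c c' : ℕ × ℤ → ℂ) (v : Modes n) :
    scale c (scale c' v) = scale (fun i => c i * c' i) v := by
  induction v using Modes.induction with
  | mode i h => simp only [scale_lof, map_smul, smul_smul, mul_comm]
  | add u v hu hv => simp only [map_add, hu, hv]

theorem scale_one (v : Modes n) : scale (fun _ => 1) v = v := by
  induction v using Modes.induction with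
  | mode i h => simp only [scale_lof, one_smul]
  | add u v hu hv => simp only [map_add, hu, hv]

variable (R d : ℝ)

/-- The action of an infinitesimal isometry on the modes of a given type. -/
def fieldMode (a : Option (Fin n × Fin n)) (i : ℕ × ℤ) : Harm n i.1 →ₗ[ℂ] Harm n i.1 :=
  match a with
  | none => (Complex.I * i.2 * (Real.pi / d)) • LinearMap.id
  | some jk => (((Real.sqrt 2 * R)⁻¹ : ℝ) : ℂ) •
      (rotDeriv jk.1 jk.2).restrict fun _ hp => rotDeriv_mem_Harm hp jk.1 jk.2

/-- The infinitesimal isometries, normalised so that the sum of their squares is the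
Laplacian. -/
def field (a : Option (Fin n × Fin n)) : Modes n →ₗ[ℂ] Modes n :=
  DirectSum.lmap (fieldMode R d a)

theorem field_lof (a : Option (Fin n × Fin n)) (i : ℕ × ℤ) (h : Harm n i.1) :
    field R d a (DirectSum.lof ℂ _ (fun i : ℕ × ℤ => Harm n i.1) i h)
      = DirectSum.lof ℂ _ (fun i : ℕ × ℤ => Harm n i.1) i (fieldMode R d a i h) := by
  rw [field, DirectSum.lmap_lof]

/-- Each field preserves the type (l, m), while a multiplier is scalar on each type. -/
theorem scale_field (c : ℕ × ℤ → ℂ) (a : Option (Fin n × Fin n)) (v : Modes n) :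
    scale c (field R d a v) = field R d a (scale c v) := by
  induction v using Modes.induction with
  | mode i h => simp only [scale_lof, field_lof, map_smul]
  | add u v hu hv => simp only [map_add, hu, hv]

/-- The eigenvalue of `-Δ` on a mode. -/
def freq (n : ℕ) (R d : ℝ) (i : ℕ × ℤ) : ℝ :=
  (i.2 : ℝ) ^ 2 * Real.pi ^ 2 / d ^ 2 + (i.1 : ℝ) * ((i.1 : ℝ) + (n : ℝ) - 2) / R ^ 2

/-- The Laplacian on sums of modes. -/
def modeLaplacian : Modes n →ₗ[ℂ] Modes n := scale fun i => -(freq n R d i : ℂ)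

/-- The heat semigroup on sums of modes. -/
def heat (t : ℝ) : Modes n →ₗ[ℂ] Modes n := scale fun i => (Real.exp (-(freq n R d i * t)) : ℂ)

theorem heat_zero (v : Modes n) : heat R d 0 v = v := by
  simp only [heat, mul_zero, neg_zero, Real.exp_zero, Complex.ofReal_one, scale_one]

theorem heat_heat (s t : ℝ) (v : Modes n) : heat R d s (heat R d t v) = heat R d (s + t) v := by
  rw [heat, heat, heat, scale_scale]
  congr 2
  funext i
  rw [← Complex.ofReal_mul, ← Real.exp_add]
  congr 2
  ring

theorem field_heat (t : ℝ) (a : Option (Fin n × Fin n)) (v : Modes n) :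
    field R d a (heat R d t v) = heat R d t (field R d a v) := (scale_field R d _ a v).symm

variable {R d}

/-- The axial field contributes (iπm/d)². The sum over ordered pairs (i, j) counts each rotation
plane twice, which the factor √2 in the normalisation corrects: the Casimir value -2l(l+n-2) is
divided by 2R². -/
theorem sum_field_field (hR : 0 < R) (v : Modes n) :
    ∑ a, field R d a (field R d a v) = modeLaplacian R d v := by
  induction v using Modes.induction with
  | add u v hu hv => simp only [map_add, Finset.sum_add_distrib, hu, hv]
  | mode i h =>
    simp only [field_lof, modeLaplacian, scale_lof]
    rw [← map_sum, ← map_smul]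
    congr 1
    rw [Fintype.sum_option, Fintype.sum_prod_type]
    apply Subtype.ext
    have hc := sum_rotDeriv_rotDeriv h.2
    have h2 : (((Real.sqrt 2 * R)⁻¹ : ℝ) : ℂ) * (((Real.sqrt 2 * R)⁻¹ : ℝ) : ℂ)
        = ((2 * R ^ 2)⁻¹ : ℝ) := by
      rw [← Complex.ofReal_mul]
      congr 1
      rw [← mul_inv]
      congr 1
      have := Real.mul_self_sqrt (show (0 : ℝ) ≤ 2 by norm_num)
      linear_combination R ^ 2 * this
    simp only [fieldMode, LinearMap.smul_apply, LinearMap.id_apply, Submodule.coe_add,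
      Submodule.coe_sum, Submodule.coe_smul, LinearMap.coe_restrict_apply, map_smul, smul_smul]
    simp only [← Finset.smul_sum, hc, h2, smul_smul, ← add_smul]
    congr 1
    rw [freq]
    push_cast
    have hR' : (R : ℂ) ≠ 0 := by exact_mod_cast hR.ne'
    have hI := Complex.I_sq
    field_simp
    linear_combination ((i.2 : ℂ) ^ 2 * (Real.pi : ℂ) ^ 2 / (d : ℂ) ^ 2 * (R : ℂ) ^ 2) * hI

/-! ### Derivatives along the isometries -/

/-- Chain rule for polynomials. -/
theorem hasFDerivAt_eval {E : Type*} [NormedAddCommGroup E] [NormedSpace ℝ E]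
    (p : MvPolynomial (Fin n) ℂ) {γ : E → Fin n → ℝ} {γ' : Fin n → E →L[ℝ] ℝ} {y : E}
    (h : ∀ k, HasFDerivAt (fun y => γ y k) (γ' k) y) :
    HasFDerivAt (fun y => MvPolynomial.eval (fun k => (γ y k : ℂ)) p)
      (∑ k, (γ' k).smulRight
        (MvPolynomial.eval (fun k => (γ y k : ℂ)) (MvPolynomial.pderiv k p))) y := by
  induction p using MvPolynomial.induction_on with
  | C c =>
    simp only [MvPolynomial.eval_C]
    refine (hasFDerivAt_const c y).congr_fderiv ?_
    ext w
    simp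
  | add p q hp hq =>
    simp only [map_add]
    refine (hp.fun_add hq).congr_fderiv ?_
    ext w
    simp [Finset.sum_add_distrib]
  | mul_X p i hp =>
    simp only [map_mul, MvPolynomial.eval_X]
    have h1 : HasFDerivAt (fun y => (γ y i : ℂ)) (Complex.ofRealCLM.comp (γ' i)) y :=
      Complex.ofRealCLM.hasFDerivAt.comp y (h i)
    refine (hp.fun_mul h1).congr_fderiv ?_
    ext w
    simp only [add_apply, FunLike.coe_smul, Pi.smul_apply,
      ContinuousLinearMap.coe_comp, Function.comp_apply, Complex.ofRealCLM_apply,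
      sum_apply, ContinuousLinearMap.smulRight_apply, Derivation.leibniz,
      MvPolynomial.pderiv_X, map_add, smul_eq_mul, map_mul, MvPolynomial.eval_X, smul_add,
      Finset.sum_add_distrib, Complex.real_smul, Finset.mul_sum]
    congr 1
    · rw [Finset.sum_eq_single i]
      · simp [mul_comm]
      · intro b _ hb
        simp [Ne.symm hb]
      · simp
    · exact Finset.sum_congr rfl fun k _ => by ring

theorem hasDerivAt_eval (p : MvPolynomial (Fin n) ℂ) {γ : ℝ → Fin n → ℝ} {γ' : Fin n → ℝ} {s : ℝ}
    (h : ∀ k, HasDerivAt (fun s => γ s k) (γ' k) s) :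
    HasDerivAt (fun s => MvPolynomial.eval (fun k => (γ s k : ℂ)) p)
      (∑ k, (γ' k : ℂ) *
        MvPolynomial.eval (fun k => (γ s k : ℂ)) (MvPolynomial.pderiv k p)) s := by
  have := (hasFDerivAt_eval p fun k => (h k).hasFDerivAt).hasDerivAt
  simpa using this

/-- The rotation by the angle `s` in the plane of the `i`-th and `j`-th coordinates. -/
def rotVec (i j : Fin n) (s : ℝ) (x : EuclideanSpace ℝ (Fin n)) : EuclideanSpace ℝ (Fin n) :=
  WithLp.toLp 2 fun k =>
    if i = j then x k else
    if k = i then Real.cos s * x i - Real.sin s * x j else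
    if k = j then Real.sin s * x i + Real.cos s * x j else x k

theorem rotVec_zero (i j : Fin n) (x : EuclideanSpace ℝ (Fin n)) : rotVec i j 0 x = x := by
  ext k
  simp only [rotVec, Real.cos_zero, Real.sin_zero]
  split_ifs with h1 h2 h3
  · rfl
  · subst h2; ring
  · subst h3; ring
  · rfl

theorem hasDerivAt_rotVec (i j : Fin n) (s : ℝ) (x : EuclideanSpace ℝ (Fin n)) (k : Fin n) :
    HasDerivAt (fun s => rotVec i j s x k)
      ((if k = j then rotVec i j s x i else 0) - (if k = i then rotVec i j s x j else 0)) s := by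
  have hc := Real.hasDerivAt_cos s
  have hs := Real.hasDerivAt_sin s
  simp only [rotVec]
  by_cases h : i = j
  · subst h
    simp only [if_true, sub_self]
    exact hasDerivAt_const s (x k)
  · simp only [if_neg h, if_true, if_neg (Ne.symm h)]
    by_cases h1 : k = i
    · subst h1
      simp only [if_true, if_neg h]
      exact ((hc.mul_const (x k)).fun_sub (hs.mul_const (x j))).congr_deriv (by ring)
    · by_cases h2 : k = j
      · subst h2
        simp only [if_true, if_neg h1]
        exact ((hs.mul_const (x i)).fun_add (hc.mul_const (x k))).congr_deriv (by ring)
      · simp only [if_neg h1, if_neg h2, sub_self]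
        exact hasDerivAt_const s (x k)

/-- The sum of squares has derivative zero in s, hence keeps its value at s = 0. This treats the
degenerate case i = j together with the others. -/
theorem norm_rotVec (i j : Fin n) (s : ℝ) (x : EuclideanSpace ℝ (Fin n)) :
    ‖rotVec i j s x‖ = ‖x‖ := by
  have h : ∀ s, HasDerivAt (fun s => ∑ k, rotVec i j s x k ^ 2) 0 s := by
    intro s
    refine (HasDerivAt.fun_sum (u := Finset.univ) fun k _ =>
      (hasDerivAt_rotVec i j s x k).fun_pow 2).congr_deriv ?_
    simp only [mul_sub, mul_ite, mul_zero, Finset.sum_sub_distrib, Finset.sum_ite_eq',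
      Finset.mem_univ, if_true]
    ring
  have h2 := is_const_of_deriv_eq_zero (fun s => (h s).differentiableAt) (fun s => (h s).deriv) s 0
  simp only [rotVec_zero] at h2
  rw [EuclideanSpace.norm_eq, EuclideanSpace.norm_eq]
  simp only [Real.norm_eq_abs, sq_abs]
  rw [h2]

variable (R d)

/-- The one-parameter groups of isometries of the model. -/
def flow (a : Option (Fin n × Fin n)) (s : ℝ) (p : Model n) : Model n :=
  match a with
  | none => (p.1, Circle.exp (Real.pi / d * s) * p.2)
  | some ij => (⟨rotVec ij.1 ij.2 ((Real.sqrt 2 * R)⁻¹ * s) p.1, by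
      rw [mem_sphere_zero_iff_norm, norm_rotVec]; exact norm_eq_of_mem_sphere p.1⟩, p.2)

theorem flow_zero (a : Option (Fin n × Fin n)) (p : Model n) : flow R d a 0 p = p := by
  rcases a with _ | ij
  · simp [flow]
  · simp [flow, rotVec_zero]

theorem hasDerivAt_circle_exp_zpow (m : ℤ) (c s : ℝ) (w : Circle) :
    HasDerivAt (fun s => (((Circle.exp (c * s) * w) ^ m : Circle) : ℂ))
      (Complex.I * m * c * (((Circle.exp (c * s) * w) ^ m : Circle) : ℂ)) s := by
  have e : ∀ s, (((Circle.exp (c * s) * w) ^ m : Circle) : ℂ)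
      = Complex.exp (Complex.I * m * c * s) * ((w ^ m : Circle) : ℂ) := by
    intro s
    rw [mul_zpow, ← Circle.exp_intCast_mul, Circle.coe_mul, Circle.coe_exp]
    congr 2
    push_cast
    ring
  simp only [e]
  have h1 : HasDerivAt (fun s : ℝ => Complex.I * m * c * (s : ℂ)) (Complex.I * m * c) s := by
    simpa using (Complex.ofRealCLM.hasDerivAt (x := s)).const_mul (Complex.I * m * c)
  exact ((h1.cexp).mul_const ((w ^ m : Circle) : ℂ)).congr_deriv (by ring)

/-- Links the algebra with the analysis: the operators `field`, defined on polynomials, are the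
derivatives along actual isometries of the model. -/
theorem hasDerivAt_flow (v : Modes n) (a : Option (Fin n × Fin n)) (p : Model n) (s : ℝ) :
    HasDerivAt (fun s => ev v (flow R d a s p)) (ev (field R d a v) (flow R d a s p)) s := by
  induction v using Modes.induction with
  | add u v hu hv => simpa only [map_add, ContinuousMap.add_apply] using hu.fun_add hv
  | mode i h =>
    rw [field_lof]
    simp only [ev_lof]
    rcases a with _ | ⟨j, k⟩
    · simp only [flow, fieldMode, LinearMap.smul_apply, LinearMap.id_apply, Submodule.coe_smul,
        MvPolynomial.smul_eval]
      refine ((hasDerivAt_circle_exp_zpow i.2 (Real.pi / d) s p.2).const_mul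
        (MvPolynomial.eval (fun k => ((p.1 : EuclideanSpace ℝ (Fin n)) k : ℂ)) h.1)).congr_deriv ?_
      push_cast
      ring
    · simp only [flow, fieldMode, LinearMap.smul_apply, Submodule.coe_smul,
        LinearMap.coe_restrict_apply, MvPolynomial.smul_eval]
      set c : ℝ := (Real.sqrt 2 * R)⁻¹
      have h1 : ∀ q, HasDerivAt (fun s => rotVec j k (c * s) p.1 q)
          (c * ((if q = k then rotVec j k (c * s) p.1 j else 0)
            - (if q = j then rotVec j k (c * s) p.1 k else 0))) s := by
        intro q
        have h2 : HasDerivAt (fun s : ℝ => c * s) c s := by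
          simpa using (hasDerivAt_id s).const_mul c
        have h3 := (hasDerivAt_rotVec j k (c * s) p.1 q).comp s h2
        rw [mul_comm] at h3
        exact h3
      refine ((hasDerivAt_eval h.1 h1).mul_const ((p.2 ^ i.2 : Circle) : ℂ)).congr_deriv ?_
      congr 1
      rw [rotDeriv_apply]
      simp only [map_sub, map_mul, MvPolynomial.eval_X, Complex.ofReal_mul, Complex.ofReal_sub,
        mul_sub, Finset.sum_sub_distrib, apply_ite Complex.ofReal, Complex.ofReal_zero, mul_ite,
        mul_zero, ite_mul, zero_mul, sub_mul, Finset.sum_ite_eq', Finset.mem_univ, if_true]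
      ring

theorem hasDerivAt_heat (v : Modes n) (p : Model n) (t : ℝ) :
    HasDerivAt (fun t => ev (heat R d t v) p) (ev (modeLaplacian R d (heat R d t v)) p) t := by
  induction v using Modes.induction with
  | add u v hu hv => simpa only [map_add, ContinuousMap.add_apply] using hu.fun_add hv
  | mode i h =>
    simp only [heat, modeLaplacian, scale_lof, map_smul, ContinuousMap.smul_apply, smul_eq_mul]
    have h1 : HasDerivAt (fun t => Real.exp (-(freq n R d i * t)))
        (Real.exp (-(freq n R d i * t)) * -(freq n R d i)) t := by
      have h2 : HasDerivAt (fun t : ℝ => -(freq n R d i * t)) (-(freq n R d i)) t := by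
        simpa using ((hasDerivAt_id' t).const_mul (freq n R d i)).fun_neg
      exact h2.exp
    refine (h1.ofReal_comp.mul_const _).congr_deriv ?_
    push_cast
    ring

theorem continuous_heat (v : Modes n) :
    Continuous fun q : ℝ × Model n => ev (heat R d q.1 v) q.2 := by
  induction v using Modes.induction with
  | add u v hu hv => simpa only [map_add, ContinuousMap.add_apply] using Continuous.fun_add hu hv
  | mode i h =>
    simp only [heat, scale_lof, map_smul, ContinuousMap.smul_apply, smul_eq_mul]
    refine Continuous.mul (by fun_prop) ((map_continuous _).comp continuous_snd)

end Modes

/-! ### Maximum principle for the heat equation on the model -/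

section MaximumPrinciple

theorem deriv_nonpos_of_le_right {f : ℝ → ℝ} {c δ : ℝ} (hδ : 0 < δ) (hf : HasDerivAt f c 0)
    (hmax : ∀ s ∈ Icc 0 δ, f s ≤ f 0) : c ≤ 0 := by
  have h1 : Filter.Tendsto (slope f 0) (nhdsWithin 0 (Ioi 0)) (nhds c) :=
    (hasDerivAt_iff_tendsto_slope.1 hf).mono_left
      (nhdsWithin_mono _ fun x hx => (ne_of_gt hx : x ≠ 0))
  refine le_of_tendsto h1 ?_
  filter_upwards [Ioc_mem_nhdsGT hδ] with s hs
  rw [slope_def_field, sub_zero]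
  exact div_nonpos_of_nonpos_of_nonneg (sub_nonpos.2 (hmax s ⟨hs.1.le, hs.2⟩)) hs.1.le

/-- Second derivative test at a maximum, from one side. -/
theorem second_deriv_nonpos_of_le_right {f f' : ℝ → ℝ} {c δ : ℝ} (hδ : 0 < δ)
    (hf : ∀ s ∈ Icc 0 δ, HasDerivWithinAt f (f' s) (Icc 0 δ) s) (h0 : f' 0 = 0)
    (hf' : HasDerivWithinAt f' c (Icc 0 δ) 0) (hmax : ∀ s ∈ Icc 0 δ, f s ≤ f 0) : c ≤ 0 := by
  by_contra! hc
  have h1 := hasDerivWithinAt_iff_tendsto_slope.1 hf'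
  have h2 := h1.eventually (lt_mem_nhds hc)
  obtain ⟨ε, hε, h3⟩ := Metric.mem_nhdsWithin_iff.1 h2
  set η := min (ε / 2) δ
  have hη : 0 < η := lt_min (by positivity) hδ
  have hηδ : η ≤ δ := min_le_right _ _
  have hpos : ∀ s ∈ Ioo 0 η, 0 < f' s := by
    intro s hs
    have hsε : s < ε := (hs.2.trans_le (min_le_left _ _)).trans (by linarith)
    have h4 : s ∈ {x | 0 < slope f' 0 x} := h3 ⟨by simp [abs_of_pos hs.1, hsε],
      ⟨hs.1.le, hs.2.le.trans hηδ⟩, ne_of_gt hs.1⟩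
    rw [mem_ofPred, slope_def_field, h0, sub_zero, sub_zero] at h4
    exact (div_pos_iff_of_pos_right hs.1).1 h4
  have hmono : StrictMonoOn f (Icc 0 η) := by
    refine strictMonoOn_of_deriv_pos (convex_Icc 0 η)
      (fun s hs => ((hf s ⟨hs.1, hs.2.trans hηδ⟩).continuousWithinAt).mono
        (Icc_subset_Icc_right hηδ)) fun s hs => ?_
    rw [interior_Icc] at hs
    have h5 := (hf s ⟨hs.1.le, hs.2.le.trans hηδ⟩).hasDerivAt
      (Icc_mem_nhds hs.1 (hs.2.trans_le hηδ))
    rw [h5.deriv]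
    exact hpos s hs
  have h6 := hmono ⟨le_rfl, hη.le⟩ ⟨hη.le, le_rfl⟩ hη
  exact absurd (hmax η ⟨hη.le, hηδ⟩) (not_le.2 h6)

variable {n : ℕ} (R d : ℝ)

/-- `w` is a classical solution of `∂w/∂t - Δ w = g` on the model. -/
def IsHeatSolution (w g : ℝ → Model n → ℝ) : Prop :=
  (Continuous fun q : ℝ × Model n => w q.1 q.2) ∧
  ∃ (wt : ℝ → Model n → ℝ) (w' : Option (Fin n × Fin n) → ℝ → Model n → ℝ)
    (w'' : Option (Fin n × Fin n) → ℝ → Model n → ℝ),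
    (∀ t p, HasDerivAt (fun t => w t p) (wt t p) t) ∧
    (∀ a t p s, HasDerivAt (fun s => w t (flow R d a s p)) (w' a t (flow R d a s p)) s) ∧
    (∀ a t p, HasDerivAt (fun s => w' a t (flow R d a s p)) (w'' a t p) 0) ∧
    ∀ t p, wt t p - ∑ a, w'' a t p = g t p

variable {R d}

theorem IsHeatSolution.add {w w' g g' : ℝ → Model n → ℝ} (h : IsHeatSolution R d w g)
    (h' : IsHeatSolution R d w' g') :
    IsHeatSolution R d (fun t p => w t p + w' t p) (fun t p => g t p + g' t p) := by
  obtain ⟨hc, wt, w1, w2, ht, h1, h2, he⟩ := h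
  obtain ⟨hc', wt', w1', w2', ht', h1', h2', he'⟩ := h'
  refine ⟨hc.add hc', fun t p => wt t p + wt' t p, fun a t p => w1 a t p + w1' a t p,
    fun a t p => w2 a t p + w2' a t p, fun t p => (ht t p).fun_add (ht' t p),
    fun a t p s => (h1 a t p s).fun_add (h1' a t p s),
    fun a t p => (h2 a t p).fun_add (h2' a t p), fun t p => ?_⟩
  beta_reduce
  rw [Finset.sum_add_distrib, ← he, ← he']
  ring

theorem IsHeatSolution.const_mul {w g : ℝ → Model n → ℝ} (h : IsHeatSolution R d w g) (c : ℝ) :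
    IsHeatSolution R d (fun t p => c * w t p) (fun t p => c * g t p) := by
  obtain ⟨hc, wt, w1, w2, ht, h1, h2, he⟩ := h
  refine ⟨continuous_const.mul hc, fun t p => c * wt t p, fun a t p => c * w1 a t p,
    fun a t p => c * w2 a t p, fun t p => (ht t p).const_mul c,
    fun a t p s => (h1 a t p s).const_mul c,
    fun a t p => (h2 a t p).const_mul c, fun t p => ?_⟩
  beta_reduce
  rw [← Finset.mul_sum, ← he]
  ring

theorem IsHeatSolution.const (c : ℝ) :
    IsHeatSolution R d (fun (_ : ℝ) (_ : Model n) => c) (fun _ _ => 0) :=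
  ⟨continuous_const, fun _ _ => 0, fun _ _ _ => 0, fun _ _ _ => 0,
    fun _ _ => hasDerivAt_const _ _, fun _ _ _ _ => hasDerivAt_const _ _,
    fun _ _ _ => hasDerivAt_const _ _, fun _ _ => by simp⟩

theorem IsHeatSolution.sum {κ : Type*} (s : Finset κ) {w g : κ → ℝ → Model n → ℝ}
    (h : ∀ k, IsHeatSolution R d (w k) (g k)) :
    IsHeatSolution R d (fun t p => ∑ k ∈ s, w k t p) (fun t p => ∑ k ∈ s, g k t p) := by
  classical
  induction s using Finset.induction_on with
  | empty => simpa using IsHeatSolution.const (R := R) (d := d) (n := n) 0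
  | insert k s hk ih =>
    simp only [Finset.sum_insert hk]
    exact (h k).add ih

/-- Serves the term t|∇u|² of Bernstein's method: the weight t makes the term vanish at t = 0 and
produces the source |∇u|², which is absorbed by the source of |u|². -/
theorem IsHeatSolution.mul_time {w g : ℝ → Model n → ℝ} (h : IsHeatSolution R d w g) :
    IsHeatSolution R d (fun t p => t * w t p) (fun t p => w t p + t * g t p) := by
  obtain ⟨hc, wt, w1, w2, ht, h1, h2, he⟩ := h
  refine ⟨continuous_fst.mul hc, fun t p => 1 * w t p + t * wt t p, fun a t p => t * w1 a t p,
    fun a t p => t * w2 a t p, fun t p => (hasDerivAt_id' t).fun_mul (ht t p),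
    fun a t p s => (h1 a t p s).const_mul t,
    fun a t p => (h2 a t p).const_mul t, fun t p => ?_⟩
  beta_reduce
  rw [← Finset.mul_sum, ← he]
  ring

/-- The parabolic maximum principle. -/
theorem IsHeatSolution.nonpos {w g : ℝ → Model n → ℝ} (h : IsHeatSolution R d w g)
    (hg : ∀ t p, 0 ≤ t → g t p ≤ 0) (h0 : ∀ p, w 0 p ≤ 0) {t : ℝ} (ht0 : 0 ≤ t) (p : Model n) :
    w t p ≤ 0 := by
  obtain ⟨hc, wt, w1, w2, ht, h1, h2, he⟩ := h
  by_contra! hpos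
  -- Small enough for w - εt to stay positive at (t, p). At a positive maximum of w - εt the second
  -- derivatives are nonpositive and the time derivative of w is at least ε, which contradicts g ≤
  -- 0.
  set ε := w t p / (2 * (t + 1))
  have hε : 0 < ε := by positivity
  have hcomp : IsCompact (Icc 0 t ×ˢ (univ : Set (Model n))) := isCompact_Icc.prod isCompact_univ
  obtain ⟨⟨τ, q⟩, hτq, hmax⟩ := hcomp.exists_isMaxOn (f := fun z => w z.1 z.2 - ε * z.1)
    ⟨(t, p), ⟨ht0, le_rfl⟩, mem_univ _⟩ (by fun_prop)
  have hmax' : ∀ s ∈ Icc 0 t, ∀ y, w s y - ε * s ≤ w τ q - ε * τ := fun s hs y =>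
    hmax (show (s, y) ∈ _ from ⟨hs, mem_univ _⟩)
  have hval : 0 < w τ q - ε * τ := by
    refine lt_of_lt_of_le ?_ (hmax' t ⟨ht0, le_rfl⟩ p)
    have : ε * t < w t p := by
      simp only [ε]
      rw [div_mul_eq_mul_div, div_lt_iff₀ (by positivity)]
      nlinarith
    linarith
  have hτ : 0 < τ := by
    rcases hτq.1.1.eq_or_lt with h | h
    · rw [← show (0 : ℝ) = τ from h] at hval
      linarith [h0 q]
    · exact h
  have hτt : τ ≤ t := hτq.1.2
  have hspace : ∀ a, w2 a τ q ≤ 0 := by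
    intro a
    have hle : ∀ s, w τ (flow R d a s q) ≤ w τ (flow R d a 0 q) := fun s => by
      rw [flow_zero]
      linarith [hmax' τ ⟨hτ.le, hτt⟩ (flow R d a s q)]
    have hz : w1 a τ (flow R d a 0 q) = 0 :=
      IsLocalMax.hasDerivAt_eq_zero (Filter.Eventually.of_forall hle) (h1 a τ q 0)
    exact second_deriv_nonpos_of_le_right one_pos
      (fun s _ => (h1 a τ q s).hasDerivWithinAt) hz (h2 a τ q).hasDerivWithinAt
      fun s _ => hle s
  -- The maximum may sit at the final time, so only times before τ are compared.
  have htime : -(wt τ q - ε) ≤ 0 := by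
    refine deriv_nonpos_of_le_right (f := fun s => w (τ - s) q - ε * (τ - s)) hτ ?_ ?_
    · have e1 : HasDerivAt (fun s : ℝ => τ - s) (-1) 0 := by
        simpa using (hasDerivAt_id' (0 : ℝ)).const_sub τ
      have e2 : HasDerivAt (fun t => w t q) (wt τ q) (τ - 0) := by rw [sub_zero]; exact ht τ q
      exact ((e2.comp 0 e1).fun_sub (e1.const_mul ε)).congr_deriv (by ring)
    · intro s hs
      rw [sub_zero]
      exact hmax' _ ⟨by linarith [hs.2], by linarith [hs.1]⟩ q
  have h3 := he τ q
  have h4 := hg τ q hτ.le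
  have h5 : ∑ a, w2 a τ q ≤ 0 := Finset.sum_nonpos fun a _ => hspace a
  linarith

theorem isHeatSolution_re (hR : 0 < R) (v : Modes n) :
    IsHeatSolution R d (fun t p => (ev (heat R d t v) p).re) (fun _ _ => 0) := by
  refine ⟨Complex.continuous_re.comp (continuous_heat R d v),
    fun t p => (ev (modeLaplacian R d (heat R d t v)) p).re,
    fun a t p => (ev (field R d a (heat R d t v)) p).re,
    fun a t p => (ev (field R d a (field R d a (heat R d t v))) p).re,
    fun t p => Complex.reCLM.hasFDerivAt.comp_hasDerivAt t (hasDerivAt_heat R d v p t),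
    fun a t p s => Complex.reCLM.hasFDerivAt.comp_hasDerivAt s (hasDerivAt_flow R d _ a p s),
    fun a t p => ?_, fun t p => ?_⟩
  · have h := Complex.reCLM.hasFDerivAt.comp_hasDerivAt 0
      (hasDerivAt_flow R d (field R d a (heat R d t v)) a p 0)
    rw [flow_zero] at h
    exact h
  · beta_reduce
    rw [← sum_field_field hR, map_sum, ContinuousMap.sum_apply, Complex.re_sum, sub_self]

/-- Bochner's formula: Δ|u|² = 2⟨u, Δu⟩ + 2∑|X_a u|². Because the X_a commute with the semigroup,
the source is again built from squared norms of heat solutions, so the formula applies to them in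
turn. -/
theorem isHeatSolution_normSq (hR : 0 < R) (v : Modes n) :
    IsHeatSolution R d (fun t p => ‖ev (heat R d t v) p‖ ^ 2)
      (fun t p => -2 * ∑ a, ‖ev (heat R d t (field R d a v)) p‖ ^ 2) := by
  refine ⟨(continuous_heat R d v).norm.pow 2,
    fun t p => 2 * inner ℝ (ev (heat R d t v) p) (ev (modeLaplacian R d (heat R d t v)) p),
    fun a t p => 2 * inner ℝ (ev (heat R d t v) p) (ev (field R d a (heat R d t v)) p),
    fun a t p => 2 * (inner ℝ (ev (heat R d t v) p)
        (ev (field R d a (field R d a (heat R d t v))) p)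
      + inner ℝ (ev (field R d a (heat R d t v)) p) (ev (field R d a (heat R d t v)) p)),
    fun t p => (hasDerivAt_heat R d v p t).norm_sq,
    fun a t p s => (hasDerivAt_flow R d _ a p s).norm_sq,
    fun a t p => ?_, fun t p => ?_⟩
  · have h := ((hasDerivAt_flow R d (heat R d t v) a p 0).inner ℝ
      (hasDerivAt_flow R d (field R d a (heat R d t v)) a p 0)).const_mul 2
    rw [flow_zero] at h
    exact h
  · beta_reduce
    rw [← sum_field_field hR, map_sum, ContinuousMap.sum_apply, inner_sum, ← Finset.mul_sum,
      Finset.sum_add_distrib]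
    simp only [real_inner_self_eq_norm_sq, field_heat]
    ring

/-- The constant function `1`. -/
def oneMode : Modes n :=
  DirectSum.lof ℂ _ (fun i : ℕ × ℤ => Harm n i.1) (0, 0)
    ⟨1, mem_Harm.2 ⟨MvPolynomial.isHomogeneous_one _ _, by simp⟩⟩

theorem ev_oneMode (p : Model n) : ev oneMode p = 1 := by
  rw [oneMode, ev_lof]
  simp

theorem heat_oneMode (t : ℝ) : heat R d t (oneMode : Modes n) = oneMode := by
  rw [oneMode, heat, scale_lof]
  simp [freq]

theorem field_oneMode (a : Option (Fin n × Fin n)) :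
    field R d a (oneMode : Modes n) = 0 := by
  rw [oneMode, field_lof]
  rcases a with _ | ⟨j, k⟩
  · simp [fieldMode]
  · have : fieldMode R d (some (j, k)) (0, 0) (⟨1, mem_Harm.2
        ⟨MvPolynomial.isHomogeneous_one _ _, by simp⟩⟩ : Harm n 0) = 0 := by
      apply Subtype.ext
      simp [fieldMode, rotDeriv_apply]
    rw [this, map_zero]

/-- A smooth majorant of the squared distance on the model. -/
def rho (R d : ℝ) (x p : Model n) : ℝ :=
  R ^ 2 * ‖(x.1 : EuclideanSpace ℝ (Fin n)) - p.1‖ ^ 2 + d ^ 2 / 4 * ‖(x.2 : ℂ) - p.2‖ ^ 2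

theorem rho_nonneg (R d : ℝ) (x p : Model n) : 0 ≤ rho R d x p := by
  unfold rho
  positivity

/-- Expanding the squares on the two unit spheres leaves a constant, a term linear in ω and a term
linear in w, all of them modes. Their heat flow is explicit, and e^{-x} ≥ 1 - x bounds the flow at p
by (2(n-1) + π²/2)t. -/
theorem exists_rho_mode (hR : 0 < R) (hd : 0 < d) (p : Model n) :
    ∃ r : Modes n, (∀ x, (ev r x).re = rho R d x p) ∧
      ∀ t, 0 ≤ t → (ev (heat R d t r) p).re ≤ (2 * n + Real.pi ^ 2 / 2) * t := by
  have hlin : (∑ i, MvPolynomial.C (((p.1 : EuclideanSpace ℝ (Fin n)) i : ℝ) : ℂ)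
      * MvPolynomial.X i : MvPolynomial (Fin n) ℂ) ∈ Harm n 1 := by
    refine Submodule.sum_mem _ fun i _ => ?_
    rw [← MvPolynomial.smul_eq_C_mul]
    refine Submodule.smul_mem _ _ (mem_Harm.2 ⟨MvPolynomial.isHomogeneous_X ℂ i,
      Finset.sum_eq_zero fun j _ => ?_⟩)
    rw [MvPolynomial.pderiv_X, Pi.single_apply]
    split_ifs <;> simp
  set lin : Modes n := DirectSum.lof ℂ _ (fun i : ℕ × ℤ => Harm n i.1) (1, 0) ⟨_, hlin⟩
  set cir : Modes n := DirectSum.lof ℂ _ (fun i : ℕ × ℤ => Harm n i.1) (0, 1)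
    ⟨1, mem_Harm.2 ⟨MvPolynomial.isHomogeneous_one _ _, by simp⟩⟩
  have evlin : ∀ x, ev lin x = ((inner ℝ (p.1 : EuclideanSpace ℝ (Fin n)) x.1 : ℝ) : ℂ) := by
    intro x
    rw [ev_lof]
    simp [PiLp.inner_apply, mul_comm]
  have evcir : ∀ x, ev cir x = (x.2 : ℂ) := by
    intro x
    rw [ev_lof]
    simp
  have n1 : ∀ y : Model n, ‖(y.1 : EuclideanSpace ℝ (Fin n))‖ = 1 := fun y =>
    norm_eq_of_mem_sphere y.1
  have hlin' : ∀ t, heat R d t lin = ((Real.exp (-(((n : ℝ) - 1) / R ^ 2 * t)) : ℝ) : ℂ) • lin := by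
    intro t
    rw [heat, scale_lof]
    congr 4
    simp [freq]
    left
    ring
  have hcir' : ∀ t, heat R d t cir = ((Real.exp (-(Real.pi ^ 2 / d ^ 2 * t)) : ℝ) : ℂ) • cir := by
    intro t
    rw [heat, scale_lof]
    congr 4
    simp [freq]
  have inn : ∀ w w' : ℂ, (starRingEnd ℂ w' * w).re = inner ℝ w' w := fun w w' => by
    rw [Complex.inner, mul_comm]
  refine ⟨((2 * R ^ 2 + d ^ 2 / 2 : ℝ) : ℂ) • oneMode - ((2 * R ^ 2 : ℝ) : ℂ) • lin
    - ((d ^ 2 / 2 : ℝ) : ℂ) • ((starRingEnd ℂ) (p.2 : ℂ)) • cir, fun x => ?_, fun t ht => ?_⟩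
  · simp only [map_sub, map_smul, ContinuousMap.sub_apply, ContinuousMap.smul_apply, evlin, evcir,
      ev_oneMode, smul_eq_mul, mul_one, Complex.sub_re, Complex.re_ofReal_mul, Complex.ofReal_re,
      inn, rho, norm_sub_sq_real, n1, Circle.norm_coe]
    rw [real_inner_comm, real_inner_comm (x.2 : ℂ)]
    ring
  · simp only [map_sub, map_smul, hlin', hcir', heat_oneMode, ContinuousMap.sub_apply,
      ContinuousMap.smul_apply, evlin, evcir, ev_oneMode, smul_eq_mul, mul_one, Complex.sub_re,
      Complex.re_ofReal_mul, Complex.ofReal_re, real_inner_self_eq_norm_sq, n1]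
    rw [mul_left_comm ((starRingEnd ℂ) (p.2 : ℂ)), Complex.re_ofReal_mul, inn,
      real_inner_self_eq_norm_sq, Circle.norm_coe]
    have e1 := Real.add_one_le_exp (-(((n : ℝ) - 1) / R ^ 2 * t))
    have e2 := Real.add_one_le_exp (-(Real.pi ^ 2 / d ^ 2 * t))
    have e3 := mul_le_mul_of_nonneg_left e1 (show 0 ≤ 2 * R ^ 2 by positivity)
    have e4 := mul_le_mul_of_nonneg_left e2 (show 0 ≤ d ^ 2 / 2 by positivity)
    have e5 : 2 * R ^ 2 * (-(((n : ℝ) - 1) / R ^ 2 * t) + 1) = 2 * R ^ 2 - 2 * (n - 1) * t := by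
      field_simp
      ring
    have e6 : d ^ 2 / 2 * (-(Real.pi ^ 2 / d ^ 2 * t) + 1) = d ^ 2 / 2 - Real.pi ^ 2 / 2 * t := by
      field_simp
      ring
    rw [e5] at e3
    rw [e6] at e4
    linarith

/-- Bernstein's gradient estimate for the heat semigroup, localised by a barrier. -/
theorem heat_barrier (hR : 0 < R) (hd : 0 < d) (v : Modes n) (p : Model n) (c : ℂ) {A B : ℝ}
    (hB : 0 ≤ B) (h : ∀ x, ‖ev v x - c‖ ^ 2 ≤ A + B * rho R d x p) {t : ℝ} (ht : 0 ≤ t) :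
    ‖ev (heat R d t v) p - c‖ ^ 2 + 2 * t * ∑ a, ‖ev (field R d a (heat R d t v)) p‖ ^ 2
      ≤ A + B * ((2 * n + Real.pi ^ 2 / 2) * t) := by
  obtain ⟨r, hr, hr'⟩ := exists_rho_mode hR hd p
  set u := v - c • oneMode
  have hu : ∀ t x, ev (heat R d t u) x = ev (heat R d t v) x - c := by
    intro t x
    simp [u, heat_oneMode, ev_oneMode]
  have hfu : ∀ a, field R d a u = field R d a v := by
    intro a
    simp [u, field_oneMode]
  -- The comparison function |u|² + 2t∑|X_a u|² - B e^{tΔ}ρ - A. The sources ∓2∑|X_a u|² cancel,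
  -- which leaves the nonpositive one with second derivatives; at t = 0 the function is nonpositive
  -- by hypothesis.
  have hs := (((isHeatSolution_normSq hR u).add
    ((IsHeatSolution.sum Finset.univ fun a =>
      isHeatSolution_normSq hR (field R d a u)).mul_time.const_mul 2)).add
    ((isHeatSolution_re (d := d) hR r).const_mul (-B))).add (IsHeatSolution.const (-A))
  have key := hs.nonpos ?_ ?_ ht p
  · simp only [hu, hfu, ← field_heat] at key
    have h1 := mul_le_mul_of_nonneg_left (hr' t ht) hB
    linarith
  · intro t p ht
    have h1 : ∑ a, -2 * ∑ b, ‖ev (heat R d t (field R d b (field R d a u))) p‖ ^ 2 ≤ 0 := by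
      refine Finset.sum_nonpos fun a _ => ?_
      have : 0 ≤ ∑ b, ‖ev (heat R d t (field R d b (field R d a u))) p‖ ^ 2 := by positivity
      linarith
    have h2 := mul_nonpos_of_nonneg_of_nonpos ht h1
    linarith
  · intro x
    have h1 := h x
    simp only [heat_zero, hr]
    have h2 := hu 0 x
    rw [heat_zero, heat_zero] at h2
    rw [h2]
    linarith

end MaximumPrinciple

/-! ### Functions on the model as functions on the ambient space -/

section AmbientExtension

variable {n : ℕ}

/-- The `k`-th coordinate of `ℝ^n`, on `ℝ^n × ℝ`. -/
def coord (k : Fin n) : Ambient n →L[ℝ] ℝ :=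
  (EuclideanSpace.proj k).comp (WithLp.fstL 2 ℝ (EuclideanSpace ℝ (Fin n)) ℝ)

theorem coord_apply (k : Fin n) (x : Ambient n) : coord k x = x.fst k := rfl

/-- The coordinate along the axis. -/
def axialCoord (n : ℕ) : Ambient n →L[ℝ] ℝ := WithLp.sndL 2 ℝ (EuclideanSpace ℝ (Fin n)) ℝ

theorem axialCoord_apply (x : Ambient n) : axialCoord n x = x.snd := rfl

/-- The point of the model below a point off the axis. -/
def modelPoint (d : ℝ) (x : Ambient n) (hx : x.fst ≠ 0) : Model n :=
  (⟨‖x.fst‖⁻¹ • x.fst, by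
    rw [mem_sphere_zero_iff_norm, norm_smul, norm_inv, norm_norm,
      inv_mul_cancel₀ (norm_ne_zero_iff.2 hx)]⟩, Circle.exp (Real.pi / d * x.snd))

open Classical in
/-- A function on the model, as a function on the ambient space off the axis. -/
def ambientExt (d : ℝ) (u : Model n → ℂ) (x : Ambient n) : ℂ :=
  if hx : x.fst ≠ 0 then u (modelPoint d x hx) else 0

theorem ambientExt_of_ne {d : ℝ} (u : Model n → ℂ) {x : Ambient n} (hx : x.fst ≠ 0) :
    ambientExt d u x = u (modelPoint d x hx) := dif_pos hx

theorem isOpen_fst_ne_zero : IsOpen {x : Ambient n | x.fst ≠ 0} :=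
  isOpen_compl_singleton.preimage (WithLp.fstL 2 ℝ (EuclideanSpace ℝ (Fin n)) ℝ).continuous

/-- The `1`-forms dual to the infinitesimal isometries. -/
def form (R : ℝ) (a : Option (Fin n × Fin n)) (x : Ambient n) : Ambient n →L[ℝ] ℝ :=
  match a with
  | none => axialCoord n
  | some ij => ((Real.sqrt 2)⁻¹ * R / ‖x.fst‖ ^ 2) • (x.fst ij.1 • coord ij.2 - x.fst ij.2 • coord ij.1)

/-- The value at `x` of the vector field of an infinitesimal isometry. -/
def tangentVec (R : ℝ) (a : Option (Fin n × Fin n)) (x : Ambient n) : Ambient n :=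
  match a with
  | none => WithLp.toLp 2 (0, 1)
  | some ij => WithLp.toLp 2 ((Real.sqrt 2 * R)⁻¹ •
      (x.fst ij.1 • EuclideanSpace.single ij.2 (1 : ℝ)
        - x.fst ij.2 • EuclideanSpace.single ij.1 (1 : ℝ)), 0)

theorem lagrange_identity (a b : Fin n → ℝ) (g : Fin n → ℂ) :
    ∑ i, ∑ j, ((a i * b j - a j * b i : ℝ) : ℂ) * (a i * g j - a j * g i)
      = 2 * (((∑ i, a i * a i : ℝ) : ℂ) * ∑ i, b i * g i
        - ((∑ i, a i * b i : ℝ) : ℂ) * ∑ i, a i * g i) := by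
  have h : ∀ i j, ((a i * b j - a j * b i : ℝ) : ℂ) * (a i * g j - a j * g i)
      = ((a i : ℂ) * a i) * (b j * g j) - (a i * g i) * ((a j : ℂ) * b j)
        - ((a i : ℂ) * b i) * (a j * g j) + (b i * g i) * ((a j : ℂ) * a j) := by
    intro i j
    push_cast
    ring
  simp only [h, Finset.sum_add_distrib, Finset.sum_sub_distrib, ← Finset.mul_sum,
    ← Finset.sum_mul]
  push_cast
  ring

theorem inner_eq_sum (x y : EuclideanSpace ℝ (Fin n)) : inner ℝ x y = ∑ i, x i * y i := by
  simp [PiLp.inner_apply, mul_comm]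

/-- The contraction of the forms with the derivatives of a polynomial along the rotations. -/
theorem sum_form_rotDeriv {R : ℝ} (hR : 0 < R) (h : MvPolynomial (Fin n) ℂ) {x : Ambient n}
    (hx : x.fst ≠ 0) (w : Ambient n) :
    ∑ ij : Fin n × Fin n, (form R (some ij) x w : ℂ) * ((((Real.sqrt 2 * R)⁻¹ : ℝ) : ℂ) *
      MvPolynomial.eval (fun k => ((‖x.fst‖⁻¹ * x.fst k : ℝ) : ℂ)) (rotDeriv ij.1 ij.2 h))
    = ∑ k, ((‖x.fst‖⁻¹ * w.fst k - ‖x.fst‖⁻¹ ^ 3 * inner ℝ x.fst w.fst * x.fst k : ℝ) : ℂ) *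
      MvPolynomial.eval (fun k => ((‖x.fst‖⁻¹ * x.fst k : ℝ) : ℂ)) (MvPolynomial.pderiv k h) := by
  set r := ‖x.fst‖
  have hr : 0 < r := norm_pos_iff.2 hx
  set g := fun k => MvPolynomial.eval (fun k => ((r⁻¹ * x.fst k : ℝ) : ℂ)) (MvPolynomial.pderiv k h)
  have hg : ∀ k, MvPolynomial.eval (fun k => ((r⁻¹ * x.fst k : ℝ) : ℂ)) (MvPolynomial.pderiv k h)
    = g k := fun _ => rfl
  have h2 : Real.sqrt 2 * Real.sqrt 2 = 2 := Real.mul_self_sqrt (by norm_num)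
  have h2' : Real.sqrt 2 ≠ 0 := by positivity
  have hconst : (Real.sqrt 2)⁻¹ * R / r ^ 2 * (Real.sqrt 2 * R)⁻¹ * r⁻¹ = (2 : ℝ)⁻¹ * r⁻¹ ^ 3 := by
    field_simp
    linear_combination -h2
  have hterm : ∀ ij : Fin n × Fin n, (form R (some ij) x w : ℂ) * ((((Real.sqrt 2 * R)⁻¹ : ℝ) : ℂ) *
      MvPolynomial.eval (fun k => ((r⁻¹ * x.fst k : ℝ) : ℂ)) (rotDeriv ij.1 ij.2 h))
      = (((2 : ℝ)⁻¹ * r⁻¹ ^ 3 : ℝ) : ℂ) * ((((x.fst ij.1 * w.fst ij.2 - x.fst ij.2 * w.fst ij.1) : ℝ) : ℂ)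
        * (x.fst ij.1 * g ij.2 - x.fst ij.2 * g ij.1)) := by
    intro ij
    rw [← hconst, rotDeriv_apply]
    simp only [form, FunLike.coe_smul, Pi.smul_apply, FunLike.coe_sub, Pi.sub_apply, smul_eq_mul,
      coord_apply, map_sub, map_mul, MvPolynomial.eval_X, hg]
    push_cast
    ring
  rw [Finset.sum_congr rfl fun ij _ => hterm ij, ← Finset.mul_sum, Fintype.sum_prod_type,
    lagrange_identity]
  have hsq : ∑ i, x.fst i * x.fst i = r ^ 2 := by
    rw [← inner_eq_sum, real_inner_self_eq_norm_sq]
  rw [hsq, ← inner_eq_sum]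
  have hrhs : ∀ k, ((r⁻¹ * w.fst k - r⁻¹ ^ 3 * inner ℝ x.fst w.fst * x.fst k : ℝ) : ℂ) * g k
      = (r⁻¹ : ℝ) * (w.fst k * g k) - ((r⁻¹ ^ 3 * inner ℝ x.fst w.fst : ℝ) : ℂ) * (x.fst k * g k) := by
    intro k
    push_cast
    ring
  rw [Finset.sum_congr rfl fun k _ => hrhs k, Finset.sum_sub_distrib, ← Finset.mul_sum,
    ← Finset.mul_sum]
  have hrc : (r : ℂ) ≠ 0 := by exact_mod_cast hr.ne'
  push_cast
  field_simp

theorem ambientExt_ev_lof {d : ℝ} (i : ℕ × ℤ) (h : Harm n i.1) {x : Ambient n} (hx : x.fst ≠ 0) :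
    ambientExt d (ev (DirectSum.lof ℂ _ (fun i : ℕ × ℤ => Harm n i.1) i h)) x
      = MvPolynomial.eval (fun k => ((‖x.fst‖⁻¹ * x.fst k : ℝ) : ℂ)) h.1
        * (((Circle.exp (Real.pi / d * x.snd)) ^ i.2 : Circle) : ℂ) := by
  rw [ambientExt_of_ne _ hx, ev_lof]
  simp [modelPoint]

theorem hasFDerivAt_inv_norm_fst {x : Ambient n} (hx : x.fst ≠ 0) :
    HasFDerivAt (fun y : Ambient n => ‖y.fst‖⁻¹)
      (-(‖x.fst‖⁻¹ ^ 3) • (innerSL ℝ x.fst).comp (WithLp.fstL 2 ℝ (EuclideanSpace ℝ (Fin n)) ℝ)) x := by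
  have hr : 0 < ‖x.fst‖ := norm_pos_iff.2 hx
  have h1 : HasFDerivAt (fun y : Ambient n => ‖y.fst‖ ^ 2) _ x :=
    ((WithLp.fstL 2 ℝ (EuclideanSpace ℝ (Fin n)) ℝ).hasFDerivAt (x := x)).norm_sq
  have h2 := h1.sqrt (by positivity)
  simp only [Real.sqrt_sq (norm_nonneg _)] at h2
  refine ((hasDerivAt_inv hr.ne').comp_hasFDerivAt x h2).congr_fderiv ?_
  ext w
  change -(‖x.fst‖ ^ 2)⁻¹ * (1 / (2 * ‖x.fst‖) * (2 • inner ℝ x.fst w.fst))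
    = -(‖x.fst‖⁻¹ ^ 3) * inner ℝ x.fst w.fst
  rw [nsmul_eq_mul]
  push_cast
  field_simp

/-- The derivative of a function `u` on the model is given by `u' a`, the derivatives of `u` along
the infinitesimal isometries. -/
def HasGradient (R d : ℝ) (u : Model n → ℂ) (u' : Option (Fin n × Fin n) → Model n → ℂ) : Prop :=
  ∀ x : Ambient n, x.fst ≠ 0 → HasFDerivAt (ambientExt d u)
    (∑ a, (form R a x).smulRight (ambientExt d (u' a) x)) x

/-- The differential of x/|x| is the tangential projection divided by |x|, and Lagrange's identity
expresses this projection through the rotations. Overcomplete as they are, the rotations therefore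
serve as a global frame, and no local charts are needed. -/
theorem hasGradient_ev {R d : ℝ} (hR : 0 < R) (v : Modes n) :
    HasGradient R d (ev v) fun a => ev (field R d a v) := by
  intro x hx
  induction v using Modes.induction with
  | add u v hu hv =>
    have e : ∀ u v : Modes n, ambientExt d (ev (u + v))
        = fun y => ambientExt d (ev u) y + ambientExt d (ev v) y := by
      intro u v
      funext y
      by_cases hy : y.fst ≠ 0
      · simp only [ambientExt_of_ne _ hy, map_add, ContinuousMap.add_apply]
      · simp [ambientExt, hy]
    rw [e]
    refine (hu.fun_add hv).congr_fderiv ?_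
    ext w
    simp only [map_add (field R d _), e, add_apply, sum_apply, ContinuousLinearMap.smulRight_apply, smul_add,
      Finset.sum_add_distrib]
  | mode i h =>
    have h1 : ∀ k, HasFDerivAt (fun y : Ambient n => ‖y.fst‖⁻¹ * y.fst k) _ x := fun k =>
      (hasFDerivAt_inv_norm_fst hx).fun_mul (coord k).hasFDerivAt
    have h2 := hasFDerivAt_eval h.1 h1
    have h0 := hasDerivAt_circle_exp_zpow i.2 (Real.pi / d) x.snd 1
    simp only [mul_one] at h0
    have h3 : HasFDerivAt (fun y : Ambient n =>
        (((Circle.exp (Real.pi / d * y.snd)) ^ i.2 : Circle) : ℂ)) _ x :=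
      HasFDerivAt.comp x (f := axialCoord n) h0.hasFDerivAt (axialCoord n).hasFDerivAt
    refine ((h2.fun_mul h3).congr_of_eventuallyEq ?_).congr_fderiv ?_
    · filter_upwards [isOpen_fst_ne_zero.mem_nhds hx] with y hy
      exact ambientExt_ev_lof i h hy
    · ext w
      simp only [field_lof, ambientExt_ev_lof i _ hx, Fintype.sum_option, add_apply, sum_apply,
        ContinuousLinearMap.smulRight_apply, FunLike.coe_smul, Pi.smul_apply, smul_eq_mul,
        ContinuousLinearMap.coe_comp, Function.comp_apply, Complex.real_smul]
      have h4 := sum_form_rotDeriv hR h.1 hx w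
      set E := (((Circle.exp (Real.pi / d * x.snd)) ^ i.2 : Circle) : ℂ)
      have h5 : ∀ jk : Fin n × Fin n, (form R (some jk) x w : ℂ) *
          (MvPolynomial.eval (fun k => ((‖x.fst‖⁻¹ * x.fst k : ℝ) : ℂ))
            (fieldMode R d (some jk) i h).1 * E)
          = E * ((form R (some jk) x w : ℂ) * ((((Real.sqrt 2 * R)⁻¹ : ℝ) : ℂ) *
            MvPolynomial.eval (fun k => ((‖x.fst‖⁻¹ * x.fst k : ℝ) : ℂ))
              (rotDeriv jk.1 jk.2 h.1))) := by
        intro jk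
        simp only [fieldMode, LinearMap.smul_apply, Submodule.coe_smul,
          LinearMap.coe_restrict_apply, MvPolynomial.smul_eval]
        ring
      rw [Finset.sum_congr rfl fun jk _ => h5 jk, ← Finset.mul_sum, h4]
      congr 1
      · simp only [fieldMode, LinearMap.smul_apply, LinearMap.id_apply, Submodule.coe_smul,
          MvPolynomial.smul_eval, form, axialCoord_apply, ContinuousLinearMap.toSpanSingleton_apply,
          Complex.real_smul]
        push_cast
        ring
      · congr 1
        refine Finset.sum_congr rfl fun k _ => ?_
        congr 1
        simp only [innerSL_apply_apply, coord_apply, WithLp.fstL]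
        change (((‖x.fst‖⁻¹ * w.fst k + x.fst k * (-(‖x.fst‖⁻¹ ^ 3) * inner ℝ x.fst w.fst)) : ℝ) : ℂ)
          = _
        congr 1
        ring

/-- Contraction of the forms with the infinitesimal isometries, on the cylinder. -/
theorem sum_form_tangentVec {R d : ℝ} (hR : 0 < R) (v : Modes n) {x : Ambient n}
    (hx : ‖x.fst‖ = R) (a : Option (Fin n × Fin n)) :
    ∑ b, (form R b x (tangentVec R a x) : ℂ) * ambientExt d (ev (field R d b v)) x
      = ambientExt d (ev (field R d a v)) x := by
  have hx0 : x.fst ≠ 0 := by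
    rw [← norm_ne_zero_iff, hx]
    exact hR.ne'
  induction v using Modes.induction with
  | add u v hu hv =>
    have e : ∀ u v : Modes n, ambientExt d (ev (u + v)) x
        = ambientExt d (ev u) x + ambientExt d (ev v) x := by
      intro u v
      simp only [ambientExt_of_ne _ hx0, map_add, ContinuousMap.add_apply]
    simp only [map_add (field R d _), e, mul_add, Finset.sum_add_distrib, hu, hv]
  | mode i h =>
    simp only [field_lof, ambientExt_ev_lof i _ hx0, Fintype.sum_option]
    set E := (((Circle.exp (Real.pi / d * x.snd)) ^ i.2 : Circle) : ℂ)
    rcases a with _ | ⟨j, k⟩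
    · have h0 : ∀ ij, form R (some ij) x (tangentVec R none x) = 0 := by
        intro ij
        simp [form, tangentVec, coord_apply]
      have h1 : form R none x (tangentVec R none x) = 1 := rfl
      simp [h0, h1]
    · have h0 : form R none x (tangentVec R (some (j, k)) x) = 0 := rfl
      have h4 := sum_form_rotDeriv hR h.1 hx0 (tangentVec R (some (j, k)) x)
      have h5 : ∀ lm : Fin n × Fin n, (form R (some lm) x (tangentVec R (some (j, k)) x) : ℂ) *
          (MvPolynomial.eval (fun k => ((‖x.fst‖⁻¹ * x.fst k : ℝ) : ℂ))
            (fieldMode R d (some lm) i h).1 * E)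
          = E * ((form R (some lm) x (tangentVec R (some (j, k)) x) : ℂ) *
            ((((Real.sqrt 2 * R)⁻¹ : ℝ) : ℂ) *
            MvPolynomial.eval (fun k => ((‖x.fst‖⁻¹ * x.fst k : ℝ) : ℂ))
              (rotDeriv lm.1 lm.2 h.1))) := by
        intro jk
        simp only [fieldMode, LinearMap.smul_apply, Submodule.coe_smul,
          LinearMap.coe_restrict_apply, MvPolynomial.smul_eval]
        ring
      -- A rotation field is tangent to the sphere, so the radial correction in `sum_form_rotDeriv`
      -- vanishes on it.
      have hin : inner ℝ x.fst (tangentVec R (some (j, k)) x).fst = 0 := by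
        simp [tangentVec, inner_smul_right, inner_sub_right, EuclideanSpace.inner_single_right]
        right
        ring
      have hco : ∀ q, (tangentVec R (some (j, k)) x).fst q = (Real.sqrt 2 * R)⁻¹ *
          ((if q = k then x.fst j else 0) - (if q = j then x.fst k else 0)) := by
        intro q
        simp [tangentVec]
      rw [Finset.sum_congr rfl fun jk _ => h5 jk, ← Finset.mul_sum, h4, h0]
      simp only [hin, hco, mul_zero, zero_mul, sub_zero, Complex.ofReal_zero, zero_add, fieldMode,
        LinearMap.smul_apply, Submodule.coe_smul, LinearMap.coe_restrict_apply,
        MvPolynomial.smul_eval, rotDeriv_apply, map_sub, map_mul, MvPolynomial.eval_X]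
      simp only [Complex.ofReal_mul, Complex.ofReal_sub, mul_sub, sub_mul, Finset.sum_sub_distrib,
        apply_ite Complex.ofReal, Complex.ofReal_zero, mul_ite, ite_mul, mul_zero, zero_mul,
        Finset.sum_ite_eq', Finset.mem_univ, if_true]
      ring

end AmbientExtension

/-! ### Products and bounds for little-Hölder functions -/

section LittleHolderCalculus

variable {X : Type*} [MetricSpace X]

/-- Lipschitz functions on a bounded space are little-Hölder. -/
theorem IsLittleHolder.of_lipschitz {F : Type*} [NormedAddCommGroup F] [CompactSpace X] {α : ℝ≥0}
    (hα : α < 1) {f : X → F} {K : ℝ≥0} (hf : LipschitzWith K f) : IsLittleHolder α f := by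
  refine ⟨?_, MemHolder.of_le hf.holderWith.memHolder hα.le, fun ε hε => ?_⟩
  · obtain ⟨C, hC⟩ := (isCompact_range (hf.continuous.norm)).bddAbove
    exact ⟨C, fun x => hC ⟨x, rfl⟩⟩
  · have h1 : 0 < 1 - (α : ℝ) := sub_pos.2 (by exact_mod_cast hα)
    have h2 : Filter.Tendsto (fun r : ℝ => (K : ℝ) * r ^ (1 - (α : ℝ))) (nhds 0) (nhds 0) := by
      have := ((Real.continuous_rpow_const h1.le).tendsto 0).const_mul (K : ℝ)
      simpa [Real.zero_rpow h1.ne'] using this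
    obtain ⟨r, hr, h3⟩ := Metric.eventually_nhds_iff.1 (h2.eventually (gt_mem_nhds hε))
    refine ⟨r, hr, fun x y hxy => ?_⟩
    rcases (dist_nonneg (x := x) (y := y)).eq_or_lt with h0 | h0
    · have : x = y := dist_eq_zero.1 h0.symm
      subst this
      simp only [sub_self, norm_zero]
      positivity
    · rw [← dist_eq_norm]
      refine (hf.dist_le_mul x y).trans ?_
      have h4 := h3 (y := dist x y) (by simpa [abs_of_pos h0] using hxy)
      calc (K : ℝ) * dist x y = (K * dist x y ^ (1 - (α : ℝ))) * dist x y ^ (α : ℝ) := by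
            rw [mul_assoc, ← Real.rpow_add h0]
            simp
        _ ≤ ε * dist x y ^ (α : ℝ) := by gcongr

/-- A function whose increments are controlled by those of little-Hölder functions is
little-Hölder. -/
theorem IsLittleHolder.of_sum {F ι : Type*} [NormedAddCommGroup F] [Fintype ι] {α : ℝ≥0}
    {f : X → F} {g : ι → X → ℂ} (hg : ∀ i, IsLittleHolder α (g i))
    (h : ∀ x, ‖f x‖ ≤ ∑ i, ‖g i x‖) (h' : ∀ x y, ‖f x - f y‖ ≤ ∑ i, ‖g i x - g i y‖) :
    IsLittleHolder α f := by
  choose C hC K hK using fun i => (⟨(hg i).1.choose, (hg i).1.choose_spec,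
    (hg i).2.1.choose, (hg i).2.1.choose_spec⟩ :
      ∃ C : ℝ, (∀ x, ‖g i x‖ ≤ C) ∧ ∃ K, HolderWith K α (g i))
  refine ⟨⟨∑ i, C i, fun x => (h x).trans (Finset.sum_le_sum fun i _ => hC i x)⟩, ⟨∑ i, K i, ?_⟩,
    fun ε hε => ?_⟩
  · intro x y
    have h1 : ‖f x - f y‖₊ ≤ ∑ i, K i * nndist x y ^ (α : ℝ) := by
      rw [← NNReal.coe_le_coe]
      push_cast
      refine (h' x y).trans (Finset.sum_le_sum fun i _ => ?_)
      have := (hK i).nndist_le x y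
      rw [nndist_eq_nnnorm] at this
      exact_mod_cast this
    rw [edist_nndist, edist_nndist, nndist_eq_nnnorm, ← ENNReal.coe_rpow_of_nonneg _ α.coe_nonneg,
      ← ENNReal.coe_mul, Finset.sum_mul]
    exact ENNReal.coe_le_coe.2 h1
  · have hN : 0 < (Fintype.card ι : ℝ) + 1 := by positivity
    choose r hr h2 using fun i => (hg i).2.2 (ε / (Fintype.card ι + 1)) (by positivity)
    obtain ⟨ρ, hρ, h3⟩ : ∃ ρ : ℝ, 0 < ρ ∧ ∀ i, ρ ≤ r i := by
      rcases isEmpty_or_nonempty ι with he | he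
      · exact ⟨1, one_pos, fun i => he.elim i⟩
      · exact ⟨Finset.univ.inf' Finset.univ_nonempty r,
          (Finset.lt_inf'_iff _).2 fun i _ => hr i, fun i => Finset.inf'_le _ (Finset.mem_univ i)⟩
    refine ⟨ρ, hρ, fun x y hxy => (h' x y).trans ?_⟩
    refine (Finset.sum_le_sum fun i _ => h2 i x y (hxy.trans_le (h3 i))).trans ?_
    rw [Finset.sum_const, Finset.card_univ, nsmul_eq_mul, ← mul_assoc]
    gcongr
    rw [mul_div_assoc', div_le_iff₀ hN]
    nlinarith

/-- The increment of fg is at most C|Δg| + D|Δf| for bounds C of |f| and D of |g|. Truncating the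
bounds at 0 makes the comparison functions usable even if the space is empty. -/
theorem IsLittleHolder.mul {α : ℝ≥0} {f g : X → ℂ} (hf : IsLittleHolder α f)
    (hg : IsLittleHolder α g) : IsLittleHolder α (fun x => f x * g x) := by
  obtain ⟨C, hC⟩ := hf.1
  obtain ⟨D, hD⟩ := hg.1
  refine IsLittleHolder.of_sum (ι := Fin 2) (g := ![fun x => ((max C 0 : ℝ) : ℂ) * g x,
    fun x => ((max D 0 : ℝ) : ℂ) * f x]) ?_ ?_ ?_
  · intro i
    fin_cases i
    · exact hg.const_smul ((max C 0 : ℝ) : ℂ)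
    · exact hf.const_smul ((max D 0 : ℝ) : ℂ)
  · intro x
    simp only [Fin.sum_univ_two, Matrix.cons_val_zero, Matrix.cons_val_one, norm_mul,
      Complex.norm_real, Real.norm_of_nonneg (le_max_right _ (0 : ℝ))]
    have h1 : ‖f x‖ * ‖g x‖ ≤ max C 0 * ‖g x‖ :=
      mul_le_mul_of_nonneg_right ((hC x).trans (le_max_left _ _)) (norm_nonneg _)
    have h2 : 0 ≤ max D 0 * ‖f x‖ := mul_nonneg (le_max_right _ _) (norm_nonneg _)
    linarith
  · intro x y
    simp only [Fin.sum_univ_two, Matrix.cons_val_zero, Matrix.cons_val_one, ← mul_sub, norm_mul,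
      Complex.norm_real, Real.norm_of_nonneg (le_max_right _ (0 : ℝ))]
    have e : f x * g x - f y * g y = f x * (g x - g y) + g y * (f x - f y) := by ring
    rw [e]
    refine (norm_add_le _ _).trans ?_
    rw [norm_mul, norm_mul]
    gcongr
    · exact (hC x).trans (le_max_left _ _)
    · exact (hD y).trans (le_max_left _ _)

theorem IsLittleHolder.finset_sum {ι : Type*} (s : Finset ι) {α : ℝ≥0} {f : ι → X → ℂ}
    (hf : ∀ i, IsLittleHolder α (f i)) : IsLittleHolder α (fun x => ∑ i ∈ s, f i x) := by
  have h : ∑ i ∈ s, f i ∈ littleHolderSubmodule X α := Submodule.sum_mem _ fun i _ => hf i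
  have e : (fun x => ∑ i ∈ s, f i x) = ∑ i ∈ s, f i := by
    funext x
    simp
  rw [e]
  exact h

/-- A family of bilinear forms is little-Hölder if its coefficients in a basis are. -/
theorem IsLittleHolder.multilinear {E ι : Type*} [NormedAddCommGroup E] [InnerProductSpace ℝ E]
    [Fintype ι] (b : OrthonormalBasis ι ℝ E) {α : ℝ≥0}
    {f : X → ContinuousMultilinearMap ℝ (fun _ : Fin 2 => E) ℂ}
    (hf : ∀ r : Fin 2 → ι, IsLittleHolder α (fun x => f x fun i => b (r i))) :
    IsLittleHolder α f := by
  classical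
  have key : ∀ T : ContinuousMultilinearMap ℝ (fun _ : Fin 2 => E) ℂ,
      ‖T‖ ≤ ∑ r : Fin 2 → ι, ‖T fun i => b (r i)‖ := by
    intro T
    refine T.opNorm_le_bound (Finset.sum_nonneg fun r _ => norm_nonneg _) fun m => ?_
    have e : T m = ∑ r : Fin 2 → ι, (∏ i, inner ℝ (b (r i)) (m i)) • T fun i => b (r i) := by
      have e1 : m = fun i => ∑ k, inner ℝ (b k) (m i) • b k := by
        funext i
        exact (b.sum_repr' (m i)).symm
      conv_lhs => rw [e1]
      rw [T.map_sum]
      exact Finset.sum_congr rfl fun r _ => T.map_smul_univ _ _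
    rw [e, Finset.sum_mul]
    refine (norm_sum_le _ _).trans (Finset.sum_le_sum fun r _ => ?_)
    rw [norm_smul, mul_comm, norm_prod]
    gcongr with i
    refine (norm_inner_le_norm _ _).trans ?_
    rw [b.orthonormal.1, one_mul]
  exact IsLittleHolder.of_sum hf (fun x => key (f x)) fun x y => key (f x - f y)

end LittleHolderCalculus

/-! ### Regularity of functions on the model with given derivatives along the isometries -/

section Regularity

variable {n : ℕ} {R d : ℝ}

instance continuousSMul_ambient (n : ℕ) : ContinuousSMul ℝ (Ambient n) :=
  IsBoundedSMul.continuousSMul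

theorem isCompact_cylinder (n : ℕ) (R d : ℝ) : IsCompact (cylinder n R d) := by
  have h : IsCompact ((fun y : EuclideanSpace ℝ (Fin n) × ℝ => (WithLp.toLp 2 y : Ambient n)) ''
      (Metric.sphere 0 R ×ˢ Icc 0 d)) :=
    ((isCompact_sphere 0 R).prod isCompact_Icc).image (WithLp.prod_continuous_toLp 2 _ _)
  convert h using 1
  ext x
  simp only [cylinder, mem_ofPred, mem_image, mem_prod, mem_sphere_zero_iff_norm]
  constructor
  · intro hx
    exact ⟨(x.fst, x.snd), hx, rfl⟩
  · rintro ⟨y, hy, rfl⟩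
    exact hy

instance compactSpace_cylinder : CompactSpace (cylinder n R d) :=
  isCompact_iff_compactSpace.1 (isCompact_cylinder n R d)

theorem cylinder_fst_ne_zero (hR : 0 < R) (p : cylinder n R d) : (p : Ambient n).fst ≠ 0 :=
  (mem_slab hR p).1

theorem continuous_modelPoint (d : ℝ) :
    Continuous fun x : {x : Ambient n | x.fst ≠ 0} => modelPoint d x.1 x.2 := by
  have h1 : Continuous fun x : {x : Ambient n | x.fst ≠ 0} => x.1.fst :=
    (WithLp.fstL 2 ℝ (EuclideanSpace ℝ (Fin n)) ℝ).continuous.comp continuous_subtype_val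
  have h2 : Continuous fun x : {x : Ambient n | x.fst ≠ 0} => x.1.snd :=
    (axialCoord n).continuous.comp continuous_subtype_val
  refine Continuous.prodMk (Continuous.subtype_mk ?_ _)
    (Circle.exp.continuous.comp (continuous_const.mul h2))
  exact (h1.norm.inv₀ fun x => norm_ne_zero_iff.2 x.2).smul h1

theorem continuousOn_ambientExt {u : Model n → ℂ} (hu : Continuous u) :
    ContinuousOn (ambientExt d u) {x | x.fst ≠ 0} := by
  rw [continuousOn_iff_continuous_domRestrict]
  convert hu.comp (continuous_modelPoint d) using 1
  funext x
  exact ambientExt_of_ne u x.2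

/-- Both extensions are constant along rays from the axis. Derivatives within the slab can thus be
computed as ordinary derivatives of a function on the open set off the axis, also at the ends of the
cylinder. -/
theorem normalExt_eq_ambientExt (hR : 0 < R) (u : Model n → ℂ) {x : Ambient n}
    (hx : x ∈ slab n d) :
    normalExt (fun p : cylinder n R d => ambientExt d u p) x = ambientExt d u x := by
  have hx0 : ‖x.fst‖ ≠ 0 := norm_ne_zero_iff.2 hx.1
  have hnorm : ‖(radialProj n R x).fst‖ = R := by
    simp [radialProj, norm_smul, abs_of_pos hR, hx0]
  have h : radialProj n R x ∈ cylinder n R d := ⟨hnorm, hx.2⟩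
  have h1 : (radialProj n R x).fst ≠ 0 := by
    rw [← norm_ne_zero_iff, hnorm]
    exact hR.ne'
  rw [normalExt, dif_pos h, ambientExt_of_ne u h1, ambientExt_of_ne u hx.1]
  congr 1
  refine Prod.ext (Subtype.ext ?_) rfl
  change ‖(radialProj n R x).fst‖⁻¹ • ((R / ‖x.fst‖) • x.fst) = ‖x.fst‖⁻¹ • x.fst
  rw [hnorm, smul_smul]
  congr 1
  field_simp

/-! ### Lipschitz bounds, limits and second derivatives in terms of the isometries -/

theorem norm_coord_le (k : Fin n) (x : Ambient n) : ‖coord k x‖ ≤ ‖x.fst‖ :=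
  PiLp.norm_apply_le x.fst k

theorem norm_fst_le (x : Ambient n) : ‖x.fst‖ ≤ ‖x‖ := by
  have h := WithLp.prod_norm_sq_eq_of_L2 x
  nlinarith [norm_nonneg x, norm_nonneg x.fst, sq_nonneg ‖x.snd‖]

theorem norm_snd_le (x : Ambient n) : ‖x.snd‖ ≤ ‖x‖ := by
  have h := WithLp.prod_norm_sq_eq_of_L2 x
  nlinarith [norm_nonneg x, norm_nonneg x.snd, sq_nonneg ‖x.fst‖]

theorem norm_form_le (hR : 0 < R) (a : Option (Fin n × Fin n)) {x : Ambient n} {r : ℝ}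
    (hr : 0 < r) (hx : r ≤ ‖x.fst‖) : ‖form R a x‖ ≤ 1 + 2 * R / r := by
  refine ContinuousLinearMap.opNorm_le_bound _ (by positivity) fun w => ?_
  rcases a with _ | ⟨i, j⟩
  · have h := norm_snd_le w
    have h2 : 0 ≤ 2 * R / r * ‖w‖ := by positivity
    change ‖w.snd‖ ≤ _
    linarith
  · have hx0 : 0 < ‖x.fst‖ := hr.trans_le hx
    have h2 : (Real.sqrt 2)⁻¹ ≤ 1 := inv_le_one_of_one_le₀ (Real.one_le_sqrt.2 (by norm_num))
    have h3 : ‖x.fst i * coord j w - x.fst j * coord i w‖ ≤ 2 * ‖x.fst‖ * ‖w‖ := by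
      refine (norm_sub_le _ _).trans ?_
      rw [norm_mul, norm_mul]
      have a1 := PiLp.norm_apply_le x.fst i
      have a2 := PiLp.norm_apply_le x.fst j
      have a3 := (norm_coord_le j w).trans (norm_fst_le w)
      have a4 := (norm_coord_le i w).trans (norm_fst_le w)
      have a5 := mul_le_mul a1 a3 (norm_nonneg _) (norm_nonneg _)
      have a6 := mul_le_mul a2 a4 (norm_nonneg _) (norm_nonneg _)
      linarith
    change ‖((Real.sqrt 2)⁻¹ * R / ‖x.fst‖ ^ 2) *
      (x.fst i * coord j w - x.fst j * coord i w)‖ ≤ _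
    rw [norm_mul, Real.norm_of_nonneg (by positivity)]
    calc _ ≤ (1 * R / ‖x.fst‖ ^ 2) * (2 * ‖x.fst‖ * ‖w‖) := by gcongr
      _ = 2 * R / ‖x.fst‖ * ‖w‖ := by field_simp
      _ ≤ 2 * R / r * ‖w‖ := by gcongr
      _ ≤ _ := by nlinarith [norm_nonneg w]

theorem norm_ambientExt_le {u : Model n → ℂ} {N : ℝ} (hN : 0 ≤ N) (hu : ∀ m, ‖u m‖ ≤ N)
    (x : Ambient n) : ‖ambientExt d u x‖ ≤ N := by
  by_cases hx : x.fst ≠ 0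
  · rw [ambientExt_of_ne u hx]
    exact hu _
  · simp [ambientExt, hx, hN]

theorem norm_gradient_le (hR : 0 < R) {u' : Option (Fin n × Fin n) → Model n → ℂ} {N r : ℝ}
    (hN : 0 ≤ N) (hu : ∀ a m, ‖u' a m‖ ≤ N) {x : Ambient n} (hr : 0 < r) (hx : r ≤ ‖x.fst‖) :
    ‖∑ a, (form R a x).smulRight (ambientExt d (u' a) x)‖
      ≤ Fintype.card (Option (Fin n × Fin n)) * (1 + 2 * R / r) * N := by
  refine (norm_sum_le _ _).trans ?_
  rw [mul_assoc, ← nsmul_eq_mul, ← Finset.card_univ, ← Finset.sum_const]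
  refine Finset.sum_le_sum fun a _ => ?_
  rw [ContinuousLinearMap.norm_smulRight_apply]
  have h1 := norm_form_le hR a hr hx
  have h2 := norm_ambientExt_le (d := d) hN (hu a) x
  gcongr

/-- A Lipschitz bound on the cylinder in terms of the derivatives along the isometries. -/
theorem HasGradient.norm_sub_le_mul_dist (hR : 0 < R) {u : Model n → ℂ}
    {u' : Option (Fin n × Fin n) → Model n → ℂ} (h : HasGradient R d u u') {N : ℝ} (hN : 0 ≤ N)
    (hu : ∀ a m, ‖u' a m‖ ≤ N) (p q : cylinder n R d) (hpq : dist p q ≤ R) :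
    ‖ambientExt d u p - ambientExt d u q‖
      ≤ Fintype.card (Option (Fin n × Fin n)) * 5 * N * dist p q := by
  -- The chord between two points at distance at most R stays away from the axis, since each of its
  -- points is within R/2 of an endpoint. With r = R/2 the bound for the forms is 1 + 2R/r = 5.
  have hseg : ∀ x ∈ segment ℝ (q : Ambient n) p, R / 2 ≤ ‖x.fst‖ := by
    have aux : ∀ p q : cylinder n R d, dist p q ≤ R → ∀ t : ℝ, 0 ≤ t → t ≤ 1 / 2 →
        R / 2 ≤ ‖((p : Ambient n) + t • ((q : Ambient n) - p)).fst‖ := by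
      intro p q hpq t h0 h1
      have e : (p : Ambient n).fst = ((p : Ambient n) + t • ((q : Ambient n) - p)).fst
          - (t • ((q : Ambient n) - p)).fst := by simp
      have h2 : ‖(t • ((q : Ambient n) - p)).fst‖ ≤ R / 2 := by
        refine (norm_fst_le _).trans ?_
        rw [norm_smul, Real.norm_of_nonneg h0, ← dist_eq_norm, dist_comm]
        have : dist (p : Ambient n) q ≤ R := hpq
        nlinarith [dist_nonneg (x := (p : Ambient n)) (y := q)]
      have h3 : ‖(p : Ambient n).fst‖ = R := p.2.1
      have h4 := norm_sub_le ((p : Ambient n) + t • ((q : Ambient n) - p)).fst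
        (t • ((q : Ambient n) - p)).fst
      rw [← e, h3] at h4
      linarith
    intro x hx
    rw [segment_eq_image'] at hx
    obtain ⟨t, ⟨h0, h1⟩, rfl⟩ := hx
    by_cases ht : t ≤ 1 / 2
    · exact aux q p (by rwa [dist_comm]) t h0 ht
    · have e : (q : Ambient n) + t • ((p : Ambient n) - q)
          = (p : Ambient n) + (1 - t) • ((q : Ambient n) - p) := by module
      beta_reduce
      rw [e]
      exact aux p q hpq (1 - t) (by linarith) (by linarith)
  have key := (convex_segment (q : Ambient n) p).norm_image_sub_le_of_norm_hasFDerivWithin_le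
    (f := ambientExt d u) (𝕜 := ℝ)
    (fun x hx => (h x (norm_pos_iff.1 ((half_pos hR).trans_le (hseg x hx)))).hasFDerivWithinAt)
    (fun x hx => norm_gradient_le hR hN hu (half_pos hR) (hseg x hx))
    (left_mem_segment ℝ _ _) (right_mem_segment ℝ _ _)
  have e : 1 + 2 * R / (R / 2) = 5 := by
    field_simp
    norm_num
  rw [e, ← dist_eq_norm (p : Ambient n)] at key
  exact key

/-- On {|q| > r} the forms are bounded, so uniform convergence of the functions u'_a makes the full
differentials converge uniformly, and a limit may be differentiated. -/
theorem HasGradient.of_tendsto (hR : 0 < R) {F : ℕ → C(Model n, ℂ)}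
    {F' : ℕ → Option (Fin n × Fin n) → C(Model n, ℂ)} (h : ∀ k, HasGradient R d (F k) fun a => F' k a)
    {u : C(Model n, ℂ)} {u' : Option (Fin n × Fin n) → C(Model n, ℂ)}
    (hF : Filter.Tendsto F Filter.atTop (nhds u))
    (hF' : ∀ a, Filter.Tendsto (fun k => F' k a) Filter.atTop (nhds (u' a))) :
    HasGradient R d u fun a => u' a := by
  intro x hx
  have hx0 : 0 < ‖x.fst‖ := norm_pos_iff.2 hx
  set r := ‖x.fst‖ / 2
  have hr : 0 < r := half_pos hx0
  have hpos : ∀ y ∈ {y : Ambient n | r < ‖y.fst‖}, y.fst ≠ 0 := fun y hy =>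
    norm_pos_iff.1 (hr.trans hy)
  have hopen : IsOpen {y : Ambient n | r < ‖y.fst‖} :=
    isOpen_lt continuous_const
      (WithLp.fstL 2 ℝ (EuclideanSpace ℝ (Fin n)) ℝ).continuous.norm
  refine hasFDerivAt_of_tendstoUniformlyOn (l := Filter.atTop) (f := fun k => ambientExt d (F k))
    (f' := fun k y => ∑ a, (form R a y).smulRight (ambientExt d (F' k a) y))
    (g' := fun y => ∑ a, (form R a y).smulRight (ambientExt d (u' a) y)) hopen
    ?_ (fun k y hy => h k y (hpos y hy)) (fun y hy => ?_) (show r < ‖x.fst‖ from half_lt_self hx0)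
  · rw [Metric.tendstoUniformlyOn_iff]
    intro ε hε
    set K := Fintype.card (Option (Fin n × Fin n)) * (1 + 2 * R / r)
    have hK : 0 ≤ K := by positivity
    have h1 : ∀ᶠ k in Filter.atTop, ∀ a, ‖u' a - F' k a‖ < ε / (K + 1) := by
      rw [Filter.eventually_all]
      intro a
      filter_upwards [Metric.tendsto_nhds.1 (hF' a) (ε / (K + 1)) (by positivity)] with k hk
      rw [← dist_eq_norm, dist_comm]
      exact hk
    filter_upwards [h1] with k hk y hy
    rw [dist_eq_norm, ← Finset.sum_sub_distrib]
    have e : ∀ a, (form R a y).smulRight (ambientExt d (u' a) y)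
        - (form R a y).smulRight (ambientExt d (F' k a) y)
        = (form R a y).smulRight (ambientExt d (fun m => (u' a - F' k a) m) y) := by
      intro a
      ext w
      simp [ambientExt_of_ne _ (hpos y hy), mul_sub]
    rw [Finset.sum_congr rfl fun a _ => e a]
    refine (norm_gradient_le hR (N := ε / (K + 1)) (by positivity)
      (fun a m => ((u' a - F' k a).norm_coe_le_norm m).trans (hk a).le) hr (le_of_lt hy)).trans_lt ?_
    change K * (ε / (K + 1)) < ε
    rw [mul_div_assoc', div_lt_iff₀ (by positivity)]
    nlinarith
  · have e : ∀ F : C(Model n, ℂ), ambientExt d F y = F (modelPoint d y (hpos y hy)) := fun F =>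
      ambientExt_of_ne _ _
    simp only [e]
    exact ((continuous_eval_const _).tendsto u).comp hF

theorem contDiffOn_form (a : Option (Fin n × Fin n)) {k : WithTop ℕ∞} :
    ContDiffOn ℝ k (form R a) {x | x.fst ≠ 0} := by
  rcases a with _ | ⟨i, j⟩
  · exact contDiffOn_const
  · have h1 : ContDiff ℝ k fun x : Ambient n => ‖x.fst‖ ^ 2 :=
      (WithLp.fstL 2 ℝ (EuclideanSpace ℝ (Fin n)) ℝ).contDiff.norm_sq ℝ
    have h2 : ContDiff ℝ k fun x : Ambient n => coord i x • coord j - coord j x • coord i :=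
      ((coord i).contDiff.smul contDiff_const).sub ((coord j).contDiff.smul contDiff_const)
    exact (contDiffOn_const.div h1.contDiffOn fun x hx => by
      have := norm_pos_iff.2 hx
      positivity).smul h2.contDiffOn

theorem HasGradient.contDiffOn_succ {u : Model n → ℂ} {u' : Option (Fin n × Fin n) → Model n → ℂ}
    (h : HasGradient R d u u') {k : ℕ}
    (hu : ∀ a, ContDiffOn ℝ k (ambientExt d (u' a)) {x | x.fst ≠ 0}) :
    ContDiffOn ℝ (k + 1) (ambientExt d u) {x | x.fst ≠ 0} := by
  rw [contDiffOn_succ_iff_hasFDerivWithinAt_of_uniqueDiffOn isOpen_fst_ne_zero.uniqueDiffOn]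
  refine ⟨fun h => absurd h (by simp), _, ?_, fun x hx => (h x hx).hasFDerivWithinAt⟩
  exact ContDiffOn.sum fun a _ => (contDiffOn_form a).smulRight (hu a)

/-- At |q| = R, and in general only there, the forms are the metric duals of the fields. This fixes
the factor R/|q|² in `form`. -/
theorem inner_tangentVec (hR : 0 < R) (a : Option (Fin n × Fin n)) {x : Ambient n}
    (hx : ‖x.fst‖ = R) (w : Ambient n) : inner ℝ (tangentVec R a x) w = form R a x w := by
  rcases a with _ | ⟨i, j⟩
  · simp [tangentVec, form, axialCoord_apply, WithLp.prod_inner_apply]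
  · have h2 : Real.sqrt 2 ≠ 0 := by positivity
    simp only [tangentVec, form, WithLp.prod_inner_apply, inner_smul_left, inner_sub_left, hx,
      EuclideanSpace.inner_single_left, coord_apply, FunLike.coe_smul, Pi.smul_apply,
      FunLike.coe_sub, Pi.sub_apply, smul_eq_mul, inner_zero_left, add_zero]
    simp
    left
    field_simp

/-- `u`, with derivatives `u' a` and `u'' a b` along the isometries, is `C²`. -/
structure HasSecondDerivs (R d : ℝ) (u : Model n → ℂ) (u' : Option (Fin n × Fin n) → Model n → ℂ)
    (u'' : Option (Fin n × Fin n) → Option (Fin n × Fin n) → Model n → ℂ) : Prop where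
  first : HasGradient R d u u'
  second : ∀ a, HasGradient R d (u' a) (u'' a)
  cont : ∀ a b, Continuous (u'' a b)
  -- The left side is the differential of u'_a on the field X_a, so the condition says that u''_aa
  -- is the derivative of u'_a along X_a. As the fields are linearly dependent, the gradient
  -- formulas alone do not imply it. It passes to limits and collapses the trace of the Hessian.
  tangent : ∀ a (x : Ambient n), ‖x.fst‖ = R →
    ∑ b, (form R b x (tangentVec R a x) : ℂ) * ambientExt d (u'' a b) x = ambientExt d (u'' a a) x

theorem hasSecondDerivs_ev (hR : 0 < R) (v : Modes n) :
    HasSecondDerivs R d (ev v) (fun a => ev (field R d a v))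
      (fun a b => ev (field R d b (field R d a v))) :=
  ⟨hasGradient_ev hR v, fun _ => hasGradient_ev hR _, fun _ _ => map_continuous _,
    fun a _ hx => sum_form_tangentVec hR (field R d a v) hx a⟩

theorem HasSecondDerivs.of_tendsto (hR : 0 < R) {F : ℕ → C(Model n, ℂ)}
    {F' : ℕ → Option (Fin n × Fin n) → C(Model n, ℂ)}
    {F'' : ℕ → Option (Fin n × Fin n) → Option (Fin n × Fin n) → C(Model n, ℂ)}
    (h : ∀ k, HasSecondDerivs R d (F k) (fun a => F' k a) fun a b => F'' k a b)
    {u : C(Model n, ℂ)} {u' : Option (Fin n × Fin n) → C(Model n, ℂ)}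
    {u'' : Option (Fin n × Fin n) → Option (Fin n × Fin n) → C(Model n, ℂ)}
    (hF : Filter.Tendsto F Filter.atTop (nhds u))
    (hF' : ∀ a, Filter.Tendsto (fun k => F' k a) Filter.atTop (nhds (u' a)))
    (hF'' : ∀ a b, Filter.Tendsto (fun k => F'' k a b) Filter.atTop (nhds (u'' a b))) :
    HasSecondDerivs R d u (fun a => u' a) fun a b => u'' a b := by
  refine ⟨HasGradient.of_tendsto hR (fun k => (h k).first) hF hF',
    fun a => HasGradient.of_tendsto hR (fun k => (h k).second a) (hF' a) (hF'' a),
    fun _ _ => map_continuous _, fun a x hx => ?_⟩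
  have hx0 : x.fst ≠ 0 := by
    rw [← norm_ne_zero_iff, hx]
    exact hR.ne'
  have e : ∀ a b, Filter.Tendsto (fun k => ambientExt d (F'' k a b) x) Filter.atTop
      (nhds (ambientExt d (u'' a b) x)) := by
    intro a b
    simp only [ambientExt_of_ne _ hx0]
    exact ((continuous_eval_const _).tendsto _).comp (hF'' a b)
  exact tendsto_nhds_unique ((tendsto_finsetSum _ fun b _ => (e a b).const_mul _).congr
    fun k => (h k).tangent a x hx) (e a a)

variable {u : Model n → ℂ} {u' : Option (Fin n × Fin n) → Model n → ℂ}
  {u'' : Option (Fin n × Fin n) → Option (Fin n × Fin n) → Model n → ℂ}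

theorem HasSecondDerivs.contDiffOn (h : HasSecondDerivs R d u u' u'') :
    ContDiffOn ℝ 2 (ambientExt d u) {x | x.fst ≠ 0} := by
  have h1 : ∀ a, ContDiffOn ℝ (1 : ℕ) (ambientExt d (u' a)) {x | x.fst ≠ 0} := fun a => by
    have := (h.second a).contDiffOn_succ (k := 0) fun b => by
      simpa using (contDiffOn_zero (𝕜 := ℝ)).2 (continuousOn_ambientExt (d := d) (h.cont a b))
    simpa using this
  simpa [one_add_one_eq_two] using h.first.contDiffOn_succ h1

/-- The second derivative in terms of the derivatives along the isometries. -/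
theorem HasSecondDerivs.iteratedFDerivWithin_apply (h : HasSecondDerivs R d u u' u'') (hR : 0 < R)
    (hd : 0 < d) (p : cylinder n R d) (m : Fin 2 → Ambient n) :
    iteratedFDerivWithin ℝ 2 (normalExt fun p : cylinder n R d => ambientExt d u p) (slab n d) p m
      = ∑ a, ((fderiv ℝ (fun x => form R a x (m 1)) p (m 0) : ℂ) * ambientExt d (u' a) p
        + (form R a p (m 1) : ℂ) * ∑ b, (form R b p (m 0) : ℂ) * ambientExt d (u'' a b) p) := by
  have hp := mem_slab hR p
  have hp0 := cylinder_fst_ne_zero hR p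
  have hnhds := isOpen_fst_ne_zero.mem_nhds hp0
  rw [iteratedFDerivWithin_congr (fun x hx => normalExt_eq_ambientExt hR u hx) hp,
    iteratedFDerivWithin_eq_iteratedFDeriv (uniqueDiffOn_slab n hd)
      (h.contDiffOn.contDiffAt hnhds) hp, iteratedFDeriv_two_apply]
  have hd1 : DifferentiableAt ℝ (fderiv ℝ (ambientExt d u)) p := by
    have := (h.contDiffOn.contDiffAt hnhds).fderiv_right (m := 1) (by norm_num)
    exact this.differentiableAt (by norm_num)
  have e1 : fderiv ℝ (fderiv ℝ (ambientExt d u)) p (m 0) (m 1)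
      = fderiv ℝ (fun x => fderiv ℝ (ambientExt d u) x (m 1)) p (m 0) := by
    rw [fderiv_clm_apply hd1 (differentiableAt_const _)]
    simp
  have e2 : (fun x => fderiv ℝ (ambientExt d u) x (m 1)) =ᶠ[nhds (p : Ambient n)]
      fun x => ∑ a, (form R a x (m 1) : ℂ) * ambientExt d (u' a) x := by
    filter_upwards [hnhds] with x hx
    rw [(h.first x hx).fderiv]
    simp
  rw [e1, e2.fderiv_eq]
  have h3 : ∀ a, HasFDerivAt (fun x => (form R a x (m 1) : ℂ))
      (Complex.ofRealCLM.comp (fderiv ℝ (fun x => form R a x (m 1)) p)) (p : Ambient n) := by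
    intro a
    refine Complex.ofRealCLM.hasFDerivAt.comp (p : Ambient n) (DifferentiableAt.hasFDerivAt ?_)
    exact ((contDiffOn_form (k := 1) a).contDiffAt hnhds).differentiableAt (by norm_num)
      |>.clm_apply (differentiableAt_const _)
  have h4 := HasFDerivAt.fun_sum (u := Finset.univ) fun a _ =>
    (h3 a).fun_mul (h.second a p hp0)
  rw [h4.fderiv]
  simp only [sum_apply, add_apply, FunLike.coe_smul, Pi.smul_apply, smul_eq_mul,
    ContinuousLinearMap.coe_comp, Function.comp_apply, Complex.ofRealCLM_apply,
    ContinuousLinearMap.smulRight_apply, Complex.real_smul]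
  exact Finset.sum_congr rfl fun a _ => by ring

/-- A C¹ function is locally Lipschitz, hence Lipschitz on the compact cylinder. This covers the
coefficients with which derivatives along isometries enter the Hessian. -/
theorem isLittleHolder_of_contDiffOn {α : ℝ≥0} (hα : α < 1) (hR : 0 < R) {φ : Ambient n → ℝ}
    (hφ : ContDiffOn ℝ 1 φ {x | x.fst ≠ 0}) :
    IsLittleHolder α (fun p : cylinder n R d => (φ p : ℂ)) := by
  have h1 : LocallyLipschitzOn (cylinder n R d) φ := by
    intro x hx
    obtain ⟨K, t, ht, hK⟩ := (hφ.contDiffAt (isOpen_fst_ne_zero.mem_nhds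
      (cylinder_fst_ne_zero hR ⟨x, hx⟩))).exists_lipschitzOnWith
    exact ⟨K, t, mem_nhdsWithin_of_mem_nhds ht, hK⟩
  obtain ⟨K, hK⟩ := h1.exists_lipschitzOnWith_of_compact (isCompact_cylinder n R d)
  refine IsLittleHolder.of_lipschitz hα (K := K) (LipschitzWith.of_dist_le_mul fun x y => ?_)
  rw [Complex.dist_of_im_eq (by simp)]
  exact hK.dist_le_mul x x.2 y y.2

theorem HasSecondDerivs.isLittleHolderTwo (h : HasSecondDerivs R d u u' u'') (hR : 0 < R)
    (hd : 0 < d) {α : ℝ≥0} (hα : α < 1)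
    (h1 : ∀ a, IsLittleHolder α fun p : cylinder n R d => ambientExt d (u' a) p)
    (h2 : ∀ a b, IsLittleHolder α fun p : cylinder n R d => ambientExt d (u'' a b) p) :
    IsLittleHolderTwo α fun p : cylinder n R d => ambientExt d u p := by
  refine ⟨(h.contDiffOn.mono fun x hx => hx.1).congr fun x hx => normalExt_eq_ambientExt hR u hx,
    IsLittleHolder.multilinear (stdOrthonormalBasis ℝ (Ambient n)) fun r => ?_⟩
  simp only [h.iteratedFDerivWithin_apply hR hd]
  have hf : ∀ (a : Option (Fin n × Fin n)) (w : Ambient n) {k : WithTop ℕ∞},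
      ContDiffOn ℝ k (fun x => form R a x w) {x | x.fst ≠ 0} := fun a w k =>
    (contDiffOn_form a).clm_apply contDiffOn_const
  refine IsLittleHolder.finset_sum _ fun a => IsLittleHolder.add (IsLittleHolder.mul ?_ (h1 a))
    (IsLittleHolder.mul (isLittleHolder_of_contDiffOn hα hR (hf a _))
      (IsLittleHolder.finset_sum _ fun b => IsLittleHolder.mul
        (isLittleHolder_of_contDiffOn hα hR (hf b _)) (h2 a b)))
  refine isLittleHolder_of_contDiffOn hα hR (ContDiffOn.clm_apply ?_ contDiffOn_const)
  exact (hf a _ (k := 2)).fderiv_of_isOpen isOpen_fst_ne_zero (by norm_num)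

/-- In the trace of the Hessian the first-order terms drop out because the forms are divergence free
on the cylinder. In the rest, ∑_k form_a(b_k) form_b(b_k) = form_b(X_a) by duality, and the tangency
relation turns the sum over b into u''_aa. -/
theorem HasSecondDerivs.laplaceBeltrami_eq (h : HasSecondDerivs R d u u' u'') (hR : 0 < R)
    (hd : 0 < d) (p : cylinder n R d) :
    laplaceBeltrami (fun p : cylinder n R d => ambientExt d u p) p
      = ∑ a, ambientExt d (u'' a a) p := by
  set b := stdOrthonormalBasis ℝ (Ambient n)
  have hpR : ‖(p : Ambient n).fst‖ = R := p.2.1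
  have hp0 := cylinder_fst_ne_zero hR p
  rw [laplaceBeltrami, InnerProductSpace.laplacianWithin_eq_iteratedFDerivWithin_orthonormalBasis _
    (uniqueDiffOn_slab n hd) (mem_slab hR p) b]
  simp only [h.iteratedFDerivWithin_apply hR hd, Matrix.cons_val_zero, Matrix.cons_val_one]
  rw [Finset.sum_comm]
  refine Finset.sum_congr rfl fun a _ => ?_
  rw [Finset.sum_add_distrib, ← Finset.sum_mul]
  -- The derivative in direction w of the antisymmetric linear factor vanishes when evaluated on w,
  -- so only the factor |q|^{-2} contributes. The trace is then a multiple of the inner product of a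
  -- radial and a tangent vector, which is 0.
  have hdiv : ∑ k, (fderiv ℝ (fun x => form R a x (b k)) p (b k) : ℂ) = 0 := by
    rw [← Complex.ofReal_sum, Complex.ofReal_eq_zero]
    rcases a with _ | ⟨i, j⟩
    · refine Finset.sum_eq_zero fun k _ => ?_
      simp [form]
    · set c : ℝ := (Real.sqrt 2)⁻¹ * R
      set X : Ambient n := WithLp.toLp 2 ((p : Ambient n).fst, 0)
      have hX : ∀ w : Ambient n, inner ℝ X w = inner ℝ (p : Ambient n).fst w.fst := by
        intro w
        simp [X, WithLp.prod_inner_apply]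
      have h1 : ∀ w : Ambient n, fderiv ℝ (fun x => form R (some (i, j)) x w) p w
          = (-2 * (R ^ 2)⁻¹) * (inner ℝ X w
            * inner ℝ (tangentVec R (some (i, j)) p) w) := by
        intro w
        have hn : HasFDerivAt (fun x : Ambient n => ‖x.fst‖ ^ 2) _ (p : Ambient n) :=
          ((WithLp.fstL 2 ℝ (EuclideanSpace ℝ (Fin n)) ℝ).hasFDerivAt).norm_sq
        have hn' := (hasDerivAt_inv (x := ‖(p : Ambient n).fst‖ ^ 2)
          (by rw [hpR]; positivity)).comp_hasFDerivAt (p : Ambient n) hn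
        have hl : HasFDerivAt (fun x : Ambient n => coord i x * coord j w - coord j x * coord i w) _
            (p : Ambient n) :=
          ((coord i).hasFDerivAt.mul_const (coord j w)).fun_sub
            ((coord j).hasFDerivAt.mul_const (coord i w))
        have hm := (hn'.const_mul c).fun_mul hl
        have e : (fun x => form R (some (i, j)) x w) = fun x : Ambient n =>
            c * ((fun y => y⁻¹) ∘ fun x : Ambient n => ‖x.fst‖ ^ 2) x
              * (coord i x * coord j w - coord j x * coord i w) := by
          funext x
          simp [form, c, coord_apply, div_eq_mul_inv]
        rw [e, hm.fderiv, inner_tangentVec hR _ hpR, hX]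
        simp only [add_apply, FunLike.coe_smul, Pi.smul_apply, FunLike.coe_sub, Pi.sub_apply,
          smul_eq_mul, Function.comp_apply, form, hpR, coord_apply]
        change _ * (_ * _ - _ * _) + (_ * _ - _ * _)
          * (c * (-((R ^ 2) ^ 2)⁻¹ * (2 • inner ℝ (p : Ambient n).fst w.fst))) = _
        rw [show (Real.sqrt 2)⁻¹ * R = c from rfl, nsmul_eq_mul]
        push_cast
        field_simp
        ring
      simp only [h1, ← Finset.mul_sum]
      have h2 := b.sum_inner_mul_inner X (tangentVec R (some (i, j)) p)
      have h3 : ∀ k, inner ℝ X (b k) * inner ℝ (tangentVec R (some (i, j)) p) (b k)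
          = inner ℝ X (b k) * inner ℝ (b k) (tangentVec R (some (i, j)) p) := fun k => by
        rw [real_inner_comm (b k) (tangentVec R (some (i, j)) p)]
      rw [Finset.sum_congr rfl fun k _ => h3 k, h2]
      have h4 : inner ℝ X (tangentVec R (some (i, j)) p) = 0 := by
        rw [real_inner_comm, inner_tangentVec hR _ hpR]
        simp [form, X, coord_apply, mul_comm]
      rw [h4, mul_zero]
  rw [hdiv, zero_mul, zero_add, ← h.tangent a p hpR]
  have hexp : ∀ b', form R b' p (tangentVec R a p) = ∑ k, form R a p (b k) * form R b' p (b k) := by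
    intro b'
    conv_lhs => rw [← b.sum_repr' (tangentVec R a p)]
    rw [map_sum]
    refine Finset.sum_congr rfl fun k _ => ?_
    rw [map_smul, smul_eq_mul, real_inner_comm, inner_tangentVec hR a hpR]
  simp only [hexp, Complex.ofReal_sum, Complex.ofReal_mul, Finset.sum_mul, Finset.mul_sum]
  rw [Finset.sum_comm]
  exact Finset.sum_congr rfl fun _ _ => Finset.sum_congr rfl fun _ _ => by ring

theorem HasSecondDerivs.axialDeriv_eq (h : HasSecondDerivs R d u u' u'') (hR : 0 < R)
    (hd : 0 < d) (p : cylinder n R d) :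
    axialDeriv (fun p : cylinder n R d => ambientExt d u p) p = ambientExt d (u' none) p := by
  have hp := mem_slab hR p
  have hp0 := cylinder_fst_ne_zero hR p
  have h1 : HasFDerivWithinAt (normalExt fun p : cylinder n R d => ambientExt d u p) _
      (slab n d) p := (h.first p hp0).hasFDerivWithinAt.congr
        (fun x hx => normalExt_eq_ambientExt hR u hx) (normalExt_eq_ambientExt hR u hp)
  rw [axialDeriv, h1.fderivWithin (uniqueDiffOn_slab n hd p hp)]
  rw [sum_apply, Fintype.sum_option]
  simp only [ContinuousLinearMap.smulRight_apply]
  have h2 : form R (none : Option (Fin n × Fin n)) p (WithLp.toLp 2 (0, 1)) = 1 := rfl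
  have h3 : ∀ ij : Fin n × Fin n, form R (some ij) p (WithLp.toLp 2 (0, 1)) = 0 := by
    intro ij
    simp [form, coord_apply]
  simp [h2, h3]

end Regularity

/-! ### Estimates for the heat semigroup and the resolvent -/

section Estimates

variable {n : ℕ} {R d : ℝ}

theorem rpow_half_sq {t : ℝ} (ht : 0 ≤ t) (a : ℝ) : (t ^ (a / 2)) ^ 2 = t ^ a := by
  rw [← Real.rpow_mul_natCast ht]
  norm_num

/-- For r ≤ t the first term suffices, for r > t the second. The barrier estimate needs a bound
affine in ρ, and this replaces the Hölder modulus by one that is adapted to the time scale t. -/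
theorem rpow_le_add_mul {α t r : ℝ} (hα0 : 0 < α) (hα1 : α ≤ 1) (ht : 0 < t) (hr : 0 ≤ r) :
    r ^ α ≤ t ^ α + t ^ (α - 1) * r := by
  rcases le_or_gt r t with h | h
  · have h1 : r ^ α ≤ t ^ α := Real.rpow_le_rpow hr h hα0.le
    have h2 : 0 ≤ t ^ (α - 1) * r := by positivity
    linarith
  · have hr' : 0 < r := ht.trans h
    have h1 : r ^ (α - 1) ≤ t ^ (α - 1) :=
      Real.rpow_le_rpow_of_nonpos ht h.le (by linarith)
    have h2 : r ^ α = r ^ (α - 1) * r := by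
      rw [← Real.rpow_add_one hr'.ne']
      ring_nf
    have h3 : 0 ≤ t ^ α := by positivity
    rw [h2]
    nlinarith [mul_le_mul_of_nonneg_right h1 hr]

/-- The constant in the localised gradient estimate. -/
def barrierConst (n : ℕ) : ℝ := 2 * n + Real.pi ^ 2 / 2

theorem barrierConst_nonneg (n : ℕ) : 0 ≤ barrierConst n := by
  unfold barrierConst
  positivity

theorem heat_sub_le (hR : 0 < R) (hd : 0 < d) (v : Modes n) (p : Model n) (c : ℂ) {A B : ℝ}
    (hB : 0 ≤ B) (h : ∀ x, ‖ev v x - c‖ ^ 2 ≤ A + B * rho R d x p) {t : ℝ} (ht : 0 ≤ t) :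
    ‖ev (heat R d t v) p - c‖ ^ 2 ≤ A + B * (barrierConst n * t) := by
  have h1 := heat_barrier hR hd v p c hB h ht
  have h2 : 0 ≤ 2 * t * ∑ a, ‖ev (field R d a (heat R d t v)) p‖ ^ 2 := by positivity
  unfold barrierConst
  linarith

theorem field_heat_sq_le (hR : 0 < R) (hd : 0 < d) (v : Modes n) (p : Model n) (c : ℂ) {A B : ℝ}
    (hB : 0 ≤ B) (h : ∀ x, ‖ev v x - c‖ ^ 2 ≤ A + B * rho R d x p) {t : ℝ} (ht : 0 < t)
    (a : Option (Fin n × Fin n)) :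
    ‖ev (field R d a (heat R d t v)) p‖ ^ 2 ≤ (A + B * (barrierConst n * t)) / t := by
  have h1 := heat_barrier hR hd v p c hB h ht.le
  have h2 := Finset.single_le_sum (f := fun a => ‖ev (field R d a (heat R d t v)) p‖ ^ 2)
    (fun _ _ => by positivity) (Finset.mem_univ a)
  have h3 := mul_le_mul_of_nonneg_left h2 ht.le
  have h4 : 0 ≤ t * ‖ev (field R d a (heat R d t v)) p‖ ^ 2 := by positivity
  rw [le_div_iff₀ ht]
  unfold barrierConst
  beta_reduce at h3
  nlinarith [sq_nonneg ‖ev (heat R d t v) p - c‖]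

theorem heat_sup_le (hR : 0 < R) (hd : 0 < d) {v : Modes n} {N : ℝ} (hv : ∀ x, ‖ev v x‖ ≤ N)
    {t : ℝ} (ht : 0 ≤ t) (p : Model n) : ‖ev (heat R d t v) p‖ ≤ N := by
  have hN : 0 ≤ N := (norm_nonneg _).trans (hv p)
  have h := heat_sub_le hR hd v p 0 (A := N ^ 2) (B := 0) le_rfl (fun x => by
    rw [sub_zero, zero_mul, add_zero]
    exact pow_le_pow_left₀ (norm_nonneg _) (hv x) 2) ht
  rw [sub_zero, zero_mul, add_zero] at h
  exact (sq_le_sq₀ (norm_nonneg _) hN).1 h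

theorem field_heat_sup_le (hR : 0 < R) (hd : 0 < d) {v : Modes n} {N : ℝ}
    (hv : ∀ x, ‖ev v x‖ ≤ N) {t : ℝ} (ht : 0 < t) (a : Option (Fin n × Fin n)) (p : Model n) :
    ‖ev (field R d a (heat R d t v)) p‖ ≤ N * t ^ (-1 / 2 : ℝ) := by
  have hN : 0 ≤ N := (norm_nonneg _).trans (hv p)
  have h := field_heat_sq_le hR hd v p 0 (A := N ^ 2) (B := 0) le_rfl (fun x => by
    rw [sub_zero, zero_mul, add_zero]
    exact pow_le_pow_left₀ (norm_nonneg _) (hv x) 2) ht a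
  rw [zero_mul, add_zero] at h
  refine (sq_le_sq₀ (norm_nonneg _) (by positivity)).1 (h.trans_eq ?_)
  rw [mul_pow, rpow_half_sq ht.le, Real.rpow_neg_one]
  rfl

/-- Hölder continuity on the model, with respect to `rho`. -/
def IsModelHolder (R d α H : ℝ) (g : Model n → ℂ) : Prop :=
  ∀ x p, ‖g x - g p‖ ^ 2 ≤ H ^ 2 * rho R d x p ^ α

/-- Apply the barrier with the constant v(p), A = H²t^α and B = H²t^{α-1}. The squared gradient is
then at most H²(1+K)t^{α-1}; enlarging 1+K to its square avoids a root in the constant. -/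
theorem field_heat_holder_le (hR : 0 < R) (hd : 0 < d) {α H : ℝ} (hα0 : 0 < α) (hα1 : α < 1)
    (hH : 0 ≤ H) {v : Modes n} (hv : IsModelHolder R d α H (ev v)) {t : ℝ} (ht : 0 < t)
    (a : Option (Fin n × Fin n)) (p : Model n) :
    ‖ev (field R d a (heat R d t v)) p‖
      ≤ H * (1 + barrierConst n) * t ^ ((α - 1) / 2) := by
  have hK := barrierConst_nonneg n
  have h := field_heat_sq_le hR hd v p (ev v p) (A := H ^ 2 * t ^ α) (B := H ^ 2 * t ^ (α - 1))
    (by positivity) (fun x => by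
      refine (hv x p).trans ?_
      have := mul_le_mul_of_nonneg_left
        (rpow_le_add_mul hα0 hα1.le ht (rho_nonneg R d x p)) (sq_nonneg H)
      linarith) ht a
  refine (sq_le_sq₀ (norm_nonneg _) (by positivity)).1 (h.trans ?_)
  rw [mul_pow, mul_pow, rpow_half_sq ht.le]
  have e : t ^ α = t ^ (α - 1) * t := by
    rw [← Real.rpow_add_one ht.ne']
    ring_nf
  have e2 : (H ^ 2 * t ^ α + H ^ 2 * t ^ (α - 1) * (barrierConst n * t)) / t
      = H ^ 2 * (1 + barrierConst n) * t ^ (α - 1) := by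
    rw [e]
    field_simp
  rw [e2]
  gcongr
  nlinarith

theorem rpow_div_le {t k β : ℝ} (ht : 0 < t) (hk : 1 ≤ k) (hβ : -2 ≤ β) :
    (t / k) ^ β ≤ k ^ 2 * t ^ β := by
  have hk0 : 0 < k := one_pos.trans_le hk
  rw [Real.div_rpow ht.le hk0.le, div_le_iff₀ (by positivity)]
  have h1 : k ^ (-2 : ℝ) ≤ k ^ β := Real.rpow_le_rpow_of_exponent_le hk hβ
  have h2 : k ^ 2 * k ^ (-2 : ℝ) = 1 := by
    rw [← Real.rpow_natCast, ← Real.rpow_add hk0]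
    norm_num
  have h3 : 0 < t ^ β := by positivity
  have h4 : 1 ≤ k ^ 2 * k ^ β := by
    rw [← h2]
    gcongr
  nlinarith

/-- Half of the time is spent on each derivative: the sup-norm gradient bound at time t/2 is applied
to X_a e^{(t/2)Δ}v. The factor 4 is 2², from `rpow_div_le` with k = 2; the third derivative costs
another factor 4. -/
theorem field_field_heat_holder_le (hR : 0 < R) (hd : 0 < d) {α H : ℝ} (hα0 : 0 < α)
    (hα1 : α < 1) (hH : 0 ≤ H) {v : Modes n} (hv : IsModelHolder R d α H (ev v)) {t : ℝ}
    (ht : 0 < t) (a b : Option (Fin n × Fin n)) (p : Model n) :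
    ‖ev (heat R d t (field R d b (field R d a v))) p‖
      ≤ H * (4 * (1 + barrierConst n)) * t ^ (α / 2 - 1) := by
  have hK := barrierConst_nonneg n
  have ht2 : 0 < t / 2 := by positivity
  have h1 := field_heat_sup_le hR hd (field_heat_holder_le hR hd hα0 hα1 hH hv ht2 a) ht2 b p
  have e : field R d b (heat R d (t / 2) (field R d a (heat R d (t / 2) v)))
      = heat R d t (field R d b (field R d a v)) := by
    simp only [field_heat, heat_heat, add_halves]
  rw [e] at h1
  refine h1.trans ?_
  rw [mul_assoc _ _ ((t / 2) ^ (-1 / 2 : ℝ)), ← Real.rpow_add ht2]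
  have h2 := rpow_div_le ht (k := 2) (β := α / 2 - 1) (by norm_num) (by linarith)
  calc H * (1 + barrierConst n) * (t / 2) ^ ((α - 1) / 2 + -1 / 2)
      = H * (1 + barrierConst n) * (t / 2) ^ (α / 2 - 1) := by ring_nf
    _ ≤ H * (1 + barrierConst n) * (2 ^ 2 * t ^ (α / 2 - 1)) := by gcongr
    _ = _ := by ring

theorem field_field_field_heat_holder_le (hR : 0 < R) (hd : 0 < d) {α H : ℝ} (hα0 : 0 < α)
    (hα1 : α < 1) (hH : 0 ≤ H) {v : Modes n} (hv : IsModelHolder R d α H (ev v)) {t : ℝ}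
    (ht : 0 < t) (a b c : Option (Fin n × Fin n)) (p : Model n) :
    ‖ev (field R d c (heat R d t (field R d b (field R d a v)))) p‖
      ≤ H * (16 * (1 + barrierConst n)) * t ^ (α / 2 - 3 / 2) := by
  have hK := barrierConst_nonneg n
  have ht2 : 0 < t / 2 := by positivity
  have h1 := field_heat_sup_le hR hd (field_field_heat_holder_le hR hd hα0 hα1 hH hv ht2 a b)
    ht2 c p
  rw [heat_heat, add_halves] at h1
  refine h1.trans ?_
  rw [mul_assoc _ _ ((t / 2) ^ (-1 / 2 : ℝ)), ← Real.rpow_add ht2]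
  have h2 := rpow_div_le ht (k := 2) (β := α / 2 - 3 / 2) (by norm_num) (by linarith)
  calc H * (4 * (1 + barrierConst n)) * (t / 2) ^ (α / 2 - 1 + -1 / 2)
      = H * (4 * (1 + barrierConst n)) * (t / 2) ^ (α / 2 - 3 / 2) := by ring_nf
    _ ≤ H * (4 * (1 + barrierConst n)) * (2 ^ 2 * t ^ (α / 2 - 3 / 2)) := by gcongr
    _ = _ := by ring

/-! #### Bounds for functions of time -/

theorem norm_sub_le_sub_of_deriv_le {g g' : ℝ → ℂ} {b b' : ℝ → ℝ} {s t : ℝ} (hst : s ≤ t)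
    (hg : ∀ r, HasDerivAt g (g' r) r) (hb : ∀ r ∈ Icc s t, HasDerivAt b (b' r) r)
    (hle : ∀ r ∈ Icc s t, ‖g' r‖ ≤ b' r) : ‖g t - g s‖ ≤ b t - b s := by
  refine image_norm_le_of_norm_deriv_right_le_deriv_boundary' (f := fun r => g r - g s) (f' := g')
    (B := fun r => b r - b s) (B' := b') (a := s) (b := t)
    (fun r _ => ((hg r).sub_const _).continuousAt.continuousWithinAt)
    (fun r _ => ((hg r).sub_const _).hasDerivWithinAt) (by simp)
    (fun r hr => ((hb r hr).sub_const _).continuousAt.continuousWithinAt)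
    (fun r hr => ((hb r ⟨hr.1, hr.2.le⟩).sub_const _).hasDerivWithinAt)
    (fun r hr => hle r ⟨hr.1, hr.2.le⟩) ⟨hst, le_rfl⟩

/-- The bound on the derivative is singular but integrable at 0: compare with (C/β)r^β on [ε, s] and
let ε → 0, using continuity of g. -/
theorem norm_sub_le_of_deriv_le_rpow {g g' : ℝ → ℂ} {β C s : ℝ} (hβ : 0 < β) (hs : 0 < s)
    (hg : ∀ r, HasDerivAt g (g' r) r) (hle : ∀ r, 0 < r → r ≤ s → ‖g' r‖ ≤ C * r ^ (β - 1)) :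
    ‖g s - g 0‖ ≤ C / β * s ^ β := by
  have h1 : ∀ ε ∈ Ioo 0 s, ‖g s - g ε‖ ≤ C / β * s ^ β - C / β * ε ^ β := by
    intro ε hε
    refine norm_sub_le_sub_of_deriv_le (b := fun r => C / β * r ^ β) hε.2.le hg (fun r hr => ?_)
      fun r hr => hle r (hε.1.trans_le hr.1) hr.2
    have h := (Real.hasDerivAt_rpow_const (x := r) (p := β)
      (Or.inl (hε.1.trans_le hr.1).ne')).const_mul (C / β)
    refine h.congr_deriv ?_
    field_simp
  have hg0 : Continuous g := continuous_iff_continuousAt.2 fun r => (hg r).continuousAt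
  have h2 : Filter.Tendsto (fun ε => ‖g s - g ε‖) (nhdsWithin 0 (Ioi 0)) (nhds ‖g s - g 0‖) :=
    ((continuous_const.sub hg0).norm.tendsto 0).mono_left nhdsWithin_le_nhds
  have h3 : Filter.Tendsto (fun ε => C / β * s ^ β - C / β * ε ^ β) (nhdsWithin 0 (Ioi 0))
      (nhds (C / β * s ^ β - C / β * 0 ^ β)) :=
    ((continuous_const.sub (continuous_const.mul (Real.continuous_rpow_const hβ.le))).tendsto
      0).mono_left nhdsWithin_le_nhds
  rw [Real.zero_rpow hβ.ne', mul_zero, sub_zero] at h3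
  exact le_of_tendsto_of_tendsto h2 h3 (Filter.eventually_of_mem (Ioo_mem_nhdsGT hs) h1)

theorem norm_le_of_deriv_le_of_tendsto {g g' : ℝ → ℂ} {b b' : ℝ → ℝ} {s M : ℝ}
    (hg : ∀ r, HasDerivAt g (g' r) r) (hb : ∀ r, s ≤ r → HasDerivAt b (b' r) r)
    (hle : ∀ r, s ≤ r → ‖g' r‖ ≤ b' r) (hM : ∀ r, s ≤ r → b r ≤ M)
    (hlim : Filter.Tendsto g Filter.atTop (nhds 0)) : ‖g s‖ ≤ M - b s := by
  have h1 : Filter.Tendsto (fun r => ‖g r - g s‖) Filter.atTop (nhds ‖0 - g s‖) :=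
    (hlim.sub_const _).norm
  rw [zero_sub, norm_neg] at h1
  refine le_of_tendsto h1 ?_
  filter_upwards [Filter.eventually_ge_atTop s] with r hr
  refine (norm_sub_le_sub_of_deriv_le hr hg (fun r hr => hb r hr.1) fun r hr => hle r hr.1).trans ?_
  linarith [hM r hr]

/-! #### The resolvent -/

theorem freq_nonneg (hn : 1 ≤ n) (i : ℕ × ℤ) : 0 ≤ freq n R d i := by
  have h : 0 ≤ (i.1 : ℝ) * ((i.1 : ℝ) + (n : ℝ) - 2) := by
    rcases Nat.eq_zero_or_pos i.1 with h0 | h0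
    · simp [h0]
    · have h1 : (1 : ℝ) ≤ i.1 := by exact_mod_cast h0
      have h2 : (1 : ℝ) ≤ n := by exact_mod_cast hn
      exact mul_nonneg (by linarith) (by linarith)
  unfold freq
  positivity

/-- The inverse of `1 - Δ` on sums of modes. -/
def resolvent (R d : ℝ) : Modes n →ₗ[ℂ] Modes n := scale fun i => (1 + (freq n R d i : ℂ))⁻¹

theorem scale_comm (c c' : ℕ × ℤ → ℂ) (v : Modes n) : scale c (scale c' v) = scale c' (scale c v) := by
  rw [scale_scale, scale_scale]
  simp only [mul_comm]

theorem modeLaplacian_resolvent (hn : 1 ≤ n) (v : Modes n) :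
    modeLaplacian R d (resolvent R d v) = resolvent R d v - v := by
  induction v using Modes.induction with
  | add u v hu hv =>
    simp only [map_add, hu, hv]
    abel
  | mode i h =>
    have h1 : (1 + (freq n R d i : ℂ)) ≠ 0 := by
      have := freq_nonneg (R := R) (d := d) hn i
      norm_cast
      positivity
    simp only [resolvent, modeLaplacian, scale_lof, map_smul, smul_smul]
    rw [eq_sub_iff_add_eq]
    nth_rewrite 2 [← one_smul ℂ (DirectSum.lof ℂ _ (fun i : ℕ × ℤ => Harm n i.1) i h)]
    rw [← add_smul]
    congr 1
    field_simp
    ring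

theorem field_resolvent (a : Option (Fin n × Fin n)) (v : Modes n) :
    field R d a (resolvent R d v) = resolvent R d (field R d a v) := (scale_field R d _ a v).symm

/-- The formula (1-Δ)^{-1}y = ∫ e^{-t}e^{tΔ}y dt in differential form. Bounds for the resolvent
follow by comparing this primitive with explicit functions, without forming the integral. -/
theorem hasDerivAt_exp_heat_resolvent (hn : 1 ≤ n) (y : Modes n) (p : Model n) (t : ℝ) :
    HasDerivAt (fun t => (Real.exp (-t) : ℂ) * ev (heat R d t (resolvent R d y)) p)
      (-((Real.exp (-t) : ℂ) * ev (heat R d t y) p)) t := by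
  have h1 : HasDerivAt (fun t => (Real.exp (-t) : ℂ)) ((-Real.exp (-t) : ℝ) : ℂ) t := by
    refine HasDerivAt.ofReal_comp ?_
    simpa using (hasDerivAt_neg t).exp
  refine (h1.fun_mul (hasDerivAt_heat R d (resolvent R d y) p t)).congr_deriv ?_
  have e : modeLaplacian R d (heat R d t (resolvent R d y))
      = heat R d t (resolvent R d y) - heat R d t y := by
    rw [← map_sub (heat R d t), ← modeLaplacian_resolvent hn, modeLaplacian, heat, scale_comm]
  rw [e, map_sub, ContinuousMap.sub_apply]
  push_cast
  ring

theorem exists_norm_ev_le (v : Modes n) : ∃ N, ∀ x, ‖ev v x‖ ≤ N :=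
  ⟨‖ev v‖, (ev v).norm_coe_le_norm⟩

theorem tendsto_exp_heat (hR : 0 < R) (hd : 0 < d) (v : Modes n) (p : Model n) :
    Filter.Tendsto (fun t => (Real.exp (-t) : ℂ) * ev (heat R d t v) p) Filter.atTop (nhds 0) := by
  obtain ⟨N, hN⟩ := exists_norm_ev_le v
  refine squeeze_zero_norm' (a := fun t => Real.exp (-t) * N) ?_ ?_
  · filter_upwards [Filter.eventually_ge_atTop 0] with t ht
    rw [norm_mul, Complex.norm_real, Real.norm_of_nonneg (Real.exp_pos _).le]
    gcongr
    exact heat_sup_le hR hd hN ht p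
  · simpa using (Real.tendsto_exp_neg_atTop_nhds_zero).mul_const N

/-- Split the time integral at t = 1: the power t^{β-1} contributes C/β before, and the factor
e^{-t} contributes at most C after. -/
theorem resolvent_sup_le (hn : 1 ≤ n) (hR : 0 < R) (hd : 0 < d) {y : Modes n} {p : Model n}
    {β C : ℝ} (hβ0 : 0 < β) (hβ1 : β ≤ 1)
    (hy : ∀ t, 0 < t → ‖ev (heat R d t y) p‖ ≤ C * t ^ (β - 1)) :
    ‖ev (resolvent R d y) p‖ ≤ C / β + C := by
  have hg := hasDerivAt_exp_heat_resolvent (R := R) (d := d) hn y p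
  have hC : 0 ≤ C := by simpa using (norm_nonneg _).trans (hy 1 one_pos)
  have hnorm : ∀ t, ‖-((Real.exp (-t) : ℂ) * ev (heat R d t y) p)‖
      = Real.exp (-t) * ‖ev (heat R d t y) p‖ := by
    intro t
    rw [norm_neg, norm_mul, Complex.norm_real, Real.norm_of_nonneg (Real.exp_pos _).le]
  have h1 := norm_sub_le_of_deriv_le_rpow (C := C) hβ0 one_pos hg fun t ht _ => by
    rw [hnorm]
    have := Real.exp_le_one_iff.2 (neg_nonpos.2 ht.le)
    exact (mul_le_of_le_one_left (norm_nonneg _) this).trans (hy t ht)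
  have h2 := norm_le_of_deriv_le_of_tendsto (s := 1) (M := 0) (b := fun t => -C * Real.exp (-t))
    (b' := fun t => C * Real.exp (-t)) hg (fun t _ => by
      have := (hasDerivAt_neg t).exp.const_mul (-C)
      simpa using this) (fun t ht => by
      rw [hnorm, mul_comm]
      gcongr
      refine (hy t (by linarith)).trans (mul_le_of_le_one_right hC ?_)
      exact Real.rpow_le_one_of_one_le_of_nonpos ht (by linarith))
    (fun t _ => by
      have := mul_nonneg hC (Real.exp_pos (-t)).le
      linarith) (tendsto_exp_heat hR hd _ p)
  rw [Real.one_rpow, mul_one, neg_zero, Real.exp_zero, heat_zero] at h1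
  have h3 : C * Real.exp (-1) ≤ C := mul_le_of_le_one_right hC (Real.exp_le_one_iff.2 (by norm_num))
  have h4 := norm_le_norm_add_norm_sub ((Real.exp (-1) : ℂ) * ev (heat R d 1 (resolvent R d y)) p)
    (((1 : ℝ) : ℂ) * ev (resolvent R d y) p)
  rw [norm_sub_rev] at h4
  simp only [Complex.ofReal_one, one_mul] at h4 h1
  rw [norm_sub_rev] at h4
  linarith

/-- Split the time at δ², the parabolic scale of the distance δ. Before it the two values are
bounded separately, after it their difference is bounded through one more derivative. Both parts
integrate to a multiple of δ^α; 0 < α < 1 makes the exponent α/2 - 1 integrable at 0 and α/2 - 3/2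
integrable at infinity. -/
theorem resolvent_sub_le (hn : 1 ≤ n) (hR : 0 < R) (hd : 0 < d) {y : Modes n} {p q : Model n}
    {α δ C C' : ℝ} (hα0 : 0 < α) (hα1 : α < 1) (hδ : 0 < δ)
    (hp : ∀ t, 0 < t → ‖ev (heat R d t y) p‖ ≤ C * t ^ (α / 2 - 1))
    (hq : ∀ t, 0 < t → ‖ev (heat R d t y) q‖ ≤ C * t ^ (α / 2 - 1))
    (hpq : ∀ t, 0 < t → ‖ev (heat R d t y) p - ev (heat R d t y) q‖
      ≤ C' * δ * t ^ (α / 2 - 3 / 2)) :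
    ‖ev (resolvent R d y) p - ev (resolvent R d y) q‖
      ≤ (4 * C / α + 2 * C' / (1 - α)) * δ ^ α := by
  have hg := fun t => (hasDerivAt_exp_heat_resolvent (R := R) (d := d) hn y p t).fun_sub
    (hasDerivAt_exp_heat_resolvent (R := R) (d := d) hn y q t)
  have hle : ∀ t, 0 < t → ‖-((Real.exp (-t) : ℂ) * ev (heat R d t y) p)
      - -((Real.exp (-t) : ℂ) * ev (heat R d t y) q)‖
      ≤ ‖ev (heat R d t y) p - ev (heat R d t y) q‖ := by
    intro t ht
    have e : -((Real.exp (-t) : ℂ) * ev (heat R d t y) p)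
      - -((Real.exp (-t) : ℂ) * ev (heat R d t y) q)
      = -((Real.exp (-t) : ℂ) * (ev (heat R d t y) p - ev (heat R d t y) q)) := by ring
    rw [e, norm_neg, norm_mul, Complex.norm_real, Real.norm_of_nonneg (Real.exp_pos _).le]
    exact mul_le_of_le_one_left (norm_nonneg _) (Real.exp_le_one_iff.2 (neg_nonpos.2 ht.le))
  have hδ2 : 0 < δ ^ 2 := by positivity
  have hpow : ∀ β : ℝ, (δ ^ 2) ^ β = δ ^ (2 * β) := fun β => by
    rw [← Real.rpow_natCast, ← Real.rpow_mul hδ.le]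
    norm_num
  have h1 := norm_sub_le_of_deriv_le_rpow (C := 2 * C) (β := α / 2) (by positivity) hδ2 hg
    fun t ht _ => by
      refine (hle t ht).trans ((norm_sub_le _ _).trans ?_)
      linarith [hp t ht, hq t ht]
  have hα' : 1 - α ≠ 0 := by linarith
  have h2 := norm_le_of_deriv_le_of_tendsto (s := δ ^ 2) (M := 0)
    (b := fun t => -(2 * C' / (1 - α) * δ) * t ^ (α / 2 - 1 / 2))
    (b' := fun t => C' * δ * t ^ (α / 2 - 3 / 2)) hg (fun t ht => by
      have := (Real.hasDerivAt_rpow_const (x := t) (p := α / 2 - 1 / 2)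
        (Or.inl (hδ2.trans_le ht).ne')).const_mul (-(2 * C' / (1 - α) * δ))
      refine this.congr_deriv ?_
      rw [show α / 2 - 1 / 2 - 1 = α / 2 - 3 / 2 by ring]
      field_simp
      ring) (fun t ht => (hle t (hδ2.trans_le ht)).trans (hpq t (hδ2.trans_le ht)))
    (fun t ht => by
      have h0 : 0 ≤ C' * δ * (1 : ℝ) ^ (α / 2 - 3 / 2) := (norm_nonneg _).trans (hpq 1 one_pos)
      rw [Real.one_rpow, mul_one] at h0
      have h3 : 0 ≤ 2 / (1 - α) * (C' * δ) := mul_nonneg (div_nonneg zero_le_two (by linarith)) h0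
      have h4 : 0 < t ^ (α / 2 - 1 / 2) := Real.rpow_pos_of_pos (hδ2.trans_le ht) _
      have e : -(2 * C' / (1 - α) * δ) * t ^ (α / 2 - 1 / 2)
        = -((2 / (1 - α) * (C' * δ)) * t ^ (α / 2 - 1 / 2)) := by ring
      rw [e]
      exact neg_nonpos.2 (mul_nonneg h3 h4.le))
    (by simpa using (tendsto_exp_heat hR hd _ p).sub (tendsto_exp_heat hR hd _ q))
  beta_reduce at h2
  rw [hpow] at h1 h2
  have e1 : 2 * (α / 2) = α := by ring
  have e2 : δ ^ α = δ * δ ^ (2 * (α / 2 - 1 / 2)) := by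
    rw [mul_comm, ← Real.rpow_add_one hδ.ne']
    ring_nf
  rw [e1] at h1
  rw [heat_zero, neg_zero, Real.exp_zero, Complex.ofReal_one, one_mul, one_mul] at h1
  set G := (Real.exp (-δ ^ 2) : ℂ) * ev (heat R d (δ ^ 2) (resolvent R d y)) p
    - (Real.exp (-δ ^ 2) : ℂ) * ev (heat R d (δ ^ 2) (resolvent R d y)) q
  have h4 := norm_le_norm_add_norm_sub G (ev (resolvent R d y) p - ev (resolvent R d y) q)
  have h5 : 0 - -(2 * C' / (1 - α) * δ) * δ ^ (2 * (α / 2 - 1 / 2)) = 2 * C' / (1 - α) * δ ^ α := by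
    rw [e2]
    ring
  have h6 : 2 * C / (α / 2) * δ ^ α = 4 * C / α * δ ^ α := by
    field_simp
    ring
  rw [h5] at h2
  rw [h6] at h1
  rw [add_mul]
  linarith

end Estimates

/-! ### The norm of the little-Hölder space -/

section LittleHolderNorm

variable {X : Type*} [MetricSpace X] {α : ℝ≥0}

theorem holderWith_of_norm_sub_le {F : Type*} [NormedAddCommGroup F] {f : X → F} {H : ℝ}
    (h : ∀ x y, ‖f x - f y‖ ≤ H * dist x y ^ (α : ℝ)) : HolderWith H.toNNReal α f := by
  intro x y
  rw [edist_nndist, edist_nndist, nndist_eq_nnnorm, ← ENNReal.coe_rpow_of_nonneg _ α.coe_nonneg,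
    ← ENNReal.coe_mul]
  refine ENNReal.coe_le_coe.2 ?_
  rw [← NNReal.coe_le_coe]
  push_cast
  refine (h x y).trans ?_
  gcongr
  exact Real.le_coe_toNNReal H

theorem LittleHolder.norm_apply_le (f : LittleHolder X α) (x : X) : ‖toFun f x‖ ≤ ‖f‖ := by
  rw [norm_def]
  have := le_ciSup f.bddAbove x
  have h : (0 : ℝ) ≤ nnHolderNorm α (toFun f) := NNReal.coe_nonneg _
  linarith

theorem LittleHolder.norm_sub_apply_le (f : LittleHolder X α) (x y : X) :
    ‖toFun f x - toFun f y‖ ≤ ‖f‖ * dist x y ^ (α : ℝ) := by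
  have h := f.isLittleHolder.2.1.holderWith.dist_le x y
  rw [dist_eq_norm] at h
  refine h.trans ?_
  gcongr
  rw [norm_def]
  have : 0 ≤ ⨆ x, ‖toFun f x‖ := Real.iSup_nonneg fun _ => norm_nonneg _
  linarith

theorem LittleHolder.norm_le {f : LittleHolder X α} {S H : ℝ} (hS : 0 ≤ S) (hH : 0 ≤ H)
    (h1 : ∀ x, ‖toFun f x‖ ≤ S) (h2 : ∀ x y, ‖toFun f x - toFun f y‖ ≤ H * dist x y ^ (α : ℝ)) :
    ‖f‖ ≤ S + H := by
  rw [norm_def]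
  refine add_le_add (Real.iSup_le h1 hS) ?_
  have h3 := (holderWith_of_norm_sub_le h2).nnholderNorm_le
  rw [← Real.coe_toNNReal H hH]
  exact_mod_cast h3

theorem LittleHolder.toFun_mk (f : X → ℂ) (hf : IsLittleHolder α f) : toFun (mk f hf) = f := rfl

theorem LittleHolder.tendsto_apply {f : ℕ → LittleHolder X α} {g : LittleHolder X α}
    (h : Filter.Tendsto f Filter.atTop (nhds g)) (x : X) :
    Filter.Tendsto (fun k => toFun (f k) x) Filter.atTop (nhds (toFun g x)) := by
  rw [tendsto_iff_norm_sub_tendsto_zero] at h ⊢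
  refine squeeze_zero (fun _ => norm_nonneg _) (fun k => ?_) h
  have := (f k - g).norm_apply_le x
  rwa [map_sub] at this

/-- The Cauchy estimate, both for the sup and for increments, passes to the pointwise limit. The
limit is little-Hölder because it differs by ε/2 in Hölder seminorm from a member of the sequence
whose own modulus is ε/2 at small scales. -/
instance LittleHolder.completeSpace : CompleteSpace (LittleHolder X α) := by
  refine Metric.complete_of_cauchySeq_tendsto fun f hf => ?_
  have hsub : ∀ j k x, ‖toFun (f j) x - toFun (f k) x‖ ≤ ‖f j - f k‖ := by
    intro j k x
    have := (f j - f k).norm_apply_le x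
    rwa [map_sub] at this
  have hsub2 : ∀ j k x y, ‖(toFun (f j) x - toFun (f k) x) - (toFun (f j) y - toFun (f k) y)‖
      ≤ ‖f j - f k‖ * dist x y ^ (α : ℝ) := by
    intro j k x y
    have := (f j - f k).norm_sub_apply_le x y
    rwa [map_sub] at this
  rw [Metric.cauchySeq_iff] at hf
  have hlim : ∀ x, ∃ z, Filter.Tendsto (fun k => toFun (f k) x) Filter.atTop (nhds z) := by
    intro x
    refine cauchySeq_tendsto_of_complete (Metric.cauchySeq_iff.2 fun ε hε => ?_)
    obtain ⟨N, hN⟩ := hf ε hε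
    refine ⟨N, fun j hj k hk => ?_⟩
    rw [dist_eq_norm]
    refine (hsub j k x).trans_lt ?_
    rw [← dist_eq_norm]
    exact hN j hj k hk
  choose g hg using hlim
  have key : ∀ ε > 0, ∃ N, ∀ k ≥ N, (∀ x, ‖toFun (f k) x - g x‖ ≤ ε) ∧
      ∀ x y, ‖(toFun (f k) x - g x) - (toFun (f k) y - g y)‖ ≤ ε * dist x y ^ (α : ℝ) := by
    intro ε hε
    obtain ⟨N, hN⟩ := hf ε hε
    have hN' : ∀ k ≥ N, ∀ j ≥ N, ‖f k - f j‖ ≤ ε := fun k hk j hj => by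
      rw [← dist_eq_norm]
      exact (hN k hk j hj).le
    refine ⟨N, fun k hk => ⟨fun x => ?_, fun x y => ?_⟩⟩
    · refine le_of_tendsto ((tendsto_const_nhds.sub (hg x)).norm) ?_
      filter_upwards [Filter.eventually_ge_atTop N] with j hj
      exact (hsub k j x).trans (hN' k hk j hj)
    · refine le_of_tendsto (((tendsto_const_nhds.sub (hg x)).sub
        (tendsto_const_nhds.sub (hg y))).norm) ?_
      filter_upwards [Filter.eventually_ge_atTop N] with j hj
      refine (hsub2 k j x y).trans ?_
      gcongr
      exact hN' k hk j hj
  have hgl : IsLittleHolder α g := by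
    obtain ⟨N, hN⟩ := key 1 one_pos
    obtain ⟨h1, h2⟩ := hN N le_rfl
    refine ⟨⟨‖f N‖ + 1, fun x => ?_⟩, (holderWith_of_norm_sub_le (H := ‖f N‖ + 1)
      fun x y => ?_).memHolder, fun ε hε => ?_⟩
    · have e : g x = toFun (f N) x - (toFun (f N) x - g x) := by ring
      rw [e]
      exact (norm_sub_le _ _).trans (add_le_add ((f N).norm_apply_le x) (h1 x))
    · have e : g x - g y = (toFun (f N) x - toFun (f N) y)
        - ((toFun (f N) x - g x) - (toFun (f N) y - g y)) := by ring
      rw [e, add_mul]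
      exact (norm_sub_le _ _).trans (add_le_add ((f N).norm_sub_apply_le x y) (h2 x y))
    · obtain ⟨M, hM⟩ := key (ε / 2) (by positivity)
      obtain ⟨r, hr, h3⟩ := (f M).isLittleHolder.2.2 (ε / 2) (by positivity)
      refine ⟨r, hr, fun x y hxy => ?_⟩
      have e : g x - g y = (toFun (f M) x - toFun (f M) y)
        - ((toFun (f M) x - g x) - (toFun (f M) y - g y)) := by ring
      rw [e]
      refine (norm_sub_le _ _).trans ((add_le_add (h3 x y hxy) ((hM M le_rfl).2 x y)).trans ?_)
      rw [← add_mul, add_halves]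
  refine ⟨mk g hgl, Metric.tendsto_atTop.2 fun ε hε => ?_⟩
  obtain ⟨N, hN⟩ := key (ε / 3) (by positivity)
  refine ⟨N, fun k hk => ?_⟩
  rw [dist_eq_norm]
  have h := LittleHolder.norm_le (f := f k - mk g hgl) (S := ε / 3) (H := ε / 3) (by positivity)
    (by positivity) (by simpa [map_sub, toFun_mk] using (hN k hk).1)
    (by simpa [map_sub, toFun_mk] using (hN k hk).2)
  linarith

end LittleHolderNorm

/-! ### The model as the double of the cylinder -/

section Fold

variable {n : ℕ} {R d : ℝ}

/-- The map from the cylinder to the model. -/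
def toModel (hR : 0 < R) (p : cylinder n R d) : Model n :=
  modelPoint d p (cylinder_fst_ne_zero hR p)

theorem ambientExt_coe (hR : 0 < R) (u : Model n → ℂ) (p : cylinder n R d) :
    ambientExt d u p = u (toModel hR p) :=
  ambientExt_of_ne u _

/-- The map from the model to the cylinder that identifies `(ω, w)` and `(ω, w⁻¹)`. -/
def fold (hR : 0 < R) (hd : 0 < d) (p : Model n) : cylinder n R d :=
  ⟨WithLp.toLp 2 (R • (p.1 : EuclideanSpace ℝ (Fin n)),
      d / Real.pi * Real.arccos (p.2 : ℂ).re), by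
    have h : ‖(p.1 : EuclideanSpace ℝ (Fin n))‖ = 1 := by simp
    have h1 := Real.arccos_nonneg (p.2 : ℂ).re
    have h2 := Real.arccos_le_pi (p.2 : ℂ).re
    refine ⟨by simp [norm_smul, h, abs_of_pos hR], mul_nonneg (by positivity) h1, ?_⟩
    calc d / Real.pi * Real.arccos (p.2 : ℂ).re ≤ d / Real.pi * Real.pi := by gcongr
      _ = d := by field_simp⟩

theorem fold_toModel (hR : 0 < R) (hd : 0 < d) (p : cylinder n R d) :
    fold hR hd (toModel hR p) = p := by
  have h : ‖(p : Ambient n).fst‖ = R := p.2.1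
  have hz : (p : Ambient n).snd ∈ Icc 0 d := p.2.2
  apply Subtype.ext
  refine WithLp.ofLp_injective 2 (Prod.ext ?_ ?_)
  · change R • (‖(p : Ambient n).fst‖⁻¹ • (p : Ambient n).fst) = (p : Ambient n).fst
    rw [h, smul_smul, mul_inv_cancel₀ hR.ne', one_smul]
  · change d / Real.pi * Real.arccos (Circle.exp (Real.pi / d * (p : Ambient n).snd) : ℂ).re
      = (p : Ambient n).snd
    rw [Circle.coe_exp, Complex.exp_ofReal_mul_I_re, Real.arccos_cos]
    · field_simp
    · have := hz.1
      positivity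
    · calc Real.pi / d * (p : Ambient n).snd ≤ Real.pi / d * d := by
            gcongr
            exact hz.2
        _ = Real.pi := by field_simp

theorem circle_re_im (w : Circle) : (w : ℂ).re ^ 2 + (w : ℂ).im ^ 2 = 1 := by
  have h := Circle.norm_coe w
  have h2 := Complex.sq_norm (w : ℂ)
  rw [h, Complex.normSq_apply] at h2
  linarith

theorem cos_arccos_circle (w : Circle) : Real.cos (Real.arccos (w : ℂ).re) = (w : ℂ).re := by
  have h := circle_re_im w
  exact Real.cos_arccos (by nlinarith [sq_nonneg (w : ℂ).im]) (by nlinarith [sq_nonneg (w : ℂ).im])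

theorem sin_arccos_circle (w : Circle) : Real.sin (Real.arccos (w : ℂ).re) = |(w : ℂ).im| := by
  rw [Real.sin_arccos, ← Real.sqrt_sq_eq_abs]
  congr 1
  linarith [circle_re_im w]

/-- Reflecting both points into the upper half circle does not increase the chord, as |Im w||Im w'|
≥ Im w · Im w'. On a half circle the chord is 2 sin(θ/2), and Jordan's inequality bounds the arc θ
by π/2 times the chord. -/
theorem sq_arccos_sub_le (w w' : Circle) :
    (Real.arccos (w : ℂ).re - Real.arccos (w' : ℂ).re) ^ 2
      ≤ Real.pi ^ 2 / 4 * ‖(w : ℂ) - w'‖ ^ 2 := by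
  set a := Real.arccos (w : ℂ).re
  set b := Real.arccos (w' : ℂ).re
  have hpi := Real.pi_pos
  have h1 : ‖(w : ℂ) - w'‖ ^ 2 = 2 - 2 * ((w : ℂ).re * (w' : ℂ).re + (w : ℂ).im * (w' : ℂ).im) := by
    rw [Complex.sq_norm, Complex.normSq_apply, Complex.sub_re, Complex.sub_im]
    linarith [circle_re_im w, circle_re_im w']
  have h2 : (w : ℂ).im * (w' : ℂ).im ≤ Real.sin a * Real.sin b := by
    rw [sin_arccos_circle, sin_arccos_circle, ← abs_mul]
    exact le_abs_self _
  have h3 : 2 - 2 * Real.cos (a - b) ≤ ‖(w : ℂ) - w'‖ ^ 2 := by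
    rw [h1, Real.cos_sub, cos_arccos_circle, cos_arccos_circle]
    linarith
  have h4 : 2 - 2 * Real.cos (a - b) = 4 * Real.sin ((a - b) / 2) ^ 2 := by
    rw [Real.sin_sq_eq_half_sub, mul_div_cancel₀ _ two_ne_zero]
    ring
  have h5 : |(a - b) / 2| ≤ Real.pi / 2 := by
    have a1 := Real.arccos_nonneg (w : ℂ).re
    have a2 := Real.arccos_le_pi (w : ℂ).re
    have b1 := Real.arccos_nonneg (w' : ℂ).re
    have b2 := Real.arccos_le_pi (w' : ℂ).re
    rw [abs_le]
    constructor <;> simp only [a, b] <;> linarith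
  have h6 := Real.mul_abs_le_abs_sin h5
  have h7 : (2 / Real.pi * |(a - b) / 2|) ^ 2 ≤ Real.sin ((a - b) / 2) ^ 2 := by
    rw [← sq_abs (Real.sin _)]
    exact pow_le_pow_left₀ (by positivity) h6 2
  rw [mul_pow, sq_abs] at h7
  have h8 : (2 / Real.pi) ^ 2 * ((a - b) / 2) ^ 2 = (a - b) ^ 2 / Real.pi ^ 2 := by
    field_simp
  rw [h8, div_le_iff₀ (by positivity)] at h7
  nlinarith [sq_nonneg Real.pi]

/-- Accounts for the weight d²/4 in `rho`: it is (d/π)² times the squared ratio (π/2)² of arc to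
chord. -/
theorem dist_fold_sq_le (hR : 0 < R) (hd : 0 < d) (x p : Model n) :
    dist (fold hR hd x) (fold hR hd p) ^ 2 ≤ rho R d x p := by
  have e : dist (fold hR hd x) (fold hR hd p)
      = ‖(fold hR hd x : Ambient n) - (fold hR hd p : Ambient n)‖ := by
    rw [Subtype.dist_eq, dist_eq_norm]
  rw [e, WithLp.prod_norm_sq_eq_of_L2]
  have h1 : ((fold hR hd x : Ambient n) - (fold hR hd p : Ambient n)).fst
      = R • ((x.1 : EuclideanSpace ℝ (Fin n)) - p.1) := by
    rw [smul_sub]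
    rfl
  have h2 : ((fold hR hd x : Ambient n) - (fold hR hd p : Ambient n)).snd
      = d / Real.pi * (Real.arccos (x.2 : ℂ).re - Real.arccos (p.2 : ℂ).re) := by
    rw [mul_sub]
    rfl
  rw [h1, h2, norm_smul, mul_pow, Real.norm_eq_abs, sq_abs, Real.norm_eq_abs, sq_abs, mul_pow, rho]
  have h3 := mul_le_mul_of_nonneg_left (sq_arccos_sub_le x.2 p.2) (sq_nonneg (d / Real.pi))
  have h4 : (d / Real.pi) ^ 2 * (Real.pi ^ 2 / 4 * ‖(x.2 : ℂ) - p.2‖ ^ 2)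
      = d ^ 2 / 4 * ‖(x.2 : ℂ) - p.2‖ ^ 2 := by
    field_simp
  linarith

theorem continuous_fold (hR : 0 < R) (hd : 0 < d) : Continuous (fold (n := n) hR hd) := by
  refine Continuous.subtype_mk ((WithLp.prod_continuous_toLp 2 _ _).comp ?_) _
  have h1 : Continuous fun p : Model n => (p.2 : ℂ).re :=
    Complex.continuous_re.comp (continuous_circle_coe.comp continuous_snd)
  have h2 : Continuous fun p : Model n => (p.1 : EuclideanSpace ℝ (Fin n)) :=
    continuous_subtype_val.comp continuous_fst
  exact (h2.const_smul R).prodMk (continuous_const.mul (Real.continuous_arccos.comp h1))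

/-- A function on the model that is even along the axis. -/
def IsEven (u : Model n → ℂ) : Prop := ∀ p : Model n, u (p.1, p.2⁻¹) = u p

theorem circle_exp_arccos (w : Circle) :
    Circle.exp (Real.arccos (w : ℂ).re) = w ∨ Circle.exp (Real.arccos (w : ℂ).re) = w⁻¹ := by
  have h : ((Circle.exp (Real.arccos (w : ℂ).re) : Circle) : ℂ) = ⟨(w : ℂ).re, |(w : ℂ).im|⟩ := by
    rw [Circle.coe_exp]
    apply Complex.ext
    · rw [Complex.exp_ofReal_mul_I_re, cos_arccos_circle]
    · rw [Complex.exp_ofReal_mul_I_im, sin_arccos_circle]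
  rcases le_total 0 (w : ℂ).im with h0 | h0
  · left
    apply Circle.ext
    rw [h, abs_of_nonneg h0]
  · right
    apply Circle.ext
    rw [h, abs_of_nonpos h0, Circle.coe_inv_eq_conj]
    rfl

theorem IsEven.apply_toModel_fold {u : Model n → ℂ} (hu : IsEven u) (hR : 0 < R) (hd : 0 < d)
    (x : Model n) : u (toModel hR (fold hR hd x)) = u x := by
  have h1 : (toModel hR (fold hR hd x)).1 = x.1 := by
    apply Subtype.ext
    have h2 : ‖(fold hR hd x : Ambient n).fst‖ = R := (fold hR hd x).2.1
    change ‖(fold hR hd x : Ambient n).fst‖⁻¹ • (R • (x.1 : EuclideanSpace ℝ (Fin n))) = x.1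
    rw [h2, smul_smul, inv_mul_cancel₀ hR.ne', one_smul]
  have h2 : (toModel hR (fold hR hd x)).2 = Circle.exp (Real.arccos (x.2 : ℂ).re) := by
    change Circle.exp (Real.pi / d * (d / Real.pi * Real.arccos (x.2 : ℂ).re)) = _
    congr 1
    field_simp
  have h3 : toModel hR (fold hR hd x) = (x.1, Circle.exp (Real.arccos (x.2 : ℂ).re)) :=
    Prod.ext h1 h2
  rw [h3]
  rcases circle_exp_arccos x.2 with h | h
  · rw [h]
  · rw [h]
    exact hu x

/-- An even function on the double is its restriction to the cylinder composed with `fold`, whose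
squared distances are dominated by `rho`. Squaring turns δ^α into (δ²)^α ≤ ρ^α. -/
theorem IsEven.isModelHolder {u : Model n → ℂ} (hu : IsEven u) (hR : 0 < R) (hd : 0 < d) {α H : ℝ}
    (hα : 0 < α)
    (h : ∀ p q : cylinder n R d, ‖u (toModel hR p) - u (toModel hR q)‖ ≤ H * dist p q ^ α) :
    IsModelHolder R d α H u := by
  intro x p
  have h1 := h (fold hR hd x) (fold hR hd p)
  rw [hu.apply_toModel_fold, hu.apply_toModel_fold] at h1
  refine (pow_le_pow_left₀ (norm_nonneg _) h1 2).trans ?_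
  rw [mul_pow, ← Real.rpow_mul_natCast dist_nonneg, mul_comm α, Real.rpow_mul dist_nonneg]
  have := dist_fold_sq_le hR hd x p
  gcongr
  exact_mod_cast this

/-- The map `(ω, w) ↦ (ω, w⁻¹)`, on sums of modes. -/
def reflect : Modes n →ₗ[ℂ] Modes n :=
  DirectSum.toModule ℂ _ _ fun i => DirectSum.lof ℂ _ (fun i : ℕ × ℤ => Harm n i.1) (i.1, -i.2)

theorem reflect_lof (i : ℕ × ℤ) (h : Harm n i.1) :
    reflect (DirectSum.lof ℂ _ (fun i : ℕ × ℤ => Harm n i.1) i h)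
      = DirectSum.lof ℂ _ (fun i : ℕ × ℤ => Harm n i.1) (i.1, -i.2) h := by
  rw [reflect, DirectSum.toModule_lof]

theorem ev_reflect (v : Modes n) (p : Model n) : ev (reflect v) p = ev v (p.1, p.2⁻¹) := by
  induction v using Modes.induction with
  | add u v hu hv => simp only [map_add, ContinuousMap.add_apply, hu, hv]
  | mode i h =>
    rw [reflect_lof, ev_lof, ev_lof]
    simp

theorem reflect_reflect (v : Modes n) : reflect (reflect v) = v := by
  induction v using Modes.induction with
  | add u v hu hv => simp only [map_add, hu, hv]
  | mode i h =>
    rw [reflect_lof, reflect_lof]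
    obtain ⟨l, m⟩ := i
    have e : ∀ m', m' = m → DirectSum.lof ℂ _ (fun i : ℕ × ℤ => Harm n i.1) (l, m') h
        = DirectSum.lof ℂ _ (fun i : ℕ × ℤ => Harm n i.1) (l, m) h := by
      rintro _ rfl
      rfl
    exact e _ (neg_neg m)

theorem scale_reflect {c : ℕ × ℤ → ℂ} (hc : ∀ l m, c (l, -m) = c (l, m)) (v : Modes n) :
    scale c (reflect v) = reflect (scale c v) := by
  induction v using Modes.induction with
  | add u v hu hv => simp only [map_add, hu, hv]
  | mode i h => rw [reflect_lof, scale_lof, scale_lof, map_smul, reflect_lof, hc]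

theorem freq_neg (n : ℕ) (R d : ℝ) (l : ℕ) (m : ℤ) : freq n R d (l, -m) = freq n R d (l, m) := by
  simp [freq]

theorem field_none_reflect (v : Modes n) :
    field R d none (reflect v) = -reflect (field R d none v) := by
  induction v using Modes.induction with
  | add u v hu hv =>
    simp only [map_add, hu, hv]
    abel
  | mode i h =>
    rw [reflect_lof, field_lof, field_lof, reflect_lof, ← map_neg]
    congr 1
    simp [fieldMode]

theorem isEven_ev {v : Modes n} (hv : reflect v = v) : IsEven (ev v) := fun p => by
  rw [← ev_reflect, hv]

theorem reflect_resolvent (v : Modes n) : reflect (resolvent R d v) = resolvent R d (reflect v) :=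
  (scale_reflect (fun l m => by rw [freq_neg]) v).symm

theorem reflect_heat (t : ℝ) (v : Modes n) : reflect (heat R d t v) = heat R d t (reflect v) :=
  (scale_reflect (fun l m => by rw [freq_neg]) v).symm

/-- Even sums of modes satisfy the Neumann condition. -/
theorem ev_field_none_eq_zero {v : Modes n} (hv : reflect v = v) {p : Model n} (hp : p.2⁻¹ = p.2) :
    ev (field R d none v) p = 0 := by
  have h1 := field_none_reflect (R := R) (d := d) v
  rw [hv] at h1
  have h2 : ev (field R d none v) p = -ev (field R d none v) p := by
    conv_lhs => rw [h1]
    rw [map_neg, ContinuousMap.neg_apply, ev_reflect, hp]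
  exact self_eq_neg.1 h2

/-- The ends z = 0 and z = d correspond to w = 1 and w = -1, the fixed points of the reflection. -/
theorem toModel_inv_eq (hR : 0 < R) (hd : 0 < d) {p : cylinder n R d}
    (hp : (p : Ambient n).snd = 0 ∨ (p : Ambient n).snd = d) :
    (toModel hR p).2⁻¹ = (toModel hR p).2 := by
  change (Circle.exp (Real.pi / d * (p : Ambient n).snd))⁻¹
    = Circle.exp (Real.pi / d * (p : Ambient n).snd)
  rcases hp with h | h
  · rw [h]
    simp
  · rw [h, div_mul_cancel₀ _ hd.ne']
    apply Circle.ext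
    rw [Circle.coe_inv]
    simp

end Fold

/-! ### Density of the sums of modes -/

section Density

variable {n : ℕ} {R d : ℝ} {α : ℝ≥0}

theorem isLittleHolder_ev (hR : 0 < R) (hα : α < 1) (v : Modes n) :
    IsLittleHolder α fun p : cylinder n R d => ev v (toModel hR p) := by
  set N := ‖ev v‖ + ∑ a, ‖ev (field R d a v)‖
  have hN : 0 ≤ N := by positivity
  have h1 : ∀ x, ‖ev v x‖ ≤ N := fun x => ((ev v).norm_coe_le_norm x).trans
    (le_add_of_nonneg_right (by positivity))
  have h2 : ∀ a x, ‖ev (field R d a v) x‖ ≤ N := fun a x =>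
    ((ev (field R d a v)).norm_coe_le_norm x).trans
      ((Finset.single_le_sum (f := fun a => ‖ev (field R d a v)‖) (fun _ _ => norm_nonneg _)
        (Finset.mem_univ a)).trans (le_add_of_nonneg_left (norm_nonneg _)))
  set c : ℝ := Fintype.card (Option (Fin n × Fin n)) * 5 * N
  have hc : 0 ≤ c := by positivity
  refine IsLittleHolder.of_lipschitz hα (K := (c + 2 * N / R).toNNReal)
    (LipschitzWith.of_dist_le_mul fun p q => ?_)
  rw [Real.coe_toNNReal _ (by positivity), dist_eq_norm]
  rcases le_or_gt (dist p q) R with h | h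
  · have h3 := (hasGradient_ev (d := d) hR v).norm_sub_le_mul_dist hR hN h2 p q h
    rw [ambientExt_coe hR, ambientExt_coe hR] at h3
    refine h3.trans ?_
    rw [add_mul]
    have : 0 ≤ 2 * N / R * dist p q := by positivity
    linarith
  · have h3 : ‖ev v (toModel hR p) - ev v (toModel hR q)‖ ≤ 2 * N :=
      (norm_sub_le _ _).trans (by linarith [h1 (toModel hR p), h1 (toModel hR q)])
    have h4 : 2 * N ≤ 2 * N / R * dist p q := by
      rw [div_mul_eq_mul_div, le_div_iff₀ hR]
      gcongr
    rw [add_mul]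
    have : 0 ≤ c * dist p q := by positivity
    linarith

/-- The restriction of a sum of modes to the cylinder. -/
def restr (hR : 0 < R) (hα : α < 1) : Modes n →ₗ[ℂ] LittleHolder (cylinder n R d) α where
  toFun v := LittleHolder.mk _ (isLittleHolder_ev hR hα v)
  map_add' u v := by
    apply LittleHolder.toFun_injective
    funext p
    simp [LittleHolder.toFun_mk]
  map_smul' c v := by
    apply LittleHolder.toFun_injective
    funext p
    simp [LittleHolder.toFun_mk]

theorem restr_apply (hR : 0 < R) (hα : α < 1) (v : Modes n) (p : cylinder n R d) :
    LittleHolder.toFun (restr hR hα v) p = ev v (toModel hR p) := rfl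

/-- The function `q(ω) w^m` on the model, for a polynomial `q`. -/
def polyFun (m : ℤ) : MvPolynomial (Fin n) ℂ →ₗ[ℂ] C(Model n, ℂ) where
  toFun q := ⟨fun p => MvPolynomial.eval (fun k => ((p.1 : EuclideanSpace ℝ (Fin n)) k : ℂ)) q
      * ((p.2 ^ m : Circle) : ℂ),
    ((continuous_eval_coe q).comp (continuous_subtype_val.comp continuous_fst)).mul
      (continuous_circle_coe.comp (Continuous.zpow (continuous_snd (Y := Circle)) m))⟩
  map_add' q q' := by
    ext p
    simp [add_mul]
  map_smul' c q := by
    ext p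
    simp [mul_assoc]

theorem polyFun_apply (m : ℤ) (q : MvPolynomial (Fin n) ℂ) (p : Model n) :
    polyFun m q p = MvPolynomial.eval (fun k => ((p.1 : EuclideanSpace ℝ (Fin n)) k : ℂ)) q
      * ((p.2 ^ m : Circle) : ℂ) := rfl

theorem eval_sqNorm (ω : Metric.sphere (0 : EuclideanSpace ℝ (Fin n)) 1) :
    MvPolynomial.eval (fun k => ((ω : EuclideanSpace ℝ (Fin n)) k : ℂ)) (sqNorm n) = 1 := by
  have h := real_inner_self_eq_norm_sq (ω : EuclideanSpace ℝ (Fin n))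
  rw [inner_eq_sum, norm_eq_of_mem_sphere] at h
  simp only [sqNorm, map_sum, map_mul, MvPolynomial.eval_X]
  exact_mod_cast h.trans (one_pow 2)

/-- On the unit sphere |x|² = 1, so |x|^{2j}h restricts to h; apply the harmonic decomposition to
each homogeneous component. -/
theorem polyFun_mem_range_ev (hn : 1 ≤ n) (q : MvPolynomial (Fin n) ℂ) (m : ℤ) :
    polyFun m q ∈ LinearMap.range (ev (n := n)) := by
  have hom : ∀ l (q : MvPolynomial (Fin n) ℂ), q.IsHomogeneous l →
      q ∈ (LinearMap.range (ev (n := n))).comap (polyFun m) := by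
    intro l q hq
    refine Submodule.span_le.2 ?_ (mem_span_harmonicMultiples hn l q hq)
    rintro _ ⟨-, -, k, j, h, hh, rfl⟩
    refine ⟨DirectSum.lof ℂ _ (fun i : ℕ × ℤ => Harm n i.1) (k, m) ⟨h, hh⟩, ?_⟩
    ext p
    rw [ev_lof, polyFun_apply, map_mul, map_pow, eval_sqNorm, one_pow, one_mul]
  have h := Submodule.sum_mem _ fun l (_ : l ∈ Finset.range (q.totalDegree + 1)) =>
    hom l _ (MvPolynomial.homogeneousComponent_isHomogeneous l q)
  rwa [MvPolynomial.sum_homogeneousComponent] at h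

/-- The algebra of functions on the model that are sums of modes. -/
def modeAlgebra (hn : 1 ≤ n) : StarSubalgebra ℂ C(Model n, ℂ) where
  carrier := LinearMap.range (ev (n := n))
  add_mem' ha hb := Submodule.add_mem _ ha hb
  zero_mem' := ⟨0, map_zero _⟩
  one_mem' := ⟨oneMode, by ext p; simp [ev_oneMode]⟩
  mul_mem' := by
    rintro _ _ ⟨u, rfl⟩ ⟨v, rfl⟩
    rw [SetLike.mem_coe]
    induction u using Modes.induction with
    | add u u' hu hu' =>
      rw [map_add, add_mul]
      exact Submodule.add_mem _ hu hu'
    | mode i h =>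
      induction v using Modes.induction with
      | add v v' hv hv' =>
        rw [map_add, mul_add]
        exact Submodule.add_mem _ hv hv'
      | mode j h' =>
        have e : ev (DirectSum.lof ℂ _ (fun i : ℕ × ℤ => Harm n i.1) i h)
            * ev (DirectSum.lof ℂ _ (fun i : ℕ × ℤ => Harm n i.1) j h')
            = polyFun (i.2 + j.2) (h.1 * h'.1) := by
          ext p
          rw [ContinuousMap.mul_apply, ev_lof, ev_lof, polyFun_apply, map_mul, zpow_add,
            Circle.coe_mul]
          ring
        rw [e]
        exact polyFun_mem_range_ev hn _ _
  algebraMap_mem' c := ⟨c • oneMode, by ext p; simp [ev_oneMode]⟩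
  star_mem' := by
    rintro _ ⟨u, rfl⟩
    rw [SetLike.mem_coe]
    induction u using Modes.induction with
    | add u u' hu hu' =>
      rw [map_add, star_add]
      exact Submodule.add_mem _ hu hu'
    | mode i h =>
      have e : star (ev (DirectSum.lof ℂ _ (fun i : ℕ × ℤ => Harm n i.1) i h))
          = polyFun (-i.2) (MvPolynomial.map (starRingEnd ℂ) h.1) := by
        ext p
        rw [ContinuousMap.star_apply, ev_lof, polyFun_apply, star_mul', zpow_neg,
          Circle.coe_inv_eq_conj]
        congr 1
        rw [MvPolynomial.eval_map, MvPolynomial.eval₂_eq', MvPolynomial.eval_eq']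
        simp [star_sum]
      rw [e]
      exact polyFun_mem_range_ev hn _ _

theorem mem_modeAlgebra (hn : 1 ≤ n) {f : C(Model n, ℂ)} :
    f ∈ modeAlgebra hn ↔ f ∈ LinearMap.range (ev (n := n)) := Iff.rfl

theorem separatesPoints_modeAlgebra (hn : 1 ≤ n) :
    (modeAlgebra hn).toSubalgebra.SeparatesPoints := by
  intro x y hxy
  by_cases h : x.1 = y.1
  · have h2 : x.2 ≠ y.2 := fun h2 => hxy (Prod.ext h h2)
    refine ⟨_, ⟨polyFun 1 1, (mem_modeAlgebra hn).2 (polyFun_mem_range_ev hn _ _), rfl⟩, fun h3 => h2 (Circle.ext ?_)⟩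
    simpa [polyFun_apply] using h3
  · obtain ⟨k, hk⟩ : ∃ k, (x.1 : EuclideanSpace ℝ (Fin n)) k ≠ (y.1 : EuclideanSpace ℝ (Fin n)) k := by
      by_contra! h'
      exact h (Subtype.ext (PiLp.ext h'))
    refine ⟨_, ⟨polyFun 0 (MvPolynomial.X k),
      (mem_modeAlgebra hn).2 (polyFun_mem_range_ev hn _ _), rfl⟩, fun h3 => hk ?_⟩
    simpa [polyFun_apply] using h3

theorem exists_ev_near (hn : 1 ≤ n) (g : C(Model n, ℂ)) {ε : ℝ} (hε : 0 < ε) :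
    ∃ v : Modes n, ∀ x, ‖ev v x - g x‖ ≤ ε := by
  have h := ContinuousMap.starSubalgebra_topologicalClosure_eq_top_of_separatesPoints _
    (separatesPoints_modeAlgebra hn)
  have h2 : g ∈ (modeAlgebra hn).topologicalClosure := by
    rw [h]
    trivial
  obtain ⟨f, hf, hv⟩ := Metric.mem_closure_iff.1 h2 ε hε
  obtain ⟨v, rfl⟩ := (mem_modeAlgebra hn).1 hf
  refine ⟨v, fun x => ?_⟩
  have h3 := (ev v - g).norm_coe_le_norm x
  rw [dist_comm, dist_eq_norm] at hv
  exact h3.trans hv.le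

theorem exists_even_ev_near (hn : 1 ≤ n) (g : C(Model n, ℂ)) (hg : IsEven g) {ε : ℝ} (hε : 0 < ε) :
    ∃ v : Modes n, reflect v = v ∧ ∀ x, ‖ev v x - g x‖ ≤ ε := by
  obtain ⟨v, hv⟩ := exists_ev_near hn g hε
  refine ⟨(1 / 2 : ℂ) • (v + reflect v), ?_, fun x => ?_⟩
  · rw [map_smul, map_add, reflect_reflect, add_comm]
  · have e : ev ((1 / 2 : ℂ) • (v + reflect v)) x - g x
        = (1 / 2 : ℂ) * ((ev v x - g x) + (ev v (x.1, x.2⁻¹) - g (x.1, x.2⁻¹))) := by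
      rw [map_smul, map_add, ContinuousMap.smul_apply, ContinuousMap.add_apply, ev_reflect, hg x,
        smul_eq_mul]
      ring
    rw [e, norm_mul]
    have h1 := norm_add_le (ev v x - g x) (ev v (x.1, x.2⁻¹) - g (x.1, x.2⁻¹))
    have h2 := hv x
    have h3 := hv (x.1, x.2⁻¹)
    norm_num
    linarith

theorem isEven_comp_fold (hR : 0 < R) (hd : 0 < d) (f : cylinder n R d → ℂ) :
    IsEven fun x => f (fold hR hd x) := by
  intro x
  have h : fold hR hd (x.1, x.2⁻¹) = fold hR hd x := by
    apply Subtype.ext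
    simp only [fold]
    rw [Circle.coe_inv_eq_conj, Complex.conj_re]
  beta_reduce
  rw [h]

/-- Even sums of modes are dense in the little-Hölder space. -/
theorem exists_even_restr_near (hn : 1 ≤ n) (hR : 0 < R) (hd : 0 < d) (hα0 : 0 < α) (hα1 : α < 1)
    (f : LittleHolder (cylinder n R d) α) {ε : ℝ} (hε : 0 < ε) :
    ∃ v : Modes n, reflect v = v ∧ ‖restr hR hα1 v - f‖ ≤ ε := by
  have hα0' : 0 < (α : ℝ) := by exact_mod_cast hα0
  have hα1' : (α : ℝ) < 1 := by exact_mod_cast hα1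
  have hK := barrierConst_nonneg n
  set S := 2 * (1 + barrierConst n)
  have hS : 0 < S := by positivity
  set c : ℝ := Fintype.card (Option (Fin n × Fin n)) * 5
  have hc : 0 ≤ c := by positivity
  -- The error will be Sε₀ in sup norm and (2S + cS + 1)ε₀ in Hölder seminorm: 2S for pairs that are
  -- far apart, cS for the gradient of the heat flow and 1 for f itself.
  set ε₀ := ε / (S + (2 * S + c * S + 1))
  have hε₀ : 0 < ε₀ := by positivity
  obtain ⟨r, hr, hf⟩ := f.isLittleHolder.2.2 ε₀ hε₀
  set M := 4 * ‖f‖ ^ 2 / r ^ 2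
  have hM : 0 ≤ M := by positivity
  set g : C(Model n, ℂ) := ⟨fun x => LittleHolder.toFun f (fold hR hd x),
    f.isLittleHolder.continuous.comp (continuous_fold hR hd)⟩
  -- Where the folded distance is below r, the little-Hölder condition gives the small constant ε₀;
  -- beyond r the trivial bound 2‖f‖ is absorbed into M ρ, since then ρ ≥ r².
  have hgρ : ∀ x p, ‖g x - g p‖ ^ 2 ≤ ε₀ ^ 2 * rho R d x p ^ (α : ℝ) + M * rho R d x p := by
    intro x p
    have h1 := dist_fold_sq_le hR hd x p
    set δ := dist (fold hR hd x) (fold hR hd p)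
    have hδ : 0 ≤ δ := dist_nonneg
    have hρ := rho_nonneg R d x p
    rcases lt_or_ge δ r with h | h
    · have h2 := pow_le_pow_left₀ (norm_nonneg _) (hf _ _ h) 2
      rw [mul_pow, ← Real.rpow_mul_natCast hδ, mul_comm (α : ℝ), Real.rpow_mul hδ] at h2
      have h3 : (δ ^ ((2 : ℕ) : ℝ)) ^ (α : ℝ) ≤ rho R d x p ^ (α : ℝ) := by
        gcongr
        exact_mod_cast h1
      have h4 := mul_le_mul_of_nonneg_left h3 (sq_nonneg ε₀)
      have h5 := mul_nonneg hM hρ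
      exact (h2.trans h4).trans (le_add_of_nonneg_right h5)
    · have h2 : ‖g x - g p‖ ≤ 2 * ‖f‖ := by
        refine (norm_sub_le _ _).trans ?_
        have h3 := f.norm_apply_le (fold hR hd x)
        have h4 := f.norm_apply_le (fold hR hd p)
        change ‖LittleHolder.toFun f (fold hR hd x)‖ + ‖LittleHolder.toFun f (fold hR hd p)‖ ≤ _
        linarith
      have h3 := pow_le_pow_left₀ (norm_nonneg _) h2 2
      have h4 : r ^ 2 ≤ rho R d x p := (pow_le_pow_left₀ hr.le h 2).trans h1
      have h5 : (2 * ‖f‖) ^ 2 ≤ M * rho R d x p := by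
        have e : (2 * ‖f‖) ^ 2 = M * r ^ 2 := by
          simp only [M]
          field_simp
          ring
        rw [e]
        gcongr
      have h6 : 0 ≤ ε₀ ^ 2 * rho R d x p ^ (α : ℝ) := by positivity
      linarith
  -- As α < 1, a small time t makes the coarse term Mt negligible against ε₀²t^α. The bounds by r²
  -- and R² allow the local estimates at distances below √t.
  obtain ⟨t, ht0, ht1, htr, htR, htM⟩ : ∃ t : ℝ, 0 < t ∧ t ≤ 1 ∧ t ≤ r ^ 2 ∧ t ≤ R ^ 2 ∧
      M * t ≤ ε₀ ^ 2 * t ^ (α : ℝ) := by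
    have h1 : Filter.Tendsto (fun t : ℝ => M * t ^ (1 - (α : ℝ))) (nhdsWithin 0 (Ioi 0)) (nhds 0) := by
      have h2 : 0 < 1 - (α : ℝ) := by linarith
      have := ((Real.continuous_rpow_const h2.le).tendsto 0).const_mul M
      rw [Real.zero_rpow h2.ne', mul_zero] at this
      exact this.mono_left nhdsWithin_le_nhds
    have h3 := h1.eventually (gt_mem_nhds (show 0 < ε₀ ^ 2 by positivity))
    have h4 : Ioo 0 (min 1 (min (r ^ 2) (R ^ 2))) ∈ nhdsWithin (0 : ℝ) (Ioi 0) :=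
      Ioo_mem_nhdsGT (by positivity)
    obtain ⟨t, h5, h6⟩ := (h3.and h4).exists
    have h7 := h6.2.le
    simp only [le_min_iff] at h7
    refine ⟨t, h6.1, h7.1, h7.2.1, h7.2.2, ?_⟩
    calc M * t = M * t ^ (1 - (α : ℝ)) * t ^ (α : ℝ) := by
          rw [mul_assoc, ← Real.rpow_add h6.1]
          simp
      _ ≤ _ := by
          have := Real.rpow_nonneg h6.1.le (α : ℝ)
          gcongr
  have hη : 0 < ε₀ * t ^ ((α : ℝ) / 2) := by positivity
  -- The uniform approximation knows nothing of the Hölder seminorm, but its error is tuned to the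
  -- time t. The heat flow up to t then has error of order ε₀t^{α/2} and gradient of order
  -- ε₀t^{(α-1)/2}.
  obtain ⟨v₀, hv₀, hv₀g⟩ := exists_even_ev_near hn g (isEven_comp_fold hR hd _) hη
  have e1 : t ^ (α : ℝ) = t ^ ((α : ℝ) - 1) * t := by
    rw [← Real.rpow_add_one ht0.ne']
    ring_nf
  have hbar : ∀ x p, ‖ev v₀ x - g p‖ ^ 2 ≤ 4 * ε₀ ^ 2 * t ^ (α : ℝ)
      + (2 * ε₀ ^ 2 * t ^ ((α : ℝ) - 1) + 2 * M) * rho R d x p := by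
    intro x p
    have h1 := pow_le_pow_left₀ (norm_nonneg _) (hv₀g x) 2
    rw [mul_pow, rpow_half_sq ht0.le] at h1
    have h2 := mul_le_mul_of_nonneg_left
      (rpow_le_add_mul hα0' hα1'.le ht0 (rho_nonneg R d x p)) (sq_nonneg ε₀)
    have h3 := hgρ x p
    have h4 := norm_add_le (ev v₀ x - g x) (g x - g p)
    rw [sub_add_sub_cancel] at h4
    have h5 := pow_le_pow_left₀ (norm_nonneg _) h4 2
    nlinarith [sq_nonneg (‖ev v₀ x - g x‖ - ‖g x - g p‖)]
  have hB : 0 ≤ 2 * ε₀ ^ 2 * t ^ ((α : ℝ) - 1) + 2 * M := by positivity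
  have hAB : 4 * ε₀ ^ 2 * t ^ (α : ℝ)
      + (2 * ε₀ ^ 2 * t ^ ((α : ℝ) - 1) + 2 * M) * (barrierConst n * t)
      ≤ (S * ε₀) ^ 2 * t ^ (α : ℝ) := by
    have h1 : (2 * ε₀ ^ 2 * t ^ ((α : ℝ) - 1) + 2 * M) * (barrierConst n * t)
        = barrierConst n * (2 * ε₀ ^ 2 * t ^ (α : ℝ) + 2 * (M * t)) := by
      rw [e1]
      ring
    have h2 : barrierConst n * (2 * ε₀ ^ 2 * t ^ (α : ℝ) + 2 * (M * t))
        ≤ barrierConst n * (4 * ε₀ ^ 2 * t ^ (α : ℝ)) := by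
      gcongr
      linarith
    rw [h1]
    have h3 : 0 ≤ ε₀ ^ 2 * t ^ (α : ℝ) := by positivity
    have e2 : (S * ε₀) ^ 2 * t ^ (α : ℝ)
        = 4 * (1 + barrierConst n) ^ 2 * (ε₀ ^ 2 * t ^ (α : ℝ)) := by
      simp only [S]
      ring
    rw [e2]
    nlinarith [mul_nonneg hK h3, mul_nonneg (sq_nonneg (barrierConst n)) h3]
  have hsup : ∀ p, ‖ev (heat R d t v₀) p - g p‖ ≤ S * ε₀ * t ^ ((α : ℝ) / 2) := by
    intro p
    have h := heat_sub_le hR hd v₀ p (g p) hB (fun x => hbar x p) ht0.le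
    refine (sq_le_sq₀ (norm_nonneg _) (by positivity)).1 ((h.trans hAB).trans_eq ?_)
    rw [mul_pow _ (t ^ _), rpow_half_sq ht0.le]
  have hgrad : ∀ a p, ‖ev (field R d a (heat R d t v₀)) p‖ ≤ S * ε₀ * t ^ (((α : ℝ) - 1) / 2) := by
    intro a p
    have h := field_heat_sq_le hR hd v₀ p (g p) hB (fun x => hbar x p) ht0 a
    refine (sq_le_sq₀ (norm_nonneg _) (by positivity)).1 (h.trans ?_)
    rw [mul_pow _ (t ^ _), rpow_half_sq ht0.le, div_le_iff₀ ht0, mul_assoc _ _ t, ← e1]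
    exact hAB
  refine ⟨heat R d t v₀, by rw [reflect_heat, hv₀], ?_⟩
  have hD : ∀ p : cylinder n R d, LittleHolder.toFun (restr hR hα1 (heat R d t v₀) - f) p
      = ev (heat R d t v₀) (toModel hR p) - g (toModel hR p) := by
    intro p
    rw [map_sub, Pi.sub_apply, restr_apply]
    change _ = _ - LittleHolder.toFun f (fold hR hd (toModel hR p))
    rw [fold_toModel]
  have key := LittleHolder.norm_le (f := restr hR hα1 (heat R d t v₀) - f) (S := S * ε₀)
    (H := (2 * S + c * S + 1) * ε₀) (by positivity) (by positivity) (fun p => ?_) fun p q => ?_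
  · refine key.trans_eq ?_
    rw [← add_mul, mul_comm, div_mul_cancel₀ _ (by positivity)]
  · rw [hD]
    refine (hsup _).trans (mul_le_of_le_one_right (by positivity) ?_)
    exact Real.rpow_le_one ht0.le ht1 (by positivity)
  · rw [hD, hD]
    set δ := dist p q
    have hδ : 0 ≤ δ := dist_nonneg
    have hpow : ∀ s β : ℝ, 0 ≤ s → (s ^ 2) ^ (β / 2) = s ^ β := by
      intro s β hs
      rw [← Real.rpow_natCast, ← Real.rpow_mul hs]
      congr 1
      push_cast
      ring
    -- At distances of at least √t the uniform error suffices. At smaller ones the gradient bound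
    -- controls the heat flow, and the little-Hölder modulus controls f.
    rcases le_or_gt t (δ ^ 2) with h | h
    · have h1 : t ^ ((α : ℝ) / 2) ≤ δ ^ (α : ℝ) := by
        rw [← hpow δ α hδ]
        gcongr
      refine (norm_sub_le _ _).trans ((add_le_add (hsup _) (hsup _)).trans ?_)
      have h2 := mul_le_mul_of_nonneg_left h1 (show 0 ≤ S * ε₀ by positivity)
      have h3 : 0 ≤ (c * S + 1) * ε₀ * δ ^ (α : ℝ) := by positivity
      linarith
    · have hδr : δ < r := lt_of_pow_lt_pow_left₀ 2 hr.le (h.trans_le htr)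
      have hδR : δ ≤ R := (lt_of_pow_lt_pow_left₀ 2 hR.le (h.trans_le htR)).le
      have h1 := (hasGradient_ev (d := d) hR (heat R d t v₀)).norm_sub_le_mul_dist hR
        (by positivity) hgrad p q hδR
      rw [ambientExt_coe hR, ambientExt_coe hR] at h1
      have h2 : ‖g (toModel hR p) - g (toModel hR q)‖ ≤ ε₀ * δ ^ (α : ℝ) := by
        change ‖LittleHolder.toFun f (fold hR hd (toModel hR p))
          - LittleHolder.toFun f (fold hR hd (toModel hR q))‖ ≤ _
        rw [fold_toModel, fold_toModel]
        exact hf p q hδr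
      have h3 : t ^ (((α : ℝ) - 1) / 2) * δ ≤ δ ^ (α : ℝ) := by
        rcases hδ.eq_or_lt with h0 | h0
        · rw [← h0, mul_zero, Real.zero_rpow hα0'.ne']
        · have h4 : t ^ (((α : ℝ) - 1) / 2) ≤ (δ ^ 2) ^ (((α : ℝ) - 1) / 2) :=
            Real.rpow_le_rpow_of_nonpos (by positivity) h.le (by linarith)
          rw [hpow δ _ hδ] at h4
          calc t ^ (((α : ℝ) - 1) / 2) * δ ≤ δ ^ ((α : ℝ) - 1) * δ := by gcongr
            _ = δ ^ (α : ℝ) := by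
              rw [← Real.rpow_add_one h0.ne']
              ring_nf
      rw [sub_sub_sub_comm]
      refine (norm_sub_le _ _).trans ((add_le_add h1 h2).trans ?_)
      have h5 := mul_le_mul_of_nonneg_left h3 (show 0 ≤ c * (S * ε₀) by positivity)
      have h6 : 0 ≤ 2 * S * ε₀ * δ ^ (α : ℝ) := by positivity
      have e3 : c * (S * ε₀ * t ^ (((α : ℝ) - 1) / 2)) * δ
          = c * (S * ε₀) * (t ^ (((α : ℝ) - 1) / 2) * δ) := by ring
      change c * (S * ε₀ * t ^ (((α : ℝ) - 1) / 2)) * δ + _ ≤ _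
      rw [e3]
      linarith

end Density

/-! ### Schauder estimates and the equation `u - Δ u = f` -/

section Schauder

variable {n : ℕ} {R d : ℝ} {α : ℝ≥0}

/-- Increments need to be controlled only at distances up to R; a farther pair costs at most 2N =
(2N/R^α)R^α. -/
theorem norm_restr_le (hR : 0 < R) (hα : α < 1) {w : Modes n} {N H : ℝ} (hN : 0 ≤ N) (hH : 0 ≤ H)
    (h1 : ∀ x, ‖ev w x‖ ≤ N) (h2 : ∀ p q : cylinder n R d, dist p q ≤ R →
      ‖ev w (toModel hR p) - ev w (toModel hR q)‖ ≤ H * dist p q ^ (α : ℝ)) :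
    ‖(restr hR hα w : LittleHolder (cylinder n R d) α)‖ ≤ N + (H + 2 * N / R ^ (α : ℝ)) := by
  refine LittleHolder.norm_le hN (by positivity) (fun p => h1 _) fun p q => ?_
  rw [restr_apply, restr_apply, add_mul]
  rcases le_or_gt (dist p q) R with h | h
  · have : 0 ≤ 2 * N / R ^ (α : ℝ) * dist p q ^ (α : ℝ) := by positivity
    linarith [h2 p q h]
  · have h3 : R ^ (α : ℝ) ≤ dist p q ^ (α : ℝ) := by gcongr
    have h4 : 2 * N ≤ 2 * N / R ^ (α : ℝ) * dist p q ^ (α : ℝ) := by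
      rw [div_mul_eq_mul_div, le_div_iff₀ (by positivity)]
      gcongr
    have h5 : 0 ≤ H * dist p q ^ (α : ℝ) := by positivity
    have h6 := norm_sub_le (ev w (toModel hR p)) (ev w (toModel hR q))
    linarith [h1 (toModel hR p), h1 (toModel hR q)]

theorem norm_sub_le_of_fields (hR : 0 < R) {w : Modes n} {N : ℝ} (hN : 0 ≤ N)
    (h : ∀ a x, ‖ev (field R d a w) x‖ ≤ N) (p q : cylinder n R d) (hpq : dist p q ≤ R) :
    ‖ev w (toModel hR p) - ev w (toModel hR q)‖
      ≤ Fintype.card (Option (Fin n × Fin n)) * 5 * N * dist p q := by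
  have h1 := (hasGradient_ev (d := d) hR w).norm_sub_le_mul_dist hR hN h p q hpq
  rwa [ambientExt_coe hR, ambientExt_coe hR] at h1

theorem norm_restr_le_of_fields (hR : 0 < R) (hα : α < 1) {w : Modes n} {N : ℝ} (hN : 0 ≤ N)
    (h1 : ∀ x, ‖ev w x‖ ≤ N) (h2 : ∀ a x, ‖ev (field R d a w) x‖ ≤ N) :
    ‖(restr hR hα w : LittleHolder (cylinder n R d) α)‖
      ≤ (1 + (Fintype.card (Option (Fin n × Fin n)) * 5 * R ^ (1 - (α : ℝ))
        + 2 / R ^ (α : ℝ))) * N := by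
  have hα' : 0 ≤ 1 - (α : ℝ) := sub_nonneg.2 (by exact_mod_cast hα.le)
  refine (norm_restr_le hR hα hN
    (H := Fintype.card (Option (Fin n × Fin n)) * 5 * N * R ^ (1 - (α : ℝ))) (by positivity) h1
    fun p q hpq => (norm_sub_le_of_fields hR hN h2 p q hpq).trans ?_).trans_eq (by ring)
  rw [mul_assoc _ (R ^ _)]
  gcongr
  rcases (dist_nonneg (x := p) (y := q)).eq_or_lt with h0 | h0
  · rw [← h0]
    positivity
  · calc dist p q = dist p q ^ (1 - (α : ℝ)) * dist p q ^ (α : ℝ) := by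
          rw [← Real.rpow_add h0]
          simp
      _ ≤ _ := by gcongr

theorem norm_ev_le_of_even (hR : 0 < R) (hd : 0 < d) {v : Modes n} (hv : reflect v = v) {N : ℝ}
    (h : ∀ p : cylinder n R d, ‖ev v (toModel hR p)‖ ≤ N) (x : Model n) : ‖ev v x‖ ≤ N := by
  rw [← (isEven_ev hv).apply_toModel_fold hR hd]
  exact h _

theorem norm_resolvent_le (hn : 1 ≤ n) (hR : 0 < R) (hd : 0 < d) {v : Modes n} {N : ℝ}
    (h : ∀ x, ‖ev v x‖ ≤ N) (x : Model n) : ‖ev (resolvent R d v) x‖ ≤ 2 * N := by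
  have h1 := resolvent_sup_le hn hR hd (y := v) (p := x) (β := 1) (C := N) one_pos le_rfl
    fun t ht => by
      rw [sub_self, Real.rpow_zero, mul_one]
      exact heat_sup_le hR hd h ht.le x
  linarith

theorem norm_field_resolvent_le (hn : 1 ≤ n) (hR : 0 < R) (hd : 0 < d) {v : Modes n} {N : ℝ}
    (h : ∀ x, ‖ev v x‖ ≤ N) (a : Option (Fin n × Fin n)) (x : Model n) :
    ‖ev (field R d a (resolvent R d v)) x‖ ≤ 3 * N := by
  have h1 := resolvent_sup_le hn hR hd (y := field R d a v) (p := x) (β := 1 / 2) (C := N)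
    (by norm_num) (by norm_num) fun t ht => by
      rw [← field_heat]
      have := field_heat_sup_le hR hd h ht a x
      norm_num at this ⊢
      exact this
  rw [field_resolvent]
  linarith

/-- The constant depends on no frequency cutoff, which permits passage to limits. Evenness is needed
because the h^α norm sees only half of the double. The second derivatives gain their Hölder bound
from `resolvent_sub_le`; the lower ones inherit it from bounds on one further derivative. -/
theorem schauder_bound (hn : 1 ≤ n) (hR : 0 < R) (hd : 0 < d) (hα0 : 0 < α) (hα1 : α < 1) :
    ∃ C : ℝ, 0 ≤ C ∧ ∀ v : Modes n, reflect v = v →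
      (‖ev (resolvent R d v)‖ ≤ C * ‖(restr hR hα1 v : LittleHolder (cylinder n R d) α)‖ ∧
        ‖(restr hR hα1 (resolvent R d v) : LittleHolder (cylinder n R d) α)‖
          ≤ C * ‖(restr hR hα1 v : LittleHolder (cylinder n R d) α)‖) ∧
      (∀ a, ‖ev (field R d a (resolvent R d v))‖
          ≤ C * ‖(restr hR hα1 v : LittleHolder (cylinder n R d) α)‖ ∧
        ‖(restr hR hα1 (field R d a (resolvent R d v)) : LittleHolder (cylinder n R d) α)‖
          ≤ C * ‖(restr hR hα1 v : LittleHolder (cylinder n R d) α)‖) ∧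
      ∀ a b, ‖ev (field R d b (field R d a (resolvent R d v)))‖
          ≤ C * ‖(restr hR hα1 v : LittleHolder (cylinder n R d) α)‖ ∧
        ‖(restr hR hα1 (field R d b (field R d a (resolvent R d v))) :
            LittleHolder (cylinder n R d) α)‖
          ≤ C * ‖(restr hR hα1 v : LittleHolder (cylinder n R d) α)‖ := by
  have hα0' : 0 < (α : ℝ) := by exact_mod_cast hα0
  have hα1' : (α : ℝ) < 1 := by exact_mod_cast hα1
  have hα2 : 0 < 1 - (α : ℝ) := by linarith
  have hK := barrierConst_nonneg n
  set κ : ℝ := (Fintype.card (Option (Fin n × Fin n)) : ℝ)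
  have hκ : 0 ≤ κ := by positivity
  set c₂ : ℝ := 4 * (1 + barrierConst n) * (2 / (α : ℝ) + 1)
  have hc₂ : 0 ≤ c₂ := by positivity
  set c₃ : ℝ := 16 * (1 + barrierConst n) / (α : ℝ) + 160 * κ * (1 + barrierConst n) / (1 - (α : ℝ))
  have hc₃ : 0 ≤ c₃ := by positivity
  set c₁ : ℝ := 1 + (κ * 5 * R ^ (1 - (α : ℝ)) + 2 / R ^ (α : ℝ))
  have hc₁ : 1 ≤ c₁ := le_add_of_nonneg_right (by positivity)
  have hc₁' : 1 + 2 / R ^ (α : ℝ) ≤ c₁ := by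
    have : 0 ≤ κ * 5 * R ^ (1 - (α : ℝ)) := by positivity
    simp only [c₁]
    linarith
  refine ⟨c₁ * (3 + c₂) + c₃, by positivity, fun v hv => ?_⟩
  set H := ‖(restr hR hα1 v : LittleHolder (cylinder n R d) α)‖
  have hH : 0 ≤ H := norm_nonneg _
  have hsup : ∀ x, ‖ev v x‖ ≤ H := norm_ev_le_of_even hR hd hv fun p =>
    (restr hR hα1 v).norm_apply_le p
  have hmod : IsModelHolder R d α H (ev v) := (isEven_ev hv).isModelHolder hR hd hα0' fun p q =>
    (restr hR hα1 v).norm_sub_apply_le p q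
  have hC0 : (3 + c₂) * H ≤ (c₁ * (3 + c₂) + c₃) * H := by
    have h0 : 3 + c₂ ≤ c₁ * (3 + c₂) + c₃ := by nlinarith
    exact mul_le_mul_of_nonneg_right h0 hH
  have hC1 : c₁ * ((3 + c₂) * H) ≤ (c₁ * (3 + c₂) + c₃) * H := by nlinarith
  have b0 : ∀ x, ‖ev (resolvent R d v) x‖ ≤ (3 + c₂) * H := fun x => by
    refine (norm_resolvent_le hn hR hd hsup x).trans ?_
    nlinarith
  have b1 : ∀ a x, ‖ev (field R d a (resolvent R d v)) x‖ ≤ (3 + c₂) * H := fun a x => by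
    refine (norm_field_resolvent_le hn hR hd hsup a x).trans ?_
    nlinarith
  have b2 : ∀ a b x, ‖ev (field R d b (field R d a (resolvent R d v))) x‖ ≤ c₂ * H := by
    intro a b x
    have h := resolvent_sup_le hn hR hd (y := field R d b (field R d a v)) (p := x)
      (β := (α : ℝ) / 2) (C := H * (4 * (1 + barrierConst n))) (by positivity) (by linarith)
      fun t ht => field_field_heat_holder_le hR hd hα0' hα1' hH hmod ht a b x
    rw [field_resolvent, field_resolvent]
    refine h.trans_eq ?_
    simp only [c₂]
    field_simp
  have b2' : ∀ a b x, ‖ev (field R d b (field R d a (resolvent R d v))) x‖ ≤ (3 + c₂) * H :=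
    fun a b x => (b2 a b x).trans (by nlinarith)
  have b3 : ∀ a b, ∀ p q : cylinder n R d, dist p q ≤ R →
      ‖ev (field R d b (field R d a (resolvent R d v))) (toModel hR p)
        - ev (field R d b (field R d a (resolvent R d v))) (toModel hR q)‖
        ≤ c₃ * H * dist p q ^ (α : ℝ) := by
    intro a b p q hpq
    rcases (dist_nonneg (x := p) (y := q)).eq_or_lt with h0 | h0
    · rw [dist_eq_zero.1 h0.symm, sub_self, norm_zero]
      positivity
    · rw [field_resolvent, field_resolvent]
      refine (resolvent_sub_le hn hR hd (y := field R d b (field R d a v)) hα0' hα1' h0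
        (fun t ht => field_field_heat_holder_le hR hd hα0' hα1' hH hmod ht a b _)
        (fun t ht => field_field_heat_holder_le hR hd hα0' hα1' hH hmod ht a b _)
        (C' := κ * 5 * (H * (16 * (1 + barrierConst n)))) fun t ht => ?_).trans_eq ?_
      · refine (norm_sub_le_of_fields hR (by positivity) (fun c x =>
          field_field_field_heat_holder_le hR hd hα0' hα1' hH hmod ht a b c x) p q hpq).trans_eq ?_
        ring
      · simp only [c₃]
        field_simp
        ring
  have hN : 0 ≤ (3 + c₂) * H := by positivity
  refine ⟨⟨?_, ?_⟩, fun a => ⟨?_, ?_⟩, fun a b => ⟨?_, ?_⟩⟩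
  · exact (ContinuousMap.norm_le _ (by positivity)).2 fun x => (b0 x).trans hC0
  · exact (norm_restr_le_of_fields hR hα1 hN b0 b1).trans hC1
  · exact (ContinuousMap.norm_le _ (by positivity)).2 fun x => (b1 a x).trans hC0
  · exact (norm_restr_le_of_fields hR hα1 hN (b1 a) fun b x => b2' a b x).trans hC1
  · exact (ContinuousMap.norm_le _ (by positivity)).2 fun x => (b2' a b x).trans hC0
  · refine (norm_restr_le hR hα1 hN (by positivity) (b2' a b) (b3 a b)).trans ?_
    have h3 : (3 + c₂) * H + (c₃ * H + 2 * ((3 + c₂) * H) / R ^ (α : ℝ))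
        = (1 + 2 / R ^ (α : ℝ)) * ((3 + c₂) * H) + c₃ * H := by ring
    have h4 := mul_le_mul_of_nonneg_right hc₁' hN
    rw [h3, add_mul (c₁ * _)]
    linarith

/-- Extension by density: a linear map that is bounded on even modes sends sequences converging in
h^α to Cauchy sequences. -/
theorem tendsto_of_norm_le_restr {E : Type*} [NormedAddCommGroup E] [NormedSpace ℂ E]
    [CompleteSpace E] (hR : 0 < R) (hα : α < 1) (Φ : Modes n →ₗ[ℂ] E) {C : ℝ} (hC : 0 ≤ C)
    (hΦ : ∀ v, reflect v = v → ‖Φ v‖ ≤ C * ‖(restr hR hα v : LittleHolder (cylinder n R d) α)‖)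
    {v : ℕ → Modes n} (hv : ∀ k, reflect (v k) = v k) {f : LittleHolder (cylinder n R d) α}
    (hf : Filter.Tendsto (fun k => restr hR hα (v k)) Filter.atTop (nhds f)) :
    ∃ z, Filter.Tendsto (fun k => Φ (v k)) Filter.atTop (nhds z) := by
  refine cauchySeq_tendsto_of_complete (Metric.cauchySeq_iff.2 fun ε hε => ?_)
  obtain ⟨N, hN⟩ := Metric.cauchySeq_iff.1 hf.cauchySeq (ε / (C + 1)) (by positivity)
  refine ⟨N, fun j hj k hk => ?_⟩
  have h1 := hN j hj k hk
  have h2 := hΦ (v j - v k) (by rw [map_sub, hv, hv])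
  rw [dist_eq_norm, ← map_sub] at h1 ⊢
  rw [lt_div_iff₀ (by positivity)] at h1
  refine h2.trans_lt (lt_of_le_of_lt ?_ h1)
  rw [mul_comm]
  gcongr
  linarith

/-- Existence for `u - Δ u = f`, with an approximation by sums of modes. -/
theorem exists_solution (hn : 1 ≤ n) (hR : 0 < R) (hd : 0 < d) (hα0 : 0 < α) (hα1 : α < 1)
    (f : LittleHolder (cylinder n R d) α) :
    ∃ u ∈ neumannDomain hR hd α, (∀ p, laplaceBeltrami (LittleHolder.toFun u) p
        = LittleHolder.toFun u p - LittleHolder.toFun f p) ∧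
      ∃ v : ℕ → Modes n, (∀ k, reflect (v k) = v k) ∧
        Filter.Tendsto (fun k => restr hR hα1 (v k)) Filter.atTop (nhds f) ∧
        Filter.Tendsto (fun k => restr hR hα1 (resolvent R d (v k))) Filter.atTop (nhds u) := by
  obtain ⟨C, hC, hS⟩ := schauder_bound (d := d) hn hR hd hα0 hα1
  choose v hv hvf using fun k : ℕ => exists_even_restr_near hn hR hd hα0 hα1 f
    (ε := 1 / ((k : ℝ) + 1)) (by positivity)
  have hf : Filter.Tendsto (fun k => restr hR hα1 (v k)) Filter.atTop (nhds f) := by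
    rw [tendsto_iff_norm_sub_tendsto_zero]
    exact squeeze_zero (fun _ => norm_nonneg _) hvf tendsto_one_div_add_atTop_nhds_zero_nat
  -- The approximate solutions and their first two derivatives converge in two senses: uniformly on
  -- the model, which gives the C² structure of the limit, and in h^α on the cylinder, which gives
  -- its little-Hölder regularity. The statement `hlim` identifies the two limits.
  obtain ⟨F, hF⟩ := tendsto_of_norm_le_restr hR hα1 (ev ∘ₗ resolvent R d) hC
    (fun v hv => (hS v hv).1.1) hv hf
  obtain ⟨u, hu⟩ := tendsto_of_norm_le_restr hR hα1
    ((restr hR hα1 : _ →ₗ[ℂ] LittleHolder (cylinder n R d) α) ∘ₗ resolvent R d) hC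
    (fun v hv => (hS v hv).1.2) hv hf
  choose F' hF' using fun a => tendsto_of_norm_le_restr hR hα1
    (ev ∘ₗ field R d a ∘ₗ resolvent R d) hC (fun v hv => ((hS v hv).2.1 a).1) hv hf
  choose u' hu' using fun a => tendsto_of_norm_le_restr hR hα1
    ((restr hR hα1 : _ →ₗ[ℂ] LittleHolder (cylinder n R d) α) ∘ₗ field R d a ∘ₗ resolvent R d) hC
    (fun v hv => ((hS v hv).2.1 a).2) hv hf
  choose F'' hF'' using fun a b => tendsto_of_norm_le_restr hR hα1
    (ev ∘ₗ field R d b ∘ₗ field R d a ∘ₗ resolvent R d) hC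
    (fun v hv => ((hS v hv).2.2 a b).1) hv hf
  choose u'' hu'' using fun a b => tendsto_of_norm_le_restr hR hα1
    ((restr hR hα1 : _ →ₗ[ℂ] LittleHolder (cylinder n R d) α) ∘ₗ
      field R d b ∘ₗ field R d a ∘ₗ resolvent R d) hC
    (fun v hv => ((hS v hv).2.2 a b).2) hv hf
  have hlim : ∀ {w : ℕ → Modes n} {G : C(Model n, ℂ)} {g : LittleHolder (cylinder n R d) α},
      Filter.Tendsto (fun k => ev (w k)) Filter.atTop (nhds G) →
      Filter.Tendsto (fun k => restr hR hα1 (w k)) Filter.atTop (nhds g) →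
      LittleHolder.toFun g = fun p : cylinder n R d => ambientExt d G p := by
    intro w G g h1 h2
    funext p
    rw [ambientExt_coe hR]
    exact tendsto_nhds_unique (LittleHolder.tendsto_apply h2 p)
      (((continuous_eval_const (toModel hR p)).tendsto G).comp h1)
  have eu := hlim hF hu
  have eu' := fun a => hlim (hF' a) (hu' a)
  have eu'' := fun a b => hlim (hF'' a b) (hu'' a b)
  have hsec := HasSecondDerivs.of_tendsto (d := d) hR (fun k => hasSecondDerivs_ev hR (resolvent R d (v k)))
    hF hF' hF''
  refine ⟨u, ⟨?_, ?_⟩, fun p => ?_, v, hv, hf, hu⟩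
  · rw [eu]
    refine hsec.isLittleHolderTwo hR hd hα1 (fun a => ?_) fun a b => ?_
    · rw [← eu']
      exact (u' a).isLittleHolder
    · rw [← eu'']
      exact (u'' a b).isLittleHolder
  · intro p hp
    rw [eu, hsec.axialDeriv_eq hR hd, ambientExt_coe hR]
    have h1 := ((continuous_eval_const (toModel hR p)).tendsto (F' none)).comp (hF' none)
    refine tendsto_nhds_unique h1 (tendsto_const_nhds.congr fun k => ?_)
    refine (ev_field_none_eq_zero ?_ (toModel_inv_eq hR hd hp)).symm
    rw [reflect_resolvent, hv]
  -- On modes ∑X_a² applied to (1-Δ)^{-1}v is (1-Δ)^{-1}v - v; both sides converge pointwise.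
  · rw [eu, hsec.laplaceBeltrami_eq hR hd, ← eu]
    simp only [← fun a b => congrFun (eu'' a b) p]
    refine tendsto_nhds_unique (tendsto_finsetSum Finset.univ fun a _ =>
      LittleHolder.tendsto_apply (hu'' a a) p) ?_
    refine ((LittleHolder.tendsto_apply hu p).sub (LittleHolder.tendsto_apply hf p)).congr fun k => ?_
    have h1 := sum_field_field (d := d) hR (resolvent R d (v k))
    rw [modeLaplacian_resolvent hn] at h1
    have h2 := congrArg (fun w => ev w (toModel hR p)) h1
    simp only [map_sum, map_sub, ContinuousMap.sub_apply, ContinuousMap.sum_apply] at h2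
    exact h2.symm

end Schauder

/-! ### Uniqueness for `u - Δ u = f` -/

section Uniqueness

variable {n : ℕ} {R d : ℝ} {α : ℝ≥0}

theorem derivWithin_nonpos_of_le_right {f : ℝ → ℝ} {c δ : ℝ} (hδ : 0 < δ)
    (hf : HasDerivWithinAt f c (Icc 0 δ) 0) (hmax : ∀ s ∈ Icc 0 δ, f s ≤ f 0) : c ≤ 0 := by
  have h1 : HasDerivWithinAt f c (Ioi 0) 0 :=
    (hf.mono_of_mem_nhdsWithin (Icc_mem_nhdsGE hδ)).Ioi_of_Ici
  have h2 := (hasDerivWithinAt_iff_tendsto_slope' self_notMem_Ioi).1 h1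
  refine le_of_tendsto h2 ?_
  filter_upwards [Ioc_mem_nhdsGT hδ] with s hs
  rw [slope_def_field, sub_zero]
  exact div_nonpos_of_nonpos_of_nonneg (sub_nonpos.2 (hmax s ⟨hs.1.le, hs.2⟩)) hs.1.le

section Directional

variable {E : Type*} [NormedAddCommGroup E] [NormedSpace ℝ E] {U : E → ℂ} {s : Set E} {p w : E}
  {δ : ℝ}

theorem hasDerivWithinAt_re_line (hU : DifferentiableOn ℝ U s)
    (hline : ∀ t ∈ Icc 0 δ, p + t • w ∈ s) {t : ℝ} (ht : t ∈ Icc 0 δ) :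
    HasDerivWithinAt (fun t : ℝ => (U (p + t • w)).re)
      (fderivWithin ℝ U s (p + t • w) w).re (Icc 0 δ) t := by
  have h1 : HasDerivWithinAt (fun t : ℝ => p + t • w) w (Icc 0 δ) t := by
    simpa using (((hasDerivAt_id t).smul_const w).const_add p).hasDerivWithinAt
  have h2 := ((hU _ (hline t ht)).hasFDerivWithinAt).comp_hasDerivWithinAt t h1 hline
  exact Complex.reCLM.hasFDerivAt.comp_hasDerivWithinAt t h2

theorem fderivWithin_re_nonpos (hU : DifferentiableOn ℝ U s) (hδ : 0 < δ)
    (hline : ∀ t ∈ Icc 0 δ, p + t • w ∈ s) (hmax : ∀ x ∈ s, (U x).re ≤ (U p).re) :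
    (fderivWithin ℝ U s p w).re ≤ 0 := by
  have h0 : (0 : ℝ) ∈ Icc 0 δ := ⟨le_rfl, hδ.le⟩
  have h := hasDerivWithinAt_re_line hU hline h0
  rw [zero_smul, add_zero] at h
  refine derivWithin_nonpos_of_le_right hδ h fun t ht => ?_
  rw [zero_smul, add_zero]
  exact hmax _ (hline t ht)

/-- Once the first derivative is known to vanish, a segment on one side is enough for the second
derivative test. This is what makes it usable on the boundary of the slab. -/
theorem fderivWithin_fderivWithin_re_nonpos (hs : UniqueDiffOn ℝ s) (hU : ContDiffOn ℝ 2 U s)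
    (hδ : 0 < δ) (hline : ∀ t ∈ Icc 0 δ, p + t • w ∈ s) (hmax : ∀ x ∈ s, (U x).re ≤ (U p).re)
    (h1 : (fderivWithin ℝ U s p w).re = 0) :
    (fderivWithin ℝ (fderivWithin ℝ U s) s p w w).re ≤ 0 := by
  have h0 : (0 : ℝ) ∈ Icc 0 δ := ⟨le_rfl, hδ.le⟩
  have hU1 : DifferentiableOn ℝ U s := hU.differentiableOn (by norm_num)
  have hU2 : DifferentiableOn ℝ (fderivWithin ℝ U s) s :=
    (hU.fderivWithin hs (m := 1) (by norm_num)).differentiableOn (by norm_num)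
  refine second_deriv_nonpos_of_le_right hδ (fun t ht => hasDerivWithinAt_re_line hU1 hline ht)
    (by simpa using h1) ?_ fun t ht => ?_
  · have h2 : HasDerivWithinAt (fun t : ℝ => p + t • w) w (Icc 0 δ) 0 := by
      simpa using (((hasDerivAt_id (0 : ℝ)).smul_const w).const_add p).hasDerivWithinAt
    have h3 := (hU2 _ (hline 0 h0)).hasFDerivWithinAt.comp_hasDerivWithinAt 0 h2 hline
    rw [zero_smul, add_zero] at h3
    have h4 := h3.clm_apply (hasDerivWithinAt_const (0 : ℝ) (Icc 0 δ) w)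
    have h5 := Complex.reCLM.hasFDerivAt.comp_hasDerivWithinAt 0 h4
    exact h5.congr_deriv (by simp)
  · rw [zero_smul, add_zero]
    exact hmax _ (hline t ht)

end Directional

theorem radialProj_mem (hR : 0 < R) {x : Ambient n} (hx : x ∈ slab n d) :
    radialProj n R x ∈ cylinder n R d := by
  have hx0 : ‖x.fst‖ ≠ 0 := norm_ne_zero_iff.2 hx.1
  exact ⟨by simp [radialProj, norm_smul, abs_of_pos hR, hx0], hx.2⟩

/-- Since the normal extension is constant along rays, a maximum on the cylinder is a maximum over
the whole slab, and all diagonal entries of the Hessian are nonpositive there. In the axial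
direction at an end, the Neumann condition supplies the vanishing first derivative. -/
theorem re_laplaceBeltrami_nonpos (hR : 0 < R) (hd : 0 < d) {u : cylinder n R d → ℂ}
    (hu : IsLittleHolderTwo α u) (hN : IsNeumann u) {p : cylinder n R d}
    (hmax : ∀ q, (u q).re ≤ (u p).re) : (laplaceBeltrami u p).re ≤ 0 := by
  set U := normalExt u
  have hs := uniqueDiffOn_slab n hd
  have hp := mem_slab hR p
  have hpR : ‖(p : Ambient n).fst‖ = R := p.2.1
  have hmaxU : ∀ x ∈ slab n d, (U x).re ≤ (U p).re := by
    intro x hx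
    simp only [U]
    rw [normalExt_coe hR, normalExt, dif_pos (radialProj_mem hR hx)]
    exact hmax _
  have hU1 : DifferentiableOn ℝ U (slab n d) := hu.1.differentiableOn (by norm_num)
  have both : ∀ (w : Ambient n) (δ : ℝ), 0 < δ → (∀ t, |t| ≤ δ → (p : Ambient n) + t • w ∈ slab n d) →
      (fderivWithin ℝ (fderivWithin ℝ U (slab n d)) (slab n d) p w w).re ≤ 0 := by
    intro w δ hδ hline
    have l1 : ∀ t ∈ Icc 0 δ, (p : Ambient n) + t • w ∈ slab n d := fun t ht =>
      hline t (by rw [abs_of_nonneg ht.1]; exact ht.2)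
    have l2 : ∀ t ∈ Icc 0 δ, (p : Ambient n) + t • (-w) ∈ slab n d := fun t ht => by
      rw [smul_neg, ← neg_smul]
      exact hline (-t) (by rw [abs_neg, abs_of_nonneg ht.1]; exact ht.2)
    have d1 := fderivWithin_re_nonpos hU1 hδ l1 hmaxU
    have d2 := fderivWithin_re_nonpos hU1 hδ l2 hmaxU
    rw [map_neg, Complex.neg_re] at d2
    exact fderivWithin_fderivWithin_re_nonpos hs hu.1 hδ l1 hmaxU (by linarith)
  set b := (EuclideanSpace.basisFun (Fin n) ℝ).prod (OrthonormalBasis.singleton Unit ℝ)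
  rw [laplaceBeltrami, InnerProductSpace.laplacianWithin_eq_iteratedFDerivWithin_orthonormalBasis _
    hs hp b]
  simp only [iteratedFDerivWithin_two_apply _ hs hp, Matrix.cons_val_zero, Matrix.cons_val_one]
  rw [Complex.re_sum, Fintype.sum_sum_type]
  refine add_nonpos (Finset.sum_nonpos fun i _ => ?_) (Finset.sum_nonpos fun i _ => ?_)
  · refine both _ (R / 2) (half_pos hR) fun t ht => ?_
    have e : b (Sum.inl i) = WithLp.toLp 2 (EuclideanSpace.single i 1, 0) := by
      simp [b]
    rw [e]
    refine ⟨fun h => ?_, ?_⟩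
    · change (p : Ambient n).fst + t • EuclideanSpace.single i (1 : ℝ) = 0 at h
      have h1 : ‖(p : Ambient n).fst‖ = |t| := by
        rw [eq_neg_of_add_eq_zero_left h, norm_neg, norm_smul]
        simp
      linarith
    · change (p : Ambient n).snd + t • (0 : ℝ) ∈ Icc 0 d
      rw [smul_zero, add_zero]
      exact p.2.2
  · have e : b (Sum.inr i) = WithLp.toLp 2 (0, 1) := by
      simp [b]
    rw [e]
    have hline : ∀ t : ℝ, (p : Ambient n).snd + t ∈ Icc 0 d →
        (p : Ambient n) + t • (WithLp.toLp 2 (0, 1) : Ambient n) ∈ slab n d := by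
      intro t ht
      refine ⟨?_, ?_⟩
      · change (p : Ambient n).fst + t • (0 : EuclideanSpace ℝ (Fin n)) ≠ 0
        rw [smul_zero, add_zero]
        exact hp.1
      · change (p : Ambient n).snd + t • (1 : ℝ) ∈ Icc 0 d
        rwa [smul_eq_mul, mul_one]
    obtain ⟨hz0, hzd⟩ := p.2.2
    have hzero : (p : Ambient n).snd = 0 ∨ (p : Ambient n).snd = d →
        fderivWithin ℝ U (slab n d) p (WithLp.toLp 2 (0, 1)) = 0 := hN p
    rcases hz0.eq_or_lt with h0 | h0
    · refine fderivWithin_fderivWithin_re_nonpos hs hu.1 hd (fun t ht => hline t ?_) hmaxU ?_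
      · rwa [← h0, zero_add]
      · rw [hzero (Or.inl h0.symm), Complex.zero_re]
    · rcases hzd.eq_or_lt with h1 | h1
      · have h2 := fderivWithin_fderivWithin_re_nonpos hs hu.1 hd
          (w := -(WithLp.toLp 2 (0, 1) : Ambient n)) (fun t ht => ?_) hmaxU ?_
        · simpa using h2
        · rw [smul_neg, ← neg_smul]
          refine hline (-t) ?_
          rw [h1]
          exact ⟨by linarith [ht.2], by linarith [ht.1]⟩
        · rw [map_neg, hzero (Or.inr h1), neg_zero, Complex.zero_re]
      · refine both _ (min (p : Ambient n).snd (d - (p : Ambient n).snd))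
          (lt_min h0 (sub_pos.2 h1)) fun t ht => hline t ?_
        obtain ⟨h2, h3⟩ := le_min_iff.1 ht
        have h4 := abs_le.1 h2
        have h5 := abs_le.1 h3
        exact ⟨by linarith, by linarith⟩

/-- The Laplace-Beltrami operator on `h^{2+α}_{∂/∂z}`. -/
def laplaceMap (hR : 0 < R) (hd : 0 < d) (α : ℝ≥0) :
    neumannDomain (n := n) hR hd α →ₗ[ℂ] LittleHolder (cylinder n R d) α where
  toFun u := LittleHolder.mk
    (laplaceBeltrami (LittleHolder.toFun (u : LittleHolder (cylinder n R d) α)))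
    (IsLittleHolderTwo.laplace hR hd u.2.1)
  map_add' u v := by
    apply LittleHolder.toFun_injective
    funext p
    have h := (u.2.1.contDiffWithinAt hR p).laplacianWithin_add
      (v.2.1.contDiffWithinAt hR p) (uniqueDiffOn_slab n hd) (mem_slab hR p)
    change laplaceBeltrami (LittleHolder.toFun (u : LittleHolder (cylinder n R d) α)
        + LittleHolder.toFun (v : LittleHolder (cylinder n R d) α)) p
      = laplaceBeltrami (LittleHolder.toFun (u : LittleHolder (cylinder n R d) α)) p
        + laplaceBeltrami (LittleHolder.toFun (v : LittleHolder (cylinder n R d) α)) p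
    simp only [laplaceBeltrami, normalExt_add, h]
  map_smul' c u := by
    apply LittleHolder.toFun_injective
    funext p
    have h := InnerProductSpace.laplacianWithin_smul c (u.2.1.contDiffWithinAt hR p)
      (uniqueDiffOn_slab n hd) (mem_slab hR p)
    change laplaceBeltrami (c • LittleHolder.toFun (u : LittleHolder (cylinder n R d) α)) p
      = c * laplaceBeltrami (LittleHolder.toFun (u : LittleHolder (cylinder n R d) α)) p
    simp only [laplaceBeltrami, normalExt_smul, h, smul_eq_mul]

theorem laplaceMap_apply (hR : 0 < R) (hd : 0 < d) (u : neumannDomain (n := n) hR hd α)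
    (p : cylinder n R d) : LittleHolder.toFun (laplaceMap hR hd α u) p
      = laplaceBeltrami (LittleHolder.toFun (u : LittleHolder (cylinder n R d) α)) p := rfl

theorem re_nonpos_of_laplaceMap_eq (hR : 0 < R) (hd : 0 < d) {u : neumannDomain (n := n) hR hd α}
    (h : laplaceMap hR hd α u = u) (p : cylinder n R d) :
    (LittleHolder.toFun (u : LittleHolder (cylinder n R d) α) p).re ≤ 0 := by
  have hc : Continuous fun p => (LittleHolder.toFun (u : LittleHolder (cylinder n R d) α) p).re :=
    Complex.continuous_re.comp (u : LittleHolder (cylinder n R d) α).isLittleHolder.continuous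
  obtain ⟨q, -, hq⟩ := isCompact_univ.exists_isMaxOn ⟨p, mem_univ p⟩ hc.continuousOn
  have hq' := fun p => hq (mem_univ p)
  have h1 := re_laplaceBeltrami_nonpos hR hd u.2.1 u.2.2 hq'
  rw [← laplaceMap_apply, h] at h1
  exact (hq' p).trans h1

/-- The maximum principle for real parts, applied to u, -u, iu and -iu. -/
theorem eq_zero_of_laplaceMap_eq (hR : 0 < R) (hd : 0 < d) {u : neumannDomain (n := n) hR hd α}
    (h : laplaceMap hR hd α u = u) : u = 0 := by
  have key : ∀ c : ℂ, ∀ p,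
      (c * LittleHolder.toFun (u : LittleHolder (cylinder n R d) α) p).re ≤ 0 := by
    intro c p
    have h1 : laplaceMap hR hd α (c • u) = (c • u : neumannDomain (n := n) hR hd α) := by
      rw [map_smul, h]
      rfl
    have h2 := re_nonpos_of_laplaceMap_eq hR hd h1 p
    rwa [Submodule.coe_smul, map_smul, Pi.smul_apply, smul_eq_mul] at h2
  apply Subtype.ext
  apply LittleHolder.toFun_injective
  funext p
  rw [Submodule.coe_zero, map_zero, Pi.zero_apply]
  have h1 := key 1 p
  have h2 := key (-1) p
  have h3 := key Complex.I p
  have h4 := key (-Complex.I) p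
  simp at h1 h2 h3 h4
  exact Complex.ext (le_antisymm h1 h2) (le_antisymm h4 h3)

/-- Approximation of the elements of the domain by sums of modes. -/
theorem exists_modes_tendsto (hn : 1 ≤ n) (hα0 : 0 < α) (hα1 : α < 1) (hR : 0 < R) (hd : 0 < d)
    (u : neumannDomain (n := n) hR hd α) :
    ∃ v : ℕ → Modes n, (∀ k, reflect (v k) = v k) ∧
      Filter.Tendsto (fun k => restr hR hα1 (v k)) Filter.atTop
        (nhds ((u : LittleHolder (cylinder n R d) α) - laplaceMap hR hd α u)) ∧
      Filter.Tendsto (fun k => restr hR hα1 (resolvent R d (v k))) Filter.atTop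
        (nhds (u : LittleHolder (cylinder n R d) α)) := by
  obtain ⟨w, hw, hwl, v, hv, h1, h2⟩ := exists_solution hn hR hd hα0 hα1
    (u - laplaceMap hR hd α u : LittleHolder (cylinder n R d) α)
  have h3 : laplaceMap hR hd α (u - ⟨w, hw⟩) = (u - ⟨w, hw⟩ : neumannDomain (n := n) hR hd α) := by
    apply LittleHolder.toFun_injective
    funext p
    have h4 := hwl p
    rw [map_sub, map_sub, Pi.sub_apply, laplaceMap_apply _ _ ⟨w, hw⟩, h4, map_sub,
      Submodule.coe_sub, map_sub, Pi.sub_apply, Pi.sub_apply]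
    ring
  have h5 : u = ⟨w, hw⟩ := sub_eq_zero.1 (eq_zero_of_laplaceMap_eq hR hd h3)
  refine ⟨v, hv, h1, ?_⟩
  rw [h5]
  exact h2

/-- Every element of `h^α` is of the form `u - Δ u`. -/
theorem exists_sub_laplaceMap_eq (hn : 1 ≤ n) (hα0 : 0 < α) (hα1 : α < 1) (hR : 0 < R) (hd : 0 < d)
    (f : LittleHolder (cylinder n R d) α) :
    ∃ u : neumannDomain (n := n) hR hd α, u - laplaceMap hR hd α u = f := by
  obtain ⟨u, hu, hul, -⟩ := exists_solution hn hR hd hα0 hα1 f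
  refine ⟨⟨u, hu⟩, ?_⟩
  apply LittleHolder.toFun_injective
  funext p
  rw [map_sub, Pi.sub_apply, laplaceMap_apply, hul]
  simp

/-- The bounds of `u` by the supremum of `u - Δ u`. -/
theorem bounds_of_sub_laplaceMap_le (hn : 1 ≤ n) (hα0 : 0 < α) (hα1 : α < 1) (hR : 0 < R)
    (hd : 0 < d) (u : neumannDomain (n := n) hR hd α) {N : ℝ} (hN : 0 ≤ N)
    (h : ∀ p, ‖LittleHolder.toFun (u - laplaceMap hR hd α u : LittleHolder (cylinder n R d) α) p‖
      ≤ N) :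
    (∀ p, ‖LittleHolder.toFun (u : LittleHolder (cylinder n R d) α) p‖ ≤ 2 * N) ∧
    ∀ p q, dist p q ≤ R → ‖LittleHolder.toFun (u : LittleHolder (cylinder n R d) α) p
        - LittleHolder.toFun (u : LittleHolder (cylinder n R d) α) q‖
      ≤ Fintype.card (Option (Fin n × Fin n)) * 15 * N * dist p q := by
  obtain ⟨v, hv, h1, h2⟩ := exists_modes_tendsto hn hα0 hα1 hR hd u
  set f : LittleHolder (cylinder n R d) α := u - laplaceMap hR hd α u
  set η : ℕ → ℝ := fun k => N + ‖restr hR hα1 (v k) - f‖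
  have hη : Filter.Tendsto η Filter.atTop (nhds N) := by
    have := (tendsto_iff_norm_sub_tendsto_zero.1 h1).const_add N
    rwa [add_zero] at this
  have hη0 : ∀ k, 0 ≤ η k := fun k => by positivity
  have hb : ∀ k x, ‖ev (v k) x‖ ≤ η k := fun k => norm_ev_le_of_even hR hd (hv k) fun p => by
    have h3 := (restr hR hα1 (v k) - f).norm_apply_le p
    rw [map_sub, Pi.sub_apply, restr_apply] at h3
    have h4 := norm_le_norm_add_norm_sub (LittleHolder.toFun f p) (ev (v k) (toModel hR p))
    rw [norm_sub_rev] at h4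
    have h5 := norm_sub_rev (LittleHolder.toFun f p) (ev (v k) (toModel hR p))
    have h6 := h p
    simp only [η]
    linarith
  refine ⟨fun p => ?_, fun p q hpq => ?_⟩
  · refine le_of_tendsto_of_tendsto' (LittleHolder.tendsto_apply h2 p).norm (hη.const_mul 2)
      fun k => ?_
    exact norm_resolvent_le hn hR hd (hb k) _
  · refine le_of_tendsto_of_tendsto' ((LittleHolder.tendsto_apply h2 p).sub
      (LittleHolder.tendsto_apply h2 q)).norm
      ((hη.const_mul (Fintype.card (Option (Fin n × Fin n)) * 15 : ℝ)).mul_const (dist p q))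
      fun k => ?_
    refine (norm_sub_le_of_fields hR (N := 3 * η k) (mul_nonneg (by norm_num) (hη0 k))
      (fun a x => norm_field_resolvent_le hn hR hd (hb k) a x) p q hpq).trans_eq ?_
    ring

end Uniqueness

/-! ### The resolvent set of the linearisation -/

section ResolventSet

variable {n : ℕ} {R d : ℝ} {α : ℝ≥0}

/-- A constant, as an element of `h^α`. -/
def constHolder (R d : ℝ) (α : ℝ≥0) : ℂ →ₗ[ℂ] LittleHolder (cylinder n R d) α where
  toFun z := LittleHolder.mk _ (IsLittleHolder.const α z)
  map_add' _ _ := rfl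
  map_smul' _ _ := rfl

theorem constHolder_apply (z : ℂ) (p : cylinder n R d) :
    LittleHolder.toFun (constHolder R d α z) p = z := rfl

theorem norm_constHolder_le (z : ℂ) :
    ‖(constHolder R d α z : LittleHolder (cylinder n R d) α)‖ ≤ ‖z‖ := by
  have h := LittleHolder.norm_le (f := (constHolder R d α z : LittleHolder (cylinder n R d) α))
    (S := ‖z‖) (H := 0) (norm_nonneg z) le_rfl (fun p => by rw [constHolder_apply])
    fun p q => by rw [constHolder_apply, constHolder_apply, sub_self, norm_zero, zero_mul]
  rwa [add_zero] at h

/-- The mean, as a linear form. -/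
def meanMap (hR : 0 < R) (d : ℝ) (α : ℝ≥0) : LittleHolder (cylinder n R d) α →ₗ[ℂ] ℂ where
  toFun u := mean hR (LittleHolder.toFun u)
  map_add' u v := mean_add hR u.isLittleHolder v.isLittleHolder
  map_smul' c _ := mean_smul hR c _

theorem meanMap_apply (hR : 0 < R) (u : LittleHolder (cylinder n R d) α) :
    meanMap hR d α u = mean hR (LittleHolder.toFun u) := rfl

theorem norm_meanMap_le (hR : 0 < R) (u : LittleHolder (cylinder n R d) α) :
    ‖meanMap hR d α u‖ ≤ ‖u‖ := by
  rw [meanMap_apply, mean, average_eq, norm_smul]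
  set ν := (volume : Measure (EuclideanSpace ℝ (Fin n))).toSphere.prod (segmentMeasure d)
  have h := norm_integral_le_of_norm_le_const (μ := ν) (C := ‖u‖)
    (f := fun p => LittleHolder.toFun u (cylinderPoint hR p))
    (Filter.Eventually.of_forall fun p => u.norm_apply_le _)
  rw [norm_inv, Real.norm_of_nonneg measureReal_nonneg]
  calc (ν.real univ)⁻¹ * ‖∫ p, LittleHolder.toFun u (cylinderPoint hR p) ∂ν‖
      ≤ (ν.real univ)⁻¹ * (‖u‖ * ν.real univ) := by gcongr
    _ = ‖u‖ * ((ν.real univ)⁻¹ * ν.real univ) := by ring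
    _ ≤ ‖u‖ * 1 := by
      gcongr
      exact inv_mul_le_one
    _ = ‖u‖ := mul_one _

/-- The constant `(n - 1) / R²`. -/
def curvConst (n : ℕ) (R : ℝ) : ℂ := ((n : ℂ) - 1) / (R : ℂ) ^ 2

theorem shifted_linearisation (hR : 0 < R) (hd : 0 < d) (μ : ℂ)
    (u : neumannDomain (n := n) hR hd α) :
    shifted (linearisation n hR hd α) μ u = μ • (u : LittleHolder (cylinder n R d) α)
      - (curvConst n R • (u : LittleHolder (cylinder n R d) α) + laplaceMap hR hd α u
        - constHolder R d α (curvConst n R * meanMap hR d α (u : LittleHolder (cylinder n R d) α))) := by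
  apply LittleHolder.toFun_injective
  funext p
  rfl

/-- Reduces every μ to the solved equation u - Δu = f: the remaining terms in u are of order zero.
-/
theorem sub_laplaceMap_eq (hR : 0 < R) (hd : 0 < d) (μ : ℂ)
    (u : neumannDomain (n := n) hR hd α) :
    (u : LittleHolder (cylinder n R d) α) - laplaceMap hR hd α u
      = (1 + curvConst n R - μ) • (u : LittleHolder (cylinder n R d) α)
        - constHolder R d α (curvConst n R * meanMap hR d α (u : LittleHolder (cylinder n R d) α))
        + shifted (linearisation n hR hd α) μ u := by
  rw [shifted_linearisation]
  module

/-- The linearisation is a closed operator. -/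
theorem exists_shifted_eq_of_tendsto (hn : 1 ≤ n) (hα0 : 0 < α) (hα1 : α < 1) (hR : 0 < R)
    (hd : 0 < d) {μ : ℂ} {u : ℕ → neumannDomain (n := n) hR hd α}
    {w g : LittleHolder (cylinder n R d) α}
    (hu : Filter.Tendsto (fun k => (u k : LittleHolder (cylinder n R d) α)) Filter.atTop (nhds w))
    (hg : Filter.Tendsto (fun k => shifted (linearisation n hR hd α) μ (u k)) Filter.atTop
      (nhds g)) :
    ∃ v : neumannDomain (n := n) hR hd α, (v : LittleHolder (cylinder n R d) α) = w ∧
      shifted (linearisation n hR hd α) μ v = g := by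
  -- The limit that u_k - Δu_k must have, since the mean and the constants are continuous. The
  -- solution v of v - Δv = f is the limit of u_k by the sup estimate, so v = w, and w lies in the
  -- domain.
  set f := (1 + curvConst n R - μ) • w - constHolder R d α (curvConst n R * meanMap hR d α w) + g
  obtain ⟨v, hv⟩ := exists_sub_laplaceMap_eq hn hα0 hα1 hR hd f
  have hmean : Filter.Tendsto (fun k => meanMap hR d α (u k : LittleHolder (cylinder n R d) α)) Filter.atTop
      (nhds (meanMap hR d α w)) :=
    ((meanMap hR d α).mkContinuous 1 fun u => by
      rw [one_mul]; exact norm_meanMap_le hR u).continuous.continuousAt.tendsto.comp hu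
  have hconst : Filter.Tendsto (fun k => constHolder R d α (curvConst n R * meanMap hR d α (u k : LittleHolder (cylinder n R d) α)))
      Filter.atTop (nhds (constHolder R d α (curvConst n R * meanMap hR d α w))) :=
    ((constHolder (n := n) R d α).mkContinuous 1 fun z => by
      rw [one_mul]; exact norm_constHolder_le z).continuous.continuousAt.tendsto.comp
        (hmean.const_mul _)
  have hf : Filter.Tendsto (fun k => (u k : LittleHolder (cylinder n R d) α)
      - laplaceMap hR hd α (u k)) Filter.atTop (nhds f) := by
    simp only [sub_laplaceMap_eq hR hd μ]
    exact ((hu.const_smul _).sub hconst).add hg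
  have hvw : (v : LittleHolder (cylinder n R d) α) = w := by
    apply LittleHolder.toFun_injective
    funext p
    refine tendsto_nhds_unique ?_ (LittleHolder.tendsto_apply hu p)
    rw [tendsto_iff_norm_sub_tendsto_zero] at hf ⊢
    refine squeeze_zero (fun _ => norm_nonneg _) (fun k => ?_)
      (by simpa using hf.const_mul 2)
    have h := (bounds_of_sub_laplaceMap_le hn hα0 hα1 hR hd (u k - v) (norm_nonneg _)
      (LittleHolder.norm_apply_le _)).1 p
    have e : ((u k - v : neumannDomain (n := n) hR hd α) : LittleHolder (cylinder n R d) α)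
        - laplaceMap hR hd α (u k - v)
        = (u k : LittleHolder (cylinder n R d) α) - laplaceMap hR hd α (u k) - f := by
      rw [← hv, map_sub, Submodule.coe_sub]
      abel
    rw [e, Submodule.coe_sub, map_sub, Pi.sub_apply] at h
    exact h
  refine ⟨v, hvw, ?_⟩
  have h := sub_laplaceMap_eq hR hd μ v
  rw [hv, hvw] at h
  exact (add_left_cancel h).symm

/-! ### Compactness and the Fredholm alternative -/

/-- Interpolation between sup and Lipschitz norm: distances below s use the Lipschitz bound, larger
ones the sup bound 2s, and distances beyond R the crude constant. With B fixed the result tends to 0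
with s, so uniform convergence of a Lipschitz family is convergence in h^α. -/
theorem norm_le_of_sup_of_lipschitz (hR : 0 < R) (hα : α < 1)
    {f : LittleHolder (cylinder n R d) α} {s B : ℝ} (hs : 0 < s) (hB : 0 ≤ B)
    (h1 : ∀ p, ‖LittleHolder.toFun f p‖ ≤ s) (h2 : ∀ p q, dist p q ≤ R →
      ‖LittleHolder.toFun f p - LittleHolder.toFun f q‖ ≤ B * dist p q) :
    ‖f‖ ≤ s + ((B + 2) * s ^ (1 - (α : ℝ)) + 2 * s / R ^ (α : ℝ)) := by
  have hα' : 0 < 1 - (α : ℝ) := sub_pos.2 (by exact_mod_cast hα)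
  refine LittleHolder.norm_le hs.le (by positivity) h1 fun p q => ?_
  have h3 : ‖LittleHolder.toFun f p - LittleHolder.toFun f q‖ ≤ 2 * s :=
    (norm_sub_le _ _).trans (by linarith [h1 p, h1 q])
  set δ := dist p q
  have hδ : 0 ≤ δ := dist_nonneg
  have a1 : 0 ≤ B * s ^ (1 - (α : ℝ)) * δ ^ (α : ℝ) := by positivity
  have a2 : 0 ≤ 2 * s ^ (1 - (α : ℝ)) * δ ^ (α : ℝ) := by positivity
  have a3 : 0 ≤ 2 * s / R ^ (α : ℝ) * δ ^ (α : ℝ) := by positivity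
  have a4 : ((B + 2) * s ^ (1 - (α : ℝ)) + 2 * s / R ^ (α : ℝ)) * δ ^ (α : ℝ)
      = B * s ^ (1 - (α : ℝ)) * δ ^ (α : ℝ) + 2 * s ^ (1 - (α : ℝ)) * δ ^ (α : ℝ)
        + 2 * s / R ^ (α : ℝ) * δ ^ (α : ℝ) := by ring
  rw [a4]
  have split : ∀ t : ℝ, 0 < t → t = t ^ (1 - (α : ℝ)) * t ^ (α : ℝ) := fun t ht => by
    rw [← Real.rpow_add ht]
    simp
  rcases le_or_gt δ R with h | h
  · rcases le_or_gt δ s with h4 | h4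
    · refine (h2 p q h).trans ?_
      have h5 : δ ≤ s ^ (1 - (α : ℝ)) * δ ^ (α : ℝ) := by
        rcases hδ.eq_or_lt with h0 | h0
        · rw [← h0]
          positivity
        · calc δ = δ ^ (1 - (α : ℝ)) * δ ^ (α : ℝ) := split δ h0
            _ ≤ _ := by gcongr
      have h6 := mul_le_mul_of_nonneg_left h5 hB
      linarith
    · have h5 : s ≤ s ^ (1 - (α : ℝ)) * δ ^ (α : ℝ) := by
        calc s = s ^ (1 - (α : ℝ)) * s ^ (α : ℝ) := split s hs
          _ ≤ _ := by gcongr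
      linarith
  · have h4 : R ^ (α : ℝ) ≤ δ ^ (α : ℝ) := by gcongr
    have h5 : 2 * s ≤ 2 * s / R ^ (α : ℝ) * δ ^ (α : ℝ) := by
      rw [div_mul_eq_mul_div, le_div_iff₀ (by positivity)]
      gcongr
    linarith

/-- A sequence in `h^α` that is bounded and uniformly Lipschitz has a convergent subsequence. -/
theorem exists_tendsto_subseq (hR : 0 < R) (hα : α < 1)
    {u : ℕ → LittleHolder (cylinder n R d) α} {B : ℝ} (hB : 0 ≤ B) (h1 : ∀ k, ‖u k‖ ≤ 1)
    (h2 : ∀ k p q, dist p q ≤ R →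
      ‖LittleHolder.toFun (u k) p - LittleHolder.toFun (u k) q‖ ≤ B * dist p q) :
    ∃ (w : LittleHolder (cylinder n R d) α) (φ : ℕ → ℕ), StrictMono φ ∧
      Filter.Tendsto (fun k => u (φ k)) Filter.atTop (nhds w) := by
  have hα' : 0 < 1 - (α : ℝ) := sub_pos.2 (by exact_mod_cast hα)
  set U : ℕ → BoundedContinuousFunction (cylinder n R d) ℂ := fun k =>
    BoundedContinuousFunction.mkOfCompact ⟨LittleHolder.toFun (u k), (u k).isLittleHolder.continuous⟩
  have hU : ∀ k p, U k p = LittleHolder.toFun (u k) p := fun _ _ => rfl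
  have hcomp : IsCompact (closure (range U)) := by
    refine BoundedContinuousFunction.arzela_ascoli (Metric.closedBall (0 : ℂ) 1)
      (isCompact_closedBall 0 1) (range U) ?_ ?_
    · rintro _ p ⟨k, rfl⟩
      rw [mem_closedBall_zero_iff, hU]
      exact ((u k).norm_apply_le p).trans (h1 k)
    · refine Metric.equicontinuous_of_continuity_modulus (fun δ => if δ ≤ R then B * δ else 2) ?_ _ ?_
      · have h3 : Filter.Tendsto (fun δ : ℝ => B * δ) (nhds 0) (nhds 0) := by
          simpa using (continuous_const_mul B).tendsto (0 : ℝ)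
        refine h3.congr' ?_
        filter_upwards [gt_mem_nhds hR] with δ hδ
        rw [if_pos hδ.le]
      · rintro p q ⟨_, k, rfl⟩
        rw [dist_eq_norm]
        change ‖LittleHolder.toFun (u k) p - LittleHolder.toFun (u k) q‖ ≤ _
        split_ifs with h
        · exact h2 k p q h
        · refine (norm_sub_le _ _).trans ?_
          linarith [(u k).norm_apply_le p, (u k).norm_apply_le q, h1 k]
  obtain ⟨V, -, φ, hφ, hV⟩ := hcomp.tendsto_subseq fun k => subset_closure (mem_range_self (f := U) k)
  have hcs : CauchySeq fun k => u (φ k) := by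
    rw [Metric.cauchySeq_iff]
    intro ε hε
    have h3 : Filter.Tendsto (fun s : ℝ => s + ((2 * B + 2) * s ^ (1 - (α : ℝ))
        + 2 * s / R ^ (α : ℝ))) (nhdsWithin 0 (Ioi 0)) (nhds 0) := by
      have hc : Continuous fun s : ℝ => s + ((2 * B + 2) * s ^ (1 - (α : ℝ))
          + 2 * s / R ^ (α : ℝ)) :=
        continuous_id.add ((continuous_const.mul (Real.continuous_rpow_const hα'.le)).add
          ((continuous_const.mul continuous_id).div_const _))
      have := hc.tendsto 0
      simp only [Real.zero_rpow hα'.ne', mul_zero, zero_div, add_zero] at this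
      exact this.mono_left nhdsWithin_le_nhds
    obtain ⟨s, h4, h5⟩ := ((h3.eventually (gt_mem_nhds hε)).and self_mem_nhdsWithin).exists
    obtain ⟨N, hN⟩ := Metric.cauchySeq_iff.1 hV.cauchySeq s h5
    refine ⟨N, fun j hj k hk => ?_⟩
    rw [dist_eq_norm]
    refine (norm_le_of_sup_of_lipschitz hR hα h5 (B := 2 * B) (by positivity) (fun p => ?_)
      fun p q hpq => ?_).trans_lt h4
    · rw [map_sub, Pi.sub_apply, ← hU, ← hU, ← dist_eq_norm]
      exact (BoundedContinuousFunction.dist_coe_le_dist p).trans (hN j hj k hk).le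
    · rw [map_sub, Pi.sub_apply, Pi.sub_apply, sub_sub_sub_comm]
      refine (norm_sub_le _ _).trans ?_
      linarith [h2 (φ j) p q hpq, h2 (φ k) p q hpq]
  obtain ⟨w, hw⟩ := cauchySeq_tendsto_of_complete hcs
  exact ⟨w, φ, hφ, hw⟩

/-- If `μ` is not an eigenvalue, then `μ - L` is bounded below. -/
theorem exists_norm_le_shifted (hn : 1 ≤ n) (hα0 : 0 < α) (hα1 : α < 1) (hR : 0 < R) (hd : 0 < d)
    {μ : ℂ} (hμ : ¬ IsEigenvalue (linearisation n hR hd α) μ) :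
    ∃ C : ℝ, 0 ≤ C ∧ ∀ u : neumannDomain (n := n) hR hd α,
      ‖(u : LittleHolder (cylinder n R d) α)‖ ≤ C * ‖shifted (linearisation n hR hd α) μ u‖ := by
  by_contra! hcon
  -- A sequence violating the bound with constants k + 1; normalised, it has norm one while its
  -- image under μ - L tends to 0.
  choose u hu using fun k : ℕ => hcon (k + 1) (by positivity)
  have hpos : ∀ k, 0 < ‖(u k : LittleHolder (cylinder n R d) α)‖ := fun k =>
    lt_of_le_of_lt (by positivity) (hu k)
  set w : ℕ → neumannDomain (n := n) hR hd α := fun k =>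
    ((‖(u k : LittleHolder (cylinder n R d) α)‖⁻¹ : ℝ) : ℂ) • u k
  have hw1 : ∀ k, ‖(w k : LittleHolder (cylinder n R d) α)‖ = 1 := fun k => by
    rw [Submodule.coe_smul, norm_smul, Complex.norm_real, norm_inv, norm_norm,
      inv_mul_cancel₀ (hpos k).ne']
  have hw2 : ∀ k, ‖shifted (linearisation n hR hd α) μ (w k)‖ ≤ 1 / ((k : ℝ) + 1) := fun k => by
    have e : shifted (linearisation n hR hd α) μ (w k)
        = ((‖(u k : LittleHolder (cylinder n R d) α)‖⁻¹ : ℝ) : ℂ)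
          • shifted (linearisation n hR hd α) μ (u k) := map_smul _ _ _
    rw [e, norm_smul, Complex.norm_real, norm_inv, norm_norm, inv_mul_eq_div,
      div_le_div_iff₀ (hpos k) (by positivity), one_mul, mul_comm]
    exact (hu k).le
  set N : ℝ := ‖1 + curvConst n R - μ‖ + ‖curvConst n R‖ + 1
  have hN : 0 ≤ N := by positivity
  have hf : ∀ k, ‖(w k : LittleHolder (cylinder n R d) α) - laplaceMap hR hd α (w k)‖ ≤ N := by
    intro k
    rw [sub_laplaceMap_eq hR hd μ]
    refine (norm_add_le _ _).trans (add_le_add ((norm_sub_le _ _).trans (add_le_add ?_ ?_)) ?_)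
    · rw [norm_smul, hw1, mul_one]
    · refine (norm_constHolder_le _).trans ?_
      rw [norm_mul]
      exact mul_le_of_le_one_right (norm_nonneg _) ((norm_meanMap_le hR _).trans (hw1 k).le)
    · refine (hw2 k).trans ?_
      rw [div_le_one (by positivity)]
      linarith [show (0 : ℝ) ≤ k by positivity]
  have hlip := fun k => (bounds_of_sub_laplaceMap_le hn hα0 hα1 hR hd (w k) hN
    fun p => (LittleHolder.norm_apply_le _ p).trans (hf k)).2
  -- The functions w_k - Δw_k are bounded, so the w_k are uniformly Lipschitz and subconverge in
  -- h^α. The limit has norm one and, by closedness, lies in the kernel, which is trivial.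
  obtain ⟨z, φ, hφ, hz⟩ := exists_tendsto_subseq hR hα1 (u := fun k => (w k : LittleHolder (cylinder n R d) α))
    (by positivity) (fun k => (hw1 k).le) hlip
  have hg : Filter.Tendsto (fun k => shifted (linearisation n hR hd α) μ (w (φ k))) Filter.atTop
      (nhds 0) := by
    have h3 := squeeze_zero_norm hw2 tendsto_one_div_add_atTop_nhds_zero_nat
    exact h3.comp hφ.tendsto_atTop
  obtain ⟨v, hv, hv0⟩ := exists_shifted_eq_of_tendsto hn hα0 hα1 hR hd hz hg
  have h4 : v = 0 := by
    by_contra h5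
    refine hμ fun h6 => h5 ?_
    have h7 : v ∈ eigenspace (linearisation n hR hd α) μ := hv0
    rw [h6] at h7
    exact h7
  have h5 : ‖z‖ = 1 := tendsto_nhds_unique hz.norm (by simp only [hw1]; exact tendsto_const_nhds)
  rw [← hv, h4, Submodule.coe_zero, norm_zero] at h5
  exact zero_ne_one h5

theorem restr_mem_neumannDomain (hR : 0 < R) (hd : 0 < d) (hα : α < 1) {v : Modes n}
    (hv : reflect v = v) : restr hR hα v ∈ neumannDomain hR hd α := by
  have hsec := hasSecondDerivs_ev (d := d) hR v
  have e : ∀ v : Modes n, (LittleHolder.toFun (restr hR hα v : LittleHolder (cylinder n R d) α))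
      = fun p : cylinder n R d => ambientExt d (ev v) p := fun v => by
    funext p
    rw [ambientExt_coe hR, restr_apply]
  refine ⟨?_, fun p hp => ?_⟩
  · rw [e]
    refine hsec.isLittleHolderTwo hR hd hα (fun a => ?_) fun a b => ?_
    · rw [← e]
      exact LittleHolder.isLittleHolder _
    · rw [← e]
      exact LittleHolder.isLittleHolder _
  · rw [e, hsec.axialDeriv_eq hR hd, ambientExt_coe hR]
    exact ev_field_none_eq_zero hv (toModel_inv_eq hR hd hp)

theorem laplaceMap_restr (hR : 0 < R) (hd : 0 < d) (hα : α < 1) {v : Modes n}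
    (hv : reflect v = v) :
    laplaceMap hR hd α ⟨restr hR hα v, restr_mem_neumannDomain hR hd hα hv⟩
      = restr hR hα (modeLaplacian R d v) := by
  have hsec := hasSecondDerivs_ev (d := d) hR v
  have e : (LittleHolder.toFun (restr hR hα v : LittleHolder (cylinder n R d) α))
      = fun p : cylinder n R d => ambientExt d (ev v) p := by
    funext p
    rw [ambientExt_coe hR, restr_apply]
  apply LittleHolder.toFun_injective
  funext p
  rw [laplaceMap_apply, restr_apply]
  change laplaceBeltrami (LittleHolder.toFun (restr hR hα v)) p = _
  rw [e, hsec.laplaceBeltrami_eq hR hd, ← sum_field_field hR, map_sum, ContinuousMap.sum_apply]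
  exact Finset.sum_congr rfl fun a _ => ambientExt_coe hR _ p

/-- `μ` is in the resolvent set if it is not an eigenvalue and `(μ - L) u = f` has a solution for
even sums of modes `f`. -/
theorem mem_resolventSet (hn : 1 ≤ n) (hα0 : 0 < α) (hα1 : α < 1) (hR : 0 < R) (hd : 0 < d)
    {μ : ℂ} (hμ : ¬ IsEigenvalue (linearisation n hR hd α) μ)
    (hmodes : ∀ v : Modes n, reflect v = v → ∃ u : neumannDomain (n := n) hR hd α,
      shifted (linearisation n hR hd α) μ u = restr hR hα1 v) :
    μ ∈ resolventSet (linearisation n hR hd α) := by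
  obtain ⟨C, hC, hest⟩ := exists_norm_le_shifted hn hα0 hα1 hR hd hμ
  have hinj : Function.Injective (shifted (linearisation n hR hd α) μ) := by
    rw [← LinearMap.ker_eq_bot]
    exact not_not.1 hμ
  refine ⟨⟨hinj, fun g => ?_⟩, C, hest⟩
  choose v hv hvg using fun k : ℕ => exists_even_restr_near hn hR hd hα0 hα1 g
    (ε := 1 / ((k : ℝ) + 1)) (by positivity)
  have hg : Filter.Tendsto (fun k => restr hR hα1 (v k)) Filter.atTop (nhds g) := by
    rw [tendsto_iff_norm_sub_tendsto_zero]
    exact squeeze_zero (fun _ => norm_nonneg _) hvg tendsto_one_div_add_atTop_nhds_zero_nat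
  choose u hu using fun k => hmodes (v k) (hv k)
  -- The lower bound for μ - L turns convergence of the right-hand sides into convergence of the
  -- solutions; closedness then identifies the limit as a solution for g.
  have hcs : CauchySeq fun k => (u k : LittleHolder (cylinder n R d) α) := by
    refine Metric.cauchySeq_iff.2 fun ε hε => ?_
    obtain ⟨N, hN⟩ := Metric.cauchySeq_iff.1 hg.cauchySeq (ε / (C + 1)) (by positivity)
    refine ⟨N, fun j hj k hk => ?_⟩
    have h1 := hN j hj k hk
    have h2 := hest (u j - u k)
    have h3 : shifted (linearisation n hR hd α) μ (u j - u k)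
        = restr hR hα1 (v j) - restr hR hα1 (v k) := by
      rw [← hu, ← hu]
      exact map_sub _ _ _
    rw [h3, Submodule.coe_sub] at h2
    rw [dist_eq_norm] at h1 ⊢
    rw [lt_div_iff₀ (by positivity)] at h1
    refine h2.trans_lt (lt_of_le_of_lt ?_ h1)
    rw [mul_comm]
    gcongr
    linarith
  obtain ⟨w, hw⟩ := cauchySeq_tendsto_of_complete hcs
  obtain ⟨z, -, hz⟩ := exists_shifted_eq_of_tendsto (μ := μ) hn hα0 hα1 hR hd hw
    (by simpa only [hu] using hg)
  exact ⟨z, hz⟩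

end ResolventSet

/-! ### Integration by parts on the cylinder -/

section Integration

variable {n : ℕ} {R d : ℝ} {α : ℝ≥0}

/-- The surface measure of the cylinder, up to a constant factor. -/
abbrev surfaceMeasure (n : ℕ) (d : ℝ) :
    Measure (Metric.sphere (0 : EuclideanSpace ℝ (Fin n)) 1 × Icc (0 : ℝ) d) :=
  (volume : Measure (EuclideanSpace ℝ (Fin n))).toSphere.prod (segmentMeasure d)

/-- A rotation, as a linear isometry. -/
def rotIsometry (i j : Fin n) (s : ℝ) :
    EuclideanSpace ℝ (Fin n) ≃ₗᵢ[ℝ] EuclideanSpace ℝ (Fin n) :=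
  LinearIsometry.toLinearIsometryEquiv
    { toFun := rotVec i j s
      map_add' := fun x y => by
        ext k
        simp only [rotVec, PiLp.add_apply]
        split_ifs <;> ring
      map_smul' := fun c x => by
        ext k
        simp only [rotVec, PiLp.smul_apply, smul_eq_mul, RingHom.id_apply]
        split_ifs <;> ring
      norm_map' := norm_rotVec i j s } rfl

/-- A linear isometry, restricted to the unit sphere. -/
def sphereMap (T : EuclideanSpace ℝ (Fin n) ≃ₗᵢ[ℝ] EuclideanSpace ℝ (Fin n))
    (x : Metric.sphere (0 : EuclideanSpace ℝ (Fin n)) 1) :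
    Metric.sphere (0 : EuclideanSpace ℝ (Fin n)) 1 :=
  ⟨T x, by rw [mem_sphere_zero_iff_norm, T.norm_map]; exact norm_eq_of_mem_sphere x⟩

theorem continuous_sphereMap (T : EuclideanSpace ℝ (Fin n) ≃ₗᵢ[ℝ] EuclideanSpace ℝ (Fin n)) :
    Continuous (sphereMap T) :=
  Continuous.subtype_mk (T.continuous.comp continuous_subtype_val) _

-- The measure of a subset of the sphere is a multiple of the volume of the cone over it, and a
-- linear isometry preserves both cones and volume.
open scoped Pointwise in
theorem measurePreserving_sphereMap
    (T : EuclideanSpace ℝ (Fin n) ≃ₗᵢ[ℝ] EuclideanSpace ℝ (Fin n)) :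
    MeasurePreserving (sphereMap T) (volume : Measure (EuclideanSpace ℝ (Fin n))).toSphere
      (volume : Measure (EuclideanSpace ℝ (Fin n))).toSphere := by
  have hm := (continuous_sphereMap T).measurable
  refine ⟨hm, Measure.ext fun s hs => ?_⟩
  rw [Measure.map_apply hm hs, Measure.toSphere_apply' _ hs, Measure.toSphere_apply' _ (hm hs)]
  congr 1
  have hT : volume (T ⁻¹' (Ioo (0 : ℝ) 1 • (Subtype.val '' s)))
      = volume (Ioo (0 : ℝ) 1 • (Subtype.val '' s)) :=
    T.measurePreserving.measure_preimage_equiv (f := T.toMeasurableEquiv) _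
  rw [← hT]
  congr 1
  ext x
  simp only [Set.mem_smul, mem_image, mem_preimage]
  constructor
  · rintro ⟨t, ht, _, ⟨y, hy, rfl⟩, rfl⟩
    exact ⟨t, ht, _, ⟨_, hy, rfl⟩, (T.map_smul t (y : EuclideanSpace ℝ (Fin n))).symm⟩
  · rintro ⟨t, ht, _, ⟨y, hy, rfl⟩, h⟩
    refine ⟨t, ht, _, ⟨sphereMap T.symm y, ?_, rfl⟩, ?_⟩
    · have e : sphereMap T (sphereMap T.symm y) = y := Subtype.ext (T.apply_symm_apply _)
      rwa [e]
    · apply T.injective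
      change T (t • T.symm (y : EuclideanSpace ℝ (Fin n))) = T x
      rw [T.map_smul, T.apply_symm_apply]
      exact h

/-- The coordinates on the cylinder, with values in the model. -/
def chart (d : ℝ) (p : Metric.sphere (0 : EuclideanSpace ℝ (Fin n)) 1 × Icc (0 : ℝ) d) :
    Model n :=
  (p.1, Circle.exp (Real.pi / d * p.2))

theorem continuous_chart : Continuous (chart (n := n) d) :=
  continuous_fst.prodMk (Circle.exp.continuous.comp
    (continuous_const.mul (continuous_subtype_val.comp continuous_snd)))

theorem toModel_cylinderPoint (hR : 0 < R)
    (p : Metric.sphere (0 : EuclideanSpace ℝ (Fin n)) 1 × Icc (0 : ℝ) d) :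
    toModel hR (cylinderPoint hR p) = chart d p := by
  refine Prod.ext (Subtype.ext ?_) rfl
  have h : ‖(cylinderPoint hR p : Ambient n).fst‖ = R := (cylinderPoint hR p).2.1
  change ‖(cylinderPoint hR p : Ambient n).fst‖⁻¹ • (R • (p.1 : EuclideanSpace ℝ (Fin n))) = p.1
  rw [h, smul_smul, inv_mul_cancel₀ hR.ne', one_smul]

theorem integrable_surface {f : Metric.sphere (0 : EuclideanSpace ℝ (Fin n)) 1 × Icc (0 : ℝ) d → ℂ}
    (hf : Continuous f) : Integrable f (surfaceMeasure n d) :=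
  hf.integrable_of_hasCompactSupport (HasCompactSupport.of_compactSpace f)

/-- The integral of a derivative along rotations vanishes. -/
theorem integral_rotation_deriv_eq_zero (i j : Fin n) {g g' : C(Model n, ℂ)}
    (h : ∀ s p, HasDerivAt (fun s => g (flow R d (some (i, j)) s p))
      (g' (flow R d (some (i, j)) s p)) s) :
    ∫ p, g' (chart d p) ∂(surfaceMeasure n d) = 0 := by
  have e : ∀ s p, flow R d (some (i, j)) s (chart d p)
      = chart d (Prod.map (sphereMap (rotIsometry i j ((Real.sqrt 2 * R)⁻¹ * s))) id p) :=
    fun _ _ => rfl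
  have hc : ∀ s, Continuous fun p : Metric.sphere (0 : EuclideanSpace ℝ (Fin n)) 1
      × Icc (0 : ℝ) d => flow R d (some (i, j)) s (chart d p) := fun s =>
    continuous_chart.comp ((continuous_sphereMap
      (rotIsometry i j ((Real.sqrt 2 * R)⁻¹ * s))).prodMap continuous_id)
  have hinv : ∀ s, ∫ p, g (flow R d (some (i, j)) s (chart d p)) ∂(surfaceMeasure n d)
      = ∫ p, g (chart d p) ∂(surfaceMeasure n d) := fun s => by
    have hmp := (measurePreserving_sphereMap (rotIsometry i j ((Real.sqrt 2 * R)⁻¹ * s))).prod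
      (MeasurePreserving.id (segmentMeasure d))
    simp only [e]
    conv_rhs => rw [surfaceMeasure, ← hmp.map_eq]
    exact (integral_map (f := fun p => g (chart d p)) hmp.measurable.aemeasurable
      (g.continuous.comp continuous_chart).aestronglyMeasurable).symm
  -- The integral does not depend on s by invariance of the measure; differentiation under the
  -- integral at s = 0 gives the integral of g'.
  have hd := (hasDerivAt_integral_of_dominated_loc_of_deriv_le (μ := surfaceMeasure n d)
    (F := fun s p => g (flow R d (some (i, j)) s (chart d p)))
    (F' := fun s p => g' (flow R d (some (i, j)) s (chart d p)))
    (x₀ := (0 : ℝ)) (bound := fun _ => ‖g'‖) Filter.univ_mem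
    (Filter.Eventually.of_forall fun s => (g.continuous.comp (hc s)).aestronglyMeasurable)
    (integrable_surface (g.continuous.comp (hc 0)))
    (g'.continuous.comp (hc 0)).aestronglyMeasurable
    (Filter.Eventually.of_forall fun p s _ => g'.norm_coe_le_norm _)
    (integrable_const _) (Filter.Eventually.of_forall fun p s _ => h s _)).2
  simp only [hinv, flow_zero] at hd
  exact hd.unique (hasDerivAt_const _ _)

theorem integral_rotation_by_parts (i j : Fin n) (u v : Modes n) :
    ∫ p, ev (field R d (some (i, j)) u) (chart d p) * ev v (chart d p) ∂(surfaceMeasure n d)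
      = -∫ p, ev u (chart d p) * ev (field R d (some (i, j)) v) (chart d p)
        ∂(surfaceMeasure n d) := by
  have h := integral_rotation_deriv_eq_zero (R := R) (d := d) i j (g := ev u * ev v)
    (g' := ev (field R d (some (i, j)) u) * ev v + ev u * ev (field R d (some (i, j)) v))
    fun s p => (hasDerivAt_flow R d u _ p s).fun_mul (hasDerivAt_flow R d v _ p s)
  have hi : ∀ u v : Modes n, Integrable (fun p => ev u (chart d p) * ev v (chart d p))
      (surfaceMeasure n d) := fun u v =>
    integrable_surface (((ev u).continuous.comp continuous_chart).mul
      ((ev v).continuous.comp continuous_chart))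
  simp only [ContinuousMap.add_apply, ContinuousMap.mul_apply] at h
  rw [integral_add (hi _ _) (hi _ _)] at h
  exact eq_neg_of_add_eq_zero_left h

theorem integral_segment (hd : 0 < d) (f : ℝ → ℂ) :
    ∫ z : Icc (0 : ℝ) d, f z ∂(segmentMeasure d) = ∫ z in (0 : ℝ)..d, f z := by
  rw [segmentMeasure, integral_subtype_comap measurableSet_Icc, integral_Icc_eq_integral_Ioc,
    intervalIntegral.integral_of_le hd.le]

/-- On each line over ω the difference of the integrands is the derivative of the Wronskian u'v -
uv', which vanishes at both ends because u and v are even. -/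
theorem integral_axial_by_parts (hd : 0 < d) {u v : Modes n} (hu : reflect u = u)
    (hv : reflect v = v) :
    ∫ p, ev (field R d none (field R d none u)) (chart d p) * ev v (chart d p)
        ∂(surfaceMeasure n d)
      = ∫ p, ev u (chart d p) * ev (field R d none (field R d none v)) (chart d p)
        ∂(surfaceMeasure n d) := by
  have hi : ∀ u v : Modes n, Integrable (fun p => ev u (chart d p) * ev v (chart d p))
      (surfaceMeasure n d) := fun u v =>
    integrable_surface (((ev u).continuous.comp continuous_chart).mul
      ((ev v).continuous.comp continuous_chart))
  rw [integral_prod _ (hi _ _), integral_prod _ (hi _ _)]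
  congr 1
  funext ω
  set γ : ℝ → Model n := fun z => flow R d none z (ω, 1)
  have hγ : ∀ z : Icc (0 : ℝ) d, chart d (ω, z) = γ z := fun z => by
    simp [chart, γ, flow]
  have hγc : Continuous γ := by
    refine continuous_const.prodMk ((Circle.exp.continuous.comp ?_).mul continuous_const)
    fun_prop
  simp only [hγ]
  rw [integral_segment hd fun z => ev (field R d none (field R d none u)) (γ z) * ev v (γ z),
    integral_segment hd fun z => ev u (γ z) * ev (field R d none (field R d none v)) (γ z),
    ← sub_eq_zero, ← intervalIntegral.integral_sub]
  · have hder : ∀ z, HasDerivAt (fun z => ev (field R d none u) (γ z) * ev v (γ z)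
        - ev u (γ z) * ev (field R d none v) (γ z))
        (ev (field R d none (field R d none u)) (γ z) * ev v (γ z)
          - ev u (γ z) * ev (field R d none (field R d none v)) (γ z)) z := fun z => by
      exact (((hasDerivAt_flow R d _ _ _ z).fun_mul (hasDerivAt_flow R d _ _ _ z)).fun_sub
        ((hasDerivAt_flow R d _ _ _ z).fun_mul (hasDerivAt_flow R d _ _ _ z))).congr_deriv
        (by ring)
    rw [intervalIntegral.integral_eq_sub_of_hasDerivAt fun z _ => hder z]
    · have h0 : (γ 0).2⁻¹ = (γ 0).2 := by simp [γ, flow]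
      have h1 : (γ d).2⁻¹ = (γ d).2 := by
        have : γ d = (ω, Circle.exp Real.pi) := by
          simp [γ, flow, hd.ne']
        rw [this]
        apply Circle.ext
        simp
      rw [ev_field_none_eq_zero hu h0, ev_field_none_eq_zero hv h0, ev_field_none_eq_zero hu h1,
        ev_field_none_eq_zero hv h1]
      ring
    · exact ((((ev _).continuous.comp hγc).mul ((ev _).continuous.comp hγc)).sub
        (((ev _).continuous.comp hγc).mul ((ev _).continuous.comp hγc))).intervalIntegrable _ _
  · exact (((ev _).continuous.comp hγc).mul ((ev _).continuous.comp hγc)).intervalIntegrable _ _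
  · exact (((ev _).continuous.comp hγc).mul ((ev _).continuous.comp hγc)).intervalIntegrable _ _

/-- The Laplacian is symmetric. -/
theorem integral_modeLaplacian_mul (hR : 0 < R) (hd : 0 < d) {u v : Modes n} (hu : reflect u = u)
    (hv : reflect v = v) :
    ∫ p, ev (modeLaplacian R d u) (chart d p) * ev v (chart d p) ∂(surfaceMeasure n d)
      = ∫ p, ev u (chart d p) * ev (modeLaplacian R d v) (chart d p) ∂(surfaceMeasure n d) := by
  have hi : ∀ u v : Modes n, Integrable (fun p => ev u (chart d p) * ev v (chart d p))
      (surfaceMeasure n d) := fun u v =>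
    integrable_surface (((ev u).continuous.comp continuous_chart).mul
      ((ev v).continuous.comp continuous_chart))
  simp only [← sum_field_field hR, map_sum, ContinuousMap.sum_apply, Finset.sum_mul,
    Finset.mul_sum]
  rw [integral_finsetSum _ fun a _ => hi _ _, integral_finsetSum _ fun a _ => hi _ _]
  refine Finset.sum_congr rfl fun a _ => ?_
  rcases a with _ | ⟨i, j⟩
  · exact integral_axial_by_parts hd hu hv
  · rw [integral_rotation_by_parts, integral_rotation_by_parts, neg_neg]

/-- The bilinear form `∫ u v` on the cylinder. -/
def pairing (hR : 0 < R) (d : ℝ) (α : ℝ≥0) :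
    LittleHolder (cylinder n R d) α →ₗ[ℂ] LittleHolder (cylinder n R d) α →ₗ[ℂ] ℂ :=
  have hi : ∀ u v : LittleHolder (cylinder n R d) α, Integrable (fun p =>
      LittleHolder.toFun u (cylinderPoint hR p) * LittleHolder.toFun v (cylinderPoint hR p))
      (surfaceMeasure n d) := fun u v =>
    integrable_surface ((u.isLittleHolder.continuous.comp (continuous_cylinderPoint hR)).mul
      (v.isLittleHolder.continuous.comp (continuous_cylinderPoint hR)))
  LinearMap.mk₂ ℂ (fun u v => ∫ p, LittleHolder.toFun u (cylinderPoint hR p)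
      * LittleHolder.toFun v (cylinderPoint hR p) ∂(surfaceMeasure n d))
    (fun u u' v => by
      rw [← integral_add (hi u v) (hi u' v)]
      simp only [map_add, Pi.add_apply, add_mul])
    (fun c u v => by
      rw [smul_eq_mul, ← integral_const_mul]
      simp only [map_smul, Pi.smul_apply, smul_eq_mul, mul_assoc])
    (fun u v v' => by
      rw [← integral_add (hi u v) (hi u v')]
      simp only [map_add, Pi.add_apply, mul_add])
    (fun c u v => by
      rw [smul_eq_mul, ← integral_const_mul]
      simp only [map_smul, Pi.smul_apply, smul_eq_mul, mul_left_comm])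

theorem pairing_apply (hR : 0 < R) (u v : LittleHolder (cylinder n R d) α) :
    pairing hR d α u v = ∫ p, LittleHolder.toFun u (cylinderPoint hR p)
      * LittleHolder.toFun v (cylinderPoint hR p) ∂(surfaceMeasure n d) := rfl

theorem pairing_comm (hR : 0 < R) (u v : LittleHolder (cylinder n R d) α) :
    pairing hR d α u v = pairing hR d α v u := by
  simp only [pairing_apply, mul_comm]

theorem norm_pairing_le (hR : 0 < R) (u v : LittleHolder (cylinder n R d) α) :
    ‖pairing hR d α u v‖ ≤ (surfaceMeasure n d).real univ * ‖u‖ * ‖v‖ := by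
  rw [pairing_apply]
  refine (norm_integral_le_of_norm_le_const (C := ‖u‖ * ‖v‖)
    (Filter.Eventually.of_forall fun p => ?_)).trans (le_of_eq (by ring))
  rw [norm_mul]
  exact mul_le_mul (u.norm_apply_le _) (v.norm_apply_le _) (norm_nonneg _) (norm_nonneg _)

theorem tendsto_pairing (hR : 0 < R) {u : ℕ → LittleHolder (cylinder n R d) α}
    {w : LittleHolder (cylinder n R d) α} (h : Filter.Tendsto u Filter.atTop (nhds w))
    (v : LittleHolder (cylinder n R d) α) :
    Filter.Tendsto (fun k => pairing hR d α (u k) v) Filter.atTop (nhds (pairing hR d α w v)) :=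
  (((pairing hR d α).flip v).mkContinuous ((surfaceMeasure n d).real univ * ‖v‖) fun u => by
    refine (norm_pairing_le hR u v).trans (le_of_eq (by ring))).continuous.continuousAt.tendsto.comp h

theorem pairing_restr_modeLaplacian (hR : 0 < R) (hd : 0 < d) (hα : α < 1) {u v : Modes n}
    (hu : reflect u = u) (hv : reflect v = v) :
    pairing hR d α (restr hR hα (modeLaplacian R d u)) (restr hR hα v)
      = pairing hR d α (restr hR hα u) (restr hR hα (modeLaplacian R d v)) := by
  simp only [pairing_apply, restr_apply, toModel_cylinderPoint]
  exact integral_modeLaplacian_mul hR hd hu hv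

/-- Symmetry extends from modes to the domain by approximating u together with Δu, so no integration
by parts is needed for general elements of h^{2+α}. -/
theorem pairing_laplaceMap (hn : 1 ≤ n) (hα0 : 0 < α) (hα1 : α < 1) (hR : 0 < R) (hd : 0 < d)
    (u : neumannDomain (n := n) hR hd α) {v : Modes n} (hv : reflect v = v) :
    pairing hR d α (laplaceMap hR hd α u) (restr hR hα1 v)
      = pairing hR d α (u : LittleHolder (cylinder n R d) α)
        (restr hR hα1 (modeLaplacian R d v)) := by
  obtain ⟨w, hw, h1, h2⟩ := exists_modes_tendsto hn hα0 hα1 hR hd u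
  have h3 := h2.sub h1
  rw [sub_sub_cancel] at h3
  refine tendsto_nhds_unique (tendsto_pairing hR h3 _)
    ((tendsto_pairing hR h2 _).congr fun k => ?_)
  rw [← map_sub (restr hR hα1), ← modeLaplacian_resolvent hn,
    pairing_restr_modeLaplacian hR hd hα1 _ hv]
  rw [reflect_resolvent, hw]

/-! ### Completeness of the even modes -/

theorem isOpenPosMeasure_segmentMeasure (hd : 0 < d) : (segmentMeasure d).IsOpenPosMeasure := by
  refine ⟨fun U hU hne => ?_⟩
  obtain ⟨O, hO, rfl⟩ := isOpen_induced_iff.1 hU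
  obtain ⟨x, hx⟩ := hne
  rw [segmentMeasure, comap_subtype_coe_apply measurableSet_Icc]
  have h1 : (O ∩ Ioo 0 d).Nonempty := by
    have h2 : (x : ℝ) ∈ closure (Ioo 0 d) := by
      rw [closure_Ioo hd.ne]
      exact x.2
    exact mem_closure_iff.1 h2 O hO hx
  refine fun h => ((hO.inter isOpen_Ioo).measure_pos volume h1).ne' (measure_mono_null ?_ h)
  exact fun y hy => ⟨⟨y, Ioo_subset_Icc_self hy.2⟩, hy.1, rfl⟩

theorem surjective_cylinderPoint (hR : 0 < R) :
    Function.Surjective (cylinderPoint (n := n) (d := d) hR) := fun p => by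
  refine ⟨((toModel hR p).1, ⟨(p : Ambient n).snd, p.2.2⟩), ?_⟩
  have h : ‖(p : Ambient n).fst‖ = R := p.2.1
  refine Subtype.ext (WithLp.ofLp_injective 2 (Prod.ext ?_ rfl))
  change R • (‖(p : Ambient n).fst‖⁻¹ • (p : Ambient n).fst) = (p : Ambient n).fst
  rw [h, smul_smul, mul_inv_cancel₀ hR.ne', one_smul]

/-- A function orthogonal to all even sums of modes vanishes. -/
theorem eq_zero_of_pairing_eq_zero (hn : 1 ≤ n) (hα0 : 0 < α) (hα1 : α < 1) (hR : 0 < R)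
    (hd : 0 < d) {u : LittleHolder (cylinder n R d) α}
    (h : ∀ v : Modes n, reflect v = v → pairing hR d α u (restr hR hα1 v) = 0) : u = 0 := by
  -- The pairing is bilinear, so testing u against its conjugate gives ∫|u|². The conjugate is a
  -- limit of even modes, whence this vanishes.
  set w : LittleHolder (cylinder n R d) α :=
    LittleHolder.mk _ (u.isLittleHolder.clm_comp (Complex.conjCLE : ℂ →L[ℝ] ℂ))
  have h1 : pairing hR d α u w = 0 := by
    refine norm_le_zero_iff.1 (le_of_forall_pos_le_add fun ε hε => ?_)
    set M := (surfaceMeasure n d).real univ * ‖u‖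
    have hM : 0 ≤ M := by positivity
    obtain ⟨v, hv, hvw⟩ := exists_even_restr_near hn hR hd hα0 hα1 w
      (ε := ε / (M + 1)) (by positivity)
    have h2 := norm_pairing_le hR u (restr hR hα1 v - w)
    rw [map_sub, h v hv, zero_sub, norm_neg] at h2
    refine h2.trans ?_
    rw [zero_add]
    calc M * ‖restr hR hα1 v - w‖ ≤ (M + 1) * (ε / (M + 1)) := by gcongr; linarith
      _ = ε := by field_simp
  set f : Metric.sphere (0 : EuclideanSpace ℝ (Fin n)) 1 × Icc (0 : ℝ) d → ℝ := fun p =>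
    ‖LittleHolder.toFun u (cylinderPoint hR p)‖ ^ 2
  have hf : Continuous f :=
    (u.isLittleHolder.continuous.comp (continuous_cylinderPoint hR)).norm.pow 2
  have h2 : ∫ p, f p ∂(surfaceMeasure n d) = 0 := by
    rw [pairing_apply] at h1
    have e : ∀ p, LittleHolder.toFun u (cylinderPoint hR p)
        * LittleHolder.toFun w (cylinderPoint hR p) = (f p : ℂ) := fun p => by
      change LittleHolder.toFun u (cylinderPoint hR p)
        * (starRingEnd ℂ) (LittleHolder.toFun u (cylinderPoint hR p)) = _
      rw [Complex.mul_conj']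
      simp [f]
    simp only [e, integral_complex_ofReal] at h1
    exact_mod_cast h1
  have := isOpenPosMeasure_segmentMeasure hd
  have h3 := (integral_eq_zero_iff_of_nonneg (fun p => by positivity)
    (hf.integrable_of_hasCompactSupport (HasCompactSupport.of_compactSpace f))).1 h2
  have h4 := (Continuous.ae_eq_iff_eq _ hf continuous_zero).1 h3
  apply LittleHolder.toFun_injective
  funext p
  obtain ⟨q, rfl⟩ := surjective_cylinderPoint hR p
  simpa [f] using congrFun h4 q

end Integration

/-! ### The eigenvalues -/

section Eigenvalues

variable {n : ℕ} {R d : ℝ} {α : ℝ≥0}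

/-- Twice the even part of a sum of modes. -/
def symmetrise : Modes n →ₗ[ℂ] Modes n := LinearMap.id + reflect

theorem symmetrise_apply (v : Modes n) : symmetrise v = v + reflect v := rfl

theorem reflect_symmetrise (v : Modes n) : reflect (symmetrise v) = symmetrise v := by
  rw [symmetrise_apply, map_add, reflect_reflect, add_comm]

theorem symmetrise_of_even {v : Modes n} (hv : reflect v = v) :
    (2⁻¹ : ℂ) • symmetrise v = v := by
  rw [symmetrise_apply, hv, ← two_smul ℂ v, smul_smul]
  norm_num

theorem scale_symmetrise_lof {c : ℕ × ℤ → ℂ} (hc : ∀ l m, c (l, -m) = c (l, m)) (i : ℕ × ℤ)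
    (h : Harm n i.1) : scale c (symmetrise (DirectSum.lof ℂ _ (fun i : ℕ × ℤ => Harm n i.1) i h))
      = c i • symmetrise (DirectSum.lof ℂ _ (fun i : ℕ × ℤ => Harm n i.1) i h) := by
  rw [symmetrise_apply, map_add, scale_reflect hc, scale_lof, map_smul, smul_add]

theorem modeLaplacian_symmetrise_lof (i : ℕ × ℤ) (h : Harm n i.1) :
    modeLaplacian R d (symmetrise (DirectSum.lof ℂ _ (fun i : ℕ × ℤ => Harm n i.1) i h))
      = -(freq n R d i : ℂ) • symmetrise (DirectSum.lof ℂ _ (fun i : ℕ × ℤ => Harm n i.1) i h) :=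
  scale_symmetrise_lof (fun l m => by rw [freq_neg]) i h

/-- The eigenvalue of the linearisation on a mode. -/
def symbol (n : ℕ) (R d : ℝ) (i : ℕ × ℤ) : ℂ :=
  if i = (0, 0) then 0 else curvConst n R - freq n R d i

theorem symbol_neg (n : ℕ) (R d : ℝ) (l : ℕ) (m : ℤ) :
    symbol n R d (l, -m) = symbol n R d (l, m) := by
  simp [symbol, freq_neg]

/-- A nonconstant mode of frequency zero forces m = 0 and l + n = 2, hence n = l = 1: the function
that changes sign between the two components of the cylinder. There the mean term is absent, since n
- 1 = 0. -/
theorem curvConst_eq_zero_of_freq (hn : 1 ≤ n) (hR : 0 < R) (hd : 0 < d) {i : ℕ × ℤ}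
    (hi : i ≠ (0, 0)) (h : freq n R d i = 0) : curvConst n R = 0 := by
  obtain ⟨l, m⟩ := i
  have hn' : (1 : ℝ) ≤ n := by exact_mod_cast hn
  have h1 : (0 : ℝ) ≤ (l : ℝ) * ((l : ℝ) + (n : ℝ) - 2) := by
    rcases Nat.eq_zero_or_pos l with rfl | hl
    · simp
    · have : (1 : ℝ) ≤ l := by exact_mod_cast hl
      exact mul_nonneg (by linarith) (by linarith)
  have h2 : 0 ≤ (m : ℝ) ^ 2 * Real.pi ^ 2 / d ^ 2 := by positivity
  have h3 : 0 ≤ (l : ℝ) * ((l : ℝ) + (n : ℝ) - 2) / R ^ 2 := by positivity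
  have h4 : (m : ℝ) ^ 2 * Real.pi ^ 2 / d ^ 2 = 0 := by
    simp only [freq] at h
    linarith
  have h5 : (l : ℝ) * ((l : ℝ) + (n : ℝ) - 2) / R ^ 2 = 0 := by
    simp only [freq] at h
    linarith
  have hm : m = 0 := by
    have := Real.pi_pos.ne'
    simpa [hd.ne', this] using h4
  have hl : l ≠ 0 := fun hl => hi (by rw [hl, hm])
  have hl' : (1 : ℝ) ≤ l := by exact_mod_cast Nat.one_le_iff_ne_zero.2 hl
  have h6 : (l : ℝ) + (n : ℝ) - 2 = 0 := by
    have : (l : ℝ) ≠ 0 := by exact_mod_cast hl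
    simpa [hR.ne', this] using h5
  have h7 : (n : ℝ) = 1 := by linarith
  have h8 : n = 1 := by exact_mod_cast h7
  simp [curvConst, h8]

theorem nontrivial_surfaceMeasure (hn : 1 ≤ n) (hd : 0 < d) :
    (surfaceMeasure n d).real univ ≠ 0 := by
  have := isOpenPosMeasure_segmentMeasure hd
  have : Nonempty (Fin n) := ⟨⟨0, hn⟩⟩
  obtain ⟨x, hx⟩ := NormedSpace.sphere_nonempty (x := (0 : EuclideanSpace ℝ (Fin n))).2 zero_le_one
  have h := isOpen_univ.measure_pos (surfaceMeasure n d) ⟨(⟨x, hx⟩, ⟨0, le_rfl, hd.le⟩), mem_univ _⟩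
  exact (ENNReal.toReal_pos h.ne' (measure_ne_top _ _)).ne'

theorem pairing_constHolder (hn : 1 ≤ n) (hR : 0 < R) (hd : 0 < d)
    (u : LittleHolder (cylinder n R d) α) (z : ℂ) :
    pairing hR d α u (constHolder R d α z)
      = (surfaceMeasure n d).real univ * z * meanMap hR d α u := by
  rw [pairing_apply, meanMap_apply, mean, average_eq]
  simp only [constHolder_apply]
  rw [integral_mul_const, Complex.real_smul, Complex.ofReal_inv]
  have h : ((surfaceMeasure n d).real univ : ℂ) ≠ 0 := by
    exact_mod_cast nontrivial_surfaceMeasure hn hd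
  field_simp

theorem meanMap_constHolder (hn : 1 ≤ n) (hR : 0 < R) (hd : 0 < d) (z : ℂ) :
    meanMap hR d α (constHolder R d α z : LittleHolder (cylinder n R d) α) = z := by
  rw [meanMap_apply, mean, average_eq]
  simp only [constHolder_apply]
  rw [integral_const, smul_smul, inv_mul_cancel₀ (nontrivial_surfaceMeasure hn hd), one_smul]

theorem exists_restr_eq_constHolder (hR : 0 < R) (hα : α < 1) (h : Harm n 0) :
    ∃ z, restr hR hα (symmetrise (DirectSum.lof ℂ _ (fun i : ℕ × ℤ => Harm n i.1) (0, 0) h))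
      = (constHolder R d α z : LittleHolder (cylinder n R d) α) := by
  have h1 := (mem_Harm.1 h.2).1
  rw [← MvPolynomial.totalDegree_zero_iff_isHomogeneous,
    MvPolynomial.totalDegree_eq_zero_iff_eq_C] at h1
  refine ⟨2 * MvPolynomial.coeff 0 h.1, ?_⟩
  apply LittleHolder.toFun_injective
  funext p
  rw [restr_apply, constHolder_apply, symmetrise_apply, map_add, ContinuousMap.add_apply,
    ev_reflect, ev_lof, ev_lof, h1]
  simp [two_mul]

theorem restr_oneMode (hR : 0 < R) (hα : α < 1) :
    restr hR hα oneMode = (constHolder R d α 1 : LittleHolder (cylinder n R d) α) := by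
  apply LittleHolder.toFun_injective
  funext p
  rw [restr_apply, constHolder_apply, ev_oneMode]

/-- By symmetry of Δ and Δ1 = 0, the product of the frequency and the integral of the mode is zero.
-/
theorem meanMap_restr_eq_zero (hn : 1 ≤ n) (hR : 0 < R) (hd : 0 < d) (hα : α < 1) {i : ℕ × ℤ}
    (hi : freq n R d i ≠ 0) (h : Harm n i.1) :
    meanMap hR d α (restr hR hα
      (symmetrise (DirectSum.lof ℂ _ (fun i : ℕ × ℤ => Harm n i.1) i h))) = 0 := by
  have h0 : reflect (oneMode : Modes n) = oneMode := by
    rw [oneMode, reflect_lof]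
    rfl
  have h1 : modeLaplacian R d (oneMode : Modes n) = 0 := by
    rw [oneMode, modeLaplacian, scale_lof]
    simp [freq]
  have h2 := pairing_restr_modeLaplacian (α := α) hR hd hα (reflect_symmetrise
    (DirectSum.lof ℂ _ (fun i : ℕ × ℤ => Harm n i.1) i h)) h0
  rw [h1, map_zero, map_zero, modeLaplacian_symmetrise_lof, map_smul, map_smul,
    LinearMap.smul_apply, restr_oneMode, pairing_constHolder hn hR hd] at h2
  have h3 : ((surfaceMeasure n d).real univ : ℂ) ≠ 0 := by
    exact_mod_cast nontrivial_surfaceMeasure hn hd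
  have h4 : (freq n R d i : ℂ) ≠ 0 := by exact_mod_cast hi
  simpa [h3, h4] using h2

/-- Modes of nonzero frequency have mean zero, and nonconstant modes of frequency zero occur only if
the coefficient vanishes. So the mean term is a multiplier supported at (0, 0). -/
theorem constHolder_meanMap_restr (hn : 1 ≤ n) (hR : 0 < R) (hd : 0 < d) (hα : α < 1)
    {v : Modes n} (hv : reflect v = v) :
    constHolder R d α (curvConst n R * meanMap hR d α (restr hR hα v))
      = restr hR hα (scale (fun i => if i = (0, 0) then curvConst n R else 0) v) := by
  set c : ℕ × ℤ → ℂ := fun i => if i = (0, 0) then curvConst n R else 0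
  have hc : ∀ l m, c (l, -m) = c (l, m) := fun l m => by simp [c]
  suffices H : ∀ v : Modes n, constHolder R d α
      (curvConst n R * meanMap hR d α (restr hR hα (symmetrise v)))
      = restr hR hα (scale c (symmetrise v)) by
    have h1 := H ((2⁻¹ : ℂ) • v)
    rwa [map_smul symmetrise, symmetrise_of_even hv] at h1
  intro v
  induction v using Modes.induction with
  | add u v hu hv => simp only [map_add, mul_add, hu, hv]
  | mode i h =>
    rw [scale_symmetrise_lof hc, map_smul]
    by_cases hi : i = (0, 0)
    · subst hi
      obtain ⟨z, hz⟩ := exists_restr_eq_constHolder (d := d) hR hα h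
      rw [hz, meanMap_constHolder hn hR hd, ← smul_eq_mul, map_smul]
      simp [c]
    · have h1 : c i = 0 := if_neg hi
      rw [h1, zero_smul]
      by_cases hf : freq n R d i = 0
      · rw [curvConst_eq_zero_of_freq hn hR hd hi hf, zero_mul, map_zero]
      · rw [meanMap_restr_eq_zero hn hR hd hα hf, mul_zero, map_zero]

/-- The restriction of an even sum of modes, as an element of the domain. -/
def restrDomain (hR : 0 < R) (hd : 0 < d) (hα : α < 1) {v : Modes n} (hv : reflect v = v) :
    neumannDomain (n := n) hR hd α :=
  ⟨restr hR hα v, restr_mem_neumannDomain hR hd hα hv⟩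

/-- The linearisation acts on even sums of modes as the multiplier `symbol`. -/
theorem shifted_restr (hn : 1 ≤ n) (hR : 0 < R) (hd : 0 < d) (hα : α < 1) (μ : ℂ) {v : Modes n}
    (hv : reflect v = v) :
    shifted (linearisation n hR hd α) μ (restrDomain hR hd hα hv)
      = restr hR hα (scale (fun i => μ - symbol n R d i) v) := by
  refine (shifted_linearisation hR hd μ (restrDomain hR hd hα hv)).trans ?_
  have h1 : ((restrDomain hR hd hα hv : neumannDomain (n := n) hR hd α) :
      LittleHolder (cylinder n R d) α) = restr hR hα v := rfl
  have h2 : laplaceMap hR hd α (restrDomain hR hd hα hv) = restr hR hα (modeLaplacian R d v) :=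
    laplaceMap_restr hR hd hα hv
  rw [h1, h2, constHolder_meanMap_restr hn hR hd hα hv]
  simp only [← map_smul, ← map_add, ← map_sub]
  congr 1
  rw [modeLaplacian]
  clear h1 h2 hv
  induction v using Modes.induction with
  | add u v hu hv =>
    simp only [map_add, smul_add, ← hu, ← hv]
    abel
  | mode i h =>
    simp only [scale_lof]
    rw [symbol]
    split_ifs with hi
    · simp [hi, freq]
    · module

/-- Eigenfunctions for different eigenvalues are orthogonal. -/
theorem pairing_eq_zero_of_ne (hn : 1 ≤ n) (hα0 : 0 < α) (hα1 : α < 1) (hR : 0 < R) (hd : 0 < d)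
    {μ : ℂ} {u : neumannDomain (n := n) hR hd α}
    (hu : shifted (linearisation n hR hd α) μ u = 0) {i : ℕ × ℤ} (hi : μ ≠ symbol n R d i)
    (h : Harm n i.1) : pairing hR d α (u : LittleHolder (cylinder n R d) α) (restr hR hα1
      (symmetrise (DirectSum.lof ℂ _ (fun i : ℕ × ℤ => Harm n i.1) i h))) = 0 := by
  have h1 := pairing_laplaceMap hn hα0 hα1 hR hd u (reflect_symmetrise
    (DirectSum.lof ℂ _ (fun i : ℕ × ℤ => Harm n i.1) i h))
  rw [modeLaplacian_symmetrise_lof, map_smul, map_smul] at h1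
  have h2 := congrArg (fun w => pairing hR d α w (restr hR hα1
      (symmetrise (DirectSum.lof ℂ _ (fun i : ℕ × ℤ => Harm n i.1) i h)))) hu
  simp only [shifted_linearisation, map_sub, map_add, map_smul, LinearMap.sub_apply,
    LinearMap.add_apply, LinearMap.smul_apply, h1, map_zero, LinearMap.zero_apply,
    smul_eq_mul] at h2
  refine (mul_eq_zero.1 (?_ : (μ - symbol n R d i) * _ = 0)).resolve_left (sub_ne_zero.2 hi)
  -- At (0, 0) the mean term cancels the curvature term. Elsewhere it vanishes, either because the
  -- coefficient is 0 or because the mode has mean zero.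
  by_cases hi0 : i = (0, 0)
  · subst hi0
    obtain ⟨z, hz⟩ := exists_restr_eq_constHolder (d := d) hR hα1 h
    rw [hz, pairing_constHolder hn hR hd, pairing_constHolder hn hR hd,
      meanMap_constHolder hn hR hd] at h2
    rw [hz, pairing_constHolder hn hR hd]
    simp only [symbol, freq, if_true]
    simp only [freq] at h2
    push_cast at h2 ⊢
    linear_combination h2
  · rw [symbol, if_neg hi0]
    by_cases hf : freq n R d i = 0
    · rw [curvConst_eq_zero_of_freq hn hR hd hi0 hf, hf] at h2 ⊢
      simp only [zero_mul, map_zero, LinearMap.zero_apply] at h2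
      push_cast at h2 ⊢
      linear_combination h2
    · rw [pairing_comm hR (constHolder R d α _), pairing_constHolder hn hR hd,
        meanMap_restr_eq_zero hn hR hd hα1 hf] at h2
      linear_combination h2

theorem eq_zero_of_pairing_lof_eq_zero (hn : 1 ≤ n) (hα0 : 0 < α) (hα1 : α < 1) (hR : 0 < R)
    (hd : 0 < d) {u : LittleHolder (cylinder n R d) α}
    (H : ∀ (i : ℕ × ℤ) (h : Harm n i.1), pairing hR d α u (restr hR hα1
      (symmetrise (DirectSum.lof ℂ _ (fun i : ℕ × ℤ => Harm n i.1) i h))) = 0) : u = 0 := by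
  refine eq_zero_of_pairing_eq_zero hn hα0 hα1 hR hd fun v hv => ?_
  suffices H' : ∀ v : Modes n, pairing hR d α u (restr hR hα1 (symmetrise v)) = 0 by
    rw [← symmetrise_of_even hv, map_smul, map_smul, H', smul_zero]
  intro v
  induction v using Modes.induction with
  | add u v hu hv => simp only [map_add, hu, hv, add_zero]
  | mode i h => exact H i h

/-- Otherwise an eigenfunction would be orthogonal to all even modes and hence zero. For n = 1 the
degrees l ≥ 2 carry no nonzero harmonics and impose nothing. -/
theorem exists_symbol_eq (hn : 1 ≤ n) (hα0 : 0 < α) (hα1 : α < 1) (hR : 0 < R) (hd : 0 < d)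
    {μ : ℂ} (hμ : IsEigenvalue (linearisation n hR hd α) μ) :
    ∃ i : ℕ × ℤ, (n = 1 → i.1 ≤ 1) ∧ μ = symbol n R d i := by
  by_contra! hcon
  obtain ⟨u, hu, hu0⟩ := Submodule.exists_mem_ne_zero_of_ne_bot hμ
  refine hu0 (Subtype.ext (eq_zero_of_pairing_lof_eq_zero hn hα0 hα1 hR hd fun i h => ?_))
  by_cases hi : n = 1 → i.1 ≤ 1
  · exact pairing_eq_zero_of_ne hn hα0 hα1 hR hd hu (hcon i hi) h
  · push Not at hi
    obtain ⟨rfl, hi⟩ := hi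
    have h0 : h = 0 := Subtype.ext (Harm_one_eq_zero hi h.2)
    rw [h0]
    simp only [map_zero]

theorem restr_symmetrise_lof_apply (hR : 0 < R) (hd : 0 < d) (hα : α < 1) (l : ℕ) (m : ℤ)
    (h : Harm n l) (ω : Metric.sphere (0 : EuclideanSpace ℝ (Fin n)) 1) :
    LittleHolder.toFun (restr hR hα (symmetrise (DirectSum.lof ℂ _
      (fun i : ℕ × ℤ => Harm n i.1) (l, m) h)) : LittleHolder (cylinder n R d) α)
      (cylinderPoint hR (ω, ⟨0, le_rfl, hd.le⟩))
      = 2 * MvPolynomial.eval (fun k => ((ω : EuclideanSpace ℝ (Fin n)) k : ℂ)) h.1 := by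
  rw [restr_apply, toModel_cylinderPoint, symmetrise_apply, map_add, ContinuousMap.add_apply,
    ev_reflect, ev_lof, ev_lof]
  simp [chart, two_mul]

/-- The even part of a mode is an eigenfunction. It is nonzero because at z = 0 both reflected
halves agree and the harmonic factor does not vanish at the first basis vector. -/
theorem isEigenvalue_symbol (hn : 1 ≤ n) (hα1 : α < 1) (hR : 0 < R) (hd : 0 < d)
    {i : ℕ × ℤ} (hi : n = 1 → i.1 ≤ 1) :
    IsEigenvalue (linearisation n hR hd α) (symbol n R d i) := by
  obtain ⟨h, hh, he⟩ := exists_mem_Harm_eval_ne_zero hn i.1 hi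
  set v := symmetrise (DirectSum.lof ℂ _ (fun i : ℕ × ℤ => Harm n i.1) i ⟨h, hh⟩)
  intro hbot
  have hv : reflect v = v := reflect_symmetrise _
  have h0 : shifted (linearisation n hR hd α) (symbol n R d i) (restrDomain hR hd hα1 hv) = 0 := by
    refine (shifted_restr hn hR hd hα1 _ hv).trans ?_
    rw [scale_symmetrise_lof fun l m => by rw [symbol_neg], sub_self, zero_smul, map_zero]
  have h1 : restrDomain hR hd hα1 hv ∈ eigenspace (linearisation n hR hd α) (symbol n R d i) := h0
  rw [hbot] at h1
  have h2 : (restr hR hα1 v : LittleHolder (cylinder n R d) α) = 0 :=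
    congrArg Subtype.val ((Submodule.mem_bot ℂ).1 h1)
  have h3 := restr_symmetrise_lof_apply hR hd hα1 i.1 i.2 ⟨h, hh⟩
    ⟨EuclideanSpace.single ⟨0, hn⟩ 1, by simp⟩
  change LittleHolder.toFun (restr hR hα1 v : LittleHolder (cylinder n R d) α) _ = _ at h3
  rw [h2, map_zero, Pi.zero_apply] at h3
  refine he (Eq.trans ?_ ((mul_eq_zero.1 h3.symm).resolve_left two_ne_zero))
  congr 2
  funext k
  rw [PiLp.single_apply]
  split_ifs <;> simp

theorem mem_resolventSet_of_not_isEigenvalue (hn : 1 ≤ n) (hα0 : 0 < α) (hα1 : α < 1)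
    (hR : 0 < R) (hd : 0 < d) {μ : ℂ} (hμ : ¬ IsEigenvalue (linearisation n hR hd α) μ) :
    μ ∈ resolventSet (linearisation n hR hd α) := by
  refine mem_resolventSet hn hα0 hα1 hR hd hμ fun v hv => ?_
  have hr : reflect (scale (fun i => (μ - symbol n R d i)⁻¹) v)
      = scale (fun i => (μ - symbol n R d i)⁻¹) v := by
    rw [← scale_reflect fun l m => by rw [symbol_neg], hv]
  refine ⟨restrDomain hR hd hα1 hr, (shifted_restr hn hR hd hα1 _ hr).trans ?_⟩
  rw [scale_scale]
  congr 1
  clear hr hv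
  induction v using Modes.induction with
  | add u v hu hv => rw [map_add, hu, hv]
  | mode i h =>
    -- For n = 1 and l ≥ 2 the symbol may equal μ and the inverse is then the default value 0; this
    -- is harmless because such modes are zero.
    by_cases hi : n = 1 → i.1 ≤ 1
    · have h1 : μ - symbol n R d i ≠ 0 := fun h1 =>
        hμ (sub_eq_zero.1 h1 ▸ isEigenvalue_symbol hn hα1 hR hd hi)
      rw [scale_lof, mul_inv_cancel₀ h1, one_smul]
    · push Not at hi
      obtain ⟨rfl, hi⟩ := hi
      have h0 : h = 0 := Subtype.ext (Harm_one_eq_zero hi h.2)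
      rw [h0]
      simp only [map_zero]

/-- The spectrum consists of eigenvalues. -/
theorem mem_spectrum_iff (hn : 1 ≤ n) (hα0 : 0 < α) (hα1 : α < 1) (hR : 0 < R) (hd : 0 < d)
    (μ : ℂ) : μ ∈ spectrum (linearisation n hR hd α) ↔
      IsEigenvalue (linearisation n hR hd α) μ := by
  constructor
  · intro h
    by_contra h1
    exact h (mem_resolventSet_of_not_isEigenvalue hn hα0 hα1 hR hd h1)
  · rintro h ⟨⟨hinj, -⟩, -⟩
    exact h (LinearMap.ker_eq_bot.2 hinj)

theorem lam_eq (n : ℕ) (R d : ℝ) (l m : ℕ) : lam n R d l m =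
    -((m : ℝ) ^ 2 * Real.pi ^ 2 / d ^ 2 + ((l : ℝ) - 1) * ((l : ℝ) + n - 1) / R ^ 2) := by
  rw [lam]
  ring

theorem symbol_eq_lam {i : ℕ × ℤ} (hi : i ≠ (0, 0)) :
    symbol n R d i = (lam n R d i.1 i.2.natAbs : ℂ) := by
  have h : ((i.2.natAbs : ℝ)) ^ 2 = (i.2 : ℝ) ^ 2 := by
    rw [Nat.cast_natAbs, Int.cast_abs, sq_abs]
  have h1 : symbol n R d i = (((n : ℝ) - 1) / R ^ 2 - freq n R d i : ℝ) := by
    rw [symbol, if_neg hi, curvConst]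
    push_cast
    rfl
  rw [h1, lam, freq, h]
  congr 1
  ring

theorem isEigenvalue_iff (hn : 1 ≤ n) (hα0 : 0 < α) (hα1 : α < 1) (hR : 0 < R) (hd : 0 < d)
    (μ : ℂ) : IsEigenvalue (linearisation n hR hd α) μ ↔
      ∃ l m : ℕ, (l, m) ≠ (0, 0) ∧ (n = 1 → l ≤ 1) ∧ μ = (lam n R d l m : ℂ) := by
  constructor
  · intro h
    obtain ⟨i, hi, rfl⟩ := exists_symbol_eq hn hα0 hα1 hR hd h
    by_cases h0 : i = (0, 0)
    -- The constants have eigenvalue 0, which is λ_{1,0} and not the positive number λ_{0,0} would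
    -- be for n > 1.
    · refine ⟨1, 0, by simp, fun _ => le_rfl, ?_⟩
      rw [symbol, if_pos h0, lam_eq]
      simp
    · refine ⟨i.1, i.2.natAbs, fun h1 => h0 ?_, hi, symbol_eq_lam h0⟩
      rw [Prod.mk.injEq, Int.natAbs_eq_zero] at h1
      exact Prod.ext h1.1 h1.2
  · rintro ⟨l, m, h0, hl, rfl⟩
    have h1 : ((l, (m : ℤ)) : ℕ × ℤ) ≠ (0, 0) := fun h => h0 (by
      rw [Prod.mk.injEq, Nat.cast_eq_zero] at h
      rw [h.1, h.2])
    have h2 := isEigenvalue_symbol (R := R) (d := d) hn hα1 hR hd (i := (l, (m : ℤ))) hl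
    rwa [symbol_eq_lam h1, Int.natAbs_natCast] at h2

end Eigenvalues

/-! ### The position of the eigenvalues -/

section Eigenvalues

variable {n : ℕ} {R d : ℝ} {α : ℝ≥0}

/-- The radius condition squared. It is equivalent to λ_{0,1} < 0 and is the only obstacle to
nonpositivity, since λ_{l,m} ≤ 0 for every l ≥ 1. -/
theorem curv_lt_of_radius (hn : 1 ≤ n) (hR : 0 < R) (hd : 0 < d)
    (hRd : d * Real.sqrt ((n : ℝ) - 1) / Real.pi < R) :
    ((n : ℝ) - 1) / R ^ 2 < Real.pi ^ 2 / d ^ 2 := by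
  have hn' : (0 : ℝ) ≤ (n : ℝ) - 1 := sub_nonneg.2 (by exact_mod_cast hn)
  rw [div_lt_iff₀ Real.pi_pos] at hRd
  have h := pow_lt_pow_left₀ hRd (by positivity) two_ne_zero
  rw [mul_pow, Real.sq_sqrt hn', mul_pow] at h
  rw [div_lt_div_iff₀ (by positivity) (by positivity)]
  linarith

theorem degree_factor_nonneg (hn : 1 ≤ n) {l : ℕ} (hl : l ≠ 0) :
    0 ≤ ((l : ℝ) - 1) * ((l : ℝ) + n - 1) := by
  have h1 : (1 : ℝ) ≤ l := by exact_mod_cast Nat.one_le_iff_ne_zero.2 hl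
  have h2 : (1 : ℝ) ≤ n := by exact_mod_cast hn
  exact mul_nonneg (by linarith) (by linarith)

theorem lam_zero_neg (hn : 1 ≤ n) (hR : 0 < R) (hd : 0 < d)
    (hRd : d * Real.sqrt ((n : ℝ) - 1) / Real.pi < R) {m : ℕ} (hm : m ≠ 0) :
    lam n R d 0 m < 0 := by
  have h := curv_lt_of_radius hn hR hd hRd
  have h1 : (1 : ℝ) ≤ (m : ℝ) ^ 2 :=
    one_le_pow₀ (by exact_mod_cast Nat.one_le_iff_ne_zero.2 hm)
  have h2 : Real.pi ^ 2 / d ^ 2 ≤ (m : ℝ) ^ 2 * Real.pi ^ 2 / d ^ 2 := by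
    rw [mul_div_assoc]
    exact le_mul_of_one_le_left (by positivity) h1
  rw [lam]
  simp only [Nat.cast_zero, zero_mul, zero_sub, neg_div]
  linarith

theorem lam_nonpos (hn : 1 ≤ n) (hR : 0 < R) (hd : 0 < d)
    (hRd : d * Real.sqrt ((n : ℝ) - 1) / Real.pi < R) {l m : ℕ} (h : (l, m) ≠ (0, 0)) :
    lam n R d l m ≤ 0 := by
  by_cases hl : l = 0
  · subst hl
    exact (lam_zero_neg hn hR hd hRd fun hm => h (by rw [hm])).le
  · have := degree_factor_nonneg hn hl
    rw [lam_eq, neg_nonpos]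
    positivity

theorem eq_of_lam_eq_zero (hn : 1 ≤ n) (hR : 0 < R) (hd : 0 < d)
    (hRd : d * Real.sqrt ((n : ℝ) - 1) / Real.pi < R) {l m : ℕ} (h : (l, m) ≠ (0, 0))
    (h0 : lam n R d l m = 0) : l = 1 ∧ m = 0 := by
  by_cases hl : l = 0
  · subst hl
    exact absurd h0 (lam_zero_neg hn hR hd hRd fun hm => h (by rw [hm])).ne
  · have h1 := degree_factor_nonneg hn hl
    rw [lam_eq, neg_eq_zero] at h0
    have h2 : 0 ≤ (m : ℝ) ^ 2 * Real.pi ^ 2 / d ^ 2 := by positivity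
    have h3 : 0 ≤ ((l : ℝ) - 1) * ((l : ℝ) + n - 1) / R ^ 2 := by positivity
    have h4 : (m : ℝ) ^ 2 * Real.pi ^ 2 / d ^ 2 = 0 := by linarith
    have h5 : ((l : ℝ) - 1) * ((l : ℝ) + n - 1) / R ^ 2 = 0 := by linarith
    have h6 : (l : ℝ) + n - 1 ≠ 0 := by
      have h1 : (1 : ℝ) ≤ l := by exact_mod_cast Nat.one_le_iff_ne_zero.2 hl
      have h2 : (1 : ℝ) ≤ n := by exact_mod_cast hn
      linarith
    constructor
    · have : (l : ℝ) - 1 = 0 := by simpa [hR.ne', h6] using h5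
      exact_mod_cast sub_eq_zero.1 this
    · simpa [hd.ne', Real.pi_ne_zero] using h4

/-- Only finitely many of the eigenvalues lie above a given bound. -/
theorem finite_lam_ge (hn : 1 ≤ n) (hR : 0 < R) (hd : 0 < d) (K : ℝ) :
    {i : ℕ × ℕ | -K ≤ lam n R d i.1 i.2}.Finite := by
  have hn' : (1 : ℝ) ≤ n := by exact_mod_cast hn
  set c : ℝ := ((n : ℝ) - 1) / R ^ 2
  -- The two nonnegative parts of -λ + c, axial and spherical, are each at most K + c. Then m ≤ m²
  -- and l ≤ 1 + l(l-1) give crude bounds for both indices.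
  refine ((finite_Iic ⌈1 + (K + c) * R ^ 2⌉₊).prod
    (finite_Iic ⌈(K + c) * d ^ 2 / Real.pi ^ 2⌉₊)).subset ?_
  rintro ⟨l, m⟩ h
  rw [Set.mem_ofPred_eq, lam] at h
  have h1 : 0 ≤ (m : ℝ) ^ 2 * Real.pi ^ 2 / d ^ 2 := by positivity
  have hl : (0 : ℝ) ≤ (l : ℝ) * ((l : ℝ) + (n : ℝ) - 2) := by
    rcases Nat.eq_zero_or_pos l with rfl | hl
    · simp
    · have : (1 : ℝ) ≤ l := by exact_mod_cast hl
      exact mul_nonneg (by linarith) (by linarith)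
  have h2 : 0 ≤ (l : ℝ) * ((l : ℝ) + (n : ℝ) - 2) / R ^ 2 := by positivity
  rw [sub_div] at h
  have h3 : (l : ℝ) * ((l : ℝ) + (n : ℝ) - 2) / R ^ 2 ≤ K + c := by linarith
  have h4 : (m : ℝ) ^ 2 * Real.pi ^ 2 / d ^ 2 ≤ K + c := by linarith
  rw [div_le_iff₀ (by positivity)] at h3 h4
  rw [mem_prod, mem_Iic, mem_Iic]
  constructor <;> refine Nat.cast_le (α := ℝ).1 (le_trans ?_ (Nat.le_ceil _))
  · have h5 : (l : ℝ) * ((l : ℝ) - 1) ≤ (l : ℝ) * ((l : ℝ) + (n : ℝ) - 2) :=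
      mul_le_mul_of_nonneg_left (by linarith) (Nat.cast_nonneg l)
    nlinarith [sq_nonneg ((l : ℝ) - 1)]
  · rw [le_div_iff₀ (by positivity)]
    refine le_trans ?_ h4
    gcongr
    exact_mod_cast Nat.le_self_pow two_ne_zero m

variable (n R d) in
/-- The set of the numbers `λ_{l,m}` that occur as eigenvalues. -/
def eigenvalueSet : Set ℂ :=
  {μ : ℂ | ∃ l m : ℕ, (l, m) ≠ (0, 0) ∧ (n = 1 → l ≤ 1) ∧ μ = (lam n R d l m : ℂ)}

theorem countable_eigenvalueSet : (eigenvalueSet n R d).Countable := by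
  refine (countable_range fun i : ℕ × ℕ => (lam n R d i.1 i.2 : ℂ)).mono ?_
  rintro _ ⟨l, m, -, -, rfl⟩
  exact ⟨(l, m), rfl⟩

theorem infinite_eigenvalueSet (hd : 0 < d) : (eigenvalueSet n R d).Infinite := by
  refine (infinite_range_of_injective (f := fun m : ℕ => (lam n R d 1 m : ℂ)) ?_).mono ?_
  · intro m m' h
    have h1 : lam n R d 1 m = lam n R d 1 m' := Complex.ofReal_injective h
    rw [lam, lam, neg_inj, add_left_inj, mul_div_assoc, mul_div_assoc] at h1
    have h2 := mul_right_cancel₀ (div_ne_zero (pow_ne_zero 2 Real.pi_ne_zero)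
      (pow_ne_zero 2 hd.ne')) h1
    exact_mod_cast (pow_left_inj₀ (Nat.cast_nonneg m) (Nat.cast_nonneg m') two_ne_zero).1 h2
  · rintro _ ⟨m, rfl⟩
    exact ⟨1, m, by simp, fun _ => le_rfl, rfl⟩

/-- Within distance one of μ the numbers are at least -(‖μ‖ + 1), so only finitely many come into
question; removing μ leaves a finite, hence closed, set. -/
theorem isolated_eigenvalueSet (hn : 1 ≤ n) (hR : 0 < R) (hd : 0 < d) (μ : ℂ) :
    ∃ ε : ℝ, 0 < ε ∧ ∀ ν ∈ eigenvalueSet n R d, ‖ν - μ‖ < ε → ν = μ := by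
  set F : Set ℂ := (fun i : ℕ × ℕ => (lam n R d i.1 i.2 : ℂ)) ''
    {i | -(‖μ‖ + 1) ≤ lam n R d i.1 i.2}
  have hF : (F \ {μ}).Finite := ((finite_lam_ge hn hR hd _).image _).subset sdiff_subset
  obtain ⟨ε, hε, h⟩ := Metric.mem_nhds_iff.1 (hF.isClosed.isOpen_compl.mem_nhds
    (x := μ) fun h => h.2 rfl)
  refine ⟨min ε 1, by positivity, ?_⟩
  rintro ν ⟨l, m, -, -, rfl⟩ hν
  by_contra hne
  refine mt (fun h1 => h h1) (not_not.2 ⟨⟨(l, m), ?_, rfl⟩, hne⟩ :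
    ¬ (lam n R d l m : ℂ) ∈ (F \ {μ})ᶜ) ?_
  rotate_left
  · rw [mem_ball_iff_norm]
    exact hν.trans_le (min_le_left _ _)
  · have h1 : ‖(lam n R d l m : ℂ)‖ ≤ ‖μ‖ + 1 := by
      have := norm_le_norm_add_norm_sub' (lam n R d l m : ℂ) μ
      linarith [hν.trans_le (min_le_right ε 1)]
    rw [Complex.norm_real, Real.norm_eq_abs] at h1
    exact (abs_le.1 h1).1

/-! ### The kernel -/

theorem X_mem_Harm (k : Fin n) : MvPolynomial.X k ∈ Harm n 1 := by
  refine mem_Harm.2 ⟨MvPolynomial.isHomogeneous_X ℂ k, Finset.sum_eq_zero fun j _ => ?_⟩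
  rw [MvPolynomial.pderiv_X, Pi.single_apply]
  split_ifs <;> simp

/-- The modes in the kernel: the constants and the coordinate functions. -/
def kernelMode : Option (Fin n) → Modes n
  | none => symmetrise oneMode
  | some k => symmetrise (DirectSum.lof ℂ _ (fun i : ℕ × ℤ => Harm n i.1) (1, 0)
      ⟨MvPolynomial.X k, X_mem_Harm k⟩)

theorem reflect_kernelMode (a : Option (Fin n)) : reflect (kernelMode a) = kernelMode a := by
  cases a <;> exact reflect_symmetrise _

theorem symbol_one_zero : symbol n R d (1, 0) = 0 := by
  rw [symbol_eq_lam (by simp), lam_eq]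
  simp

theorem scale_symbol_kernelMode (a : Option (Fin n)) :
    scale (fun i => 0 - symbol n R d i) (kernelMode a) = 0 := by
  have hc : ∀ l m, 0 - symbol n R d (l, -m) = 0 - symbol n R d (l, m) := fun l m => by
    rw [symbol_neg]
  cases a with
  | none =>
    rw [kernelMode, oneMode, scale_symmetrise_lof hc]
    simp [symbol]
  | some k =>
    rw [kernelMode, scale_symmetrise_lof hc, symbol_one_zero, sub_zero, zero_smul]

/-- The kernel, spanned by the constants and the coordinate functions. -/
def kernelMap (hn : 1 ≤ n) (hR : 0 < R) (hd : 0 < d) (hα : α < 1) :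
    (Option (Fin n) → ℂ) →ₗ[ℂ] eigenspace (linearisation n hR hd α) 0 :=
  Fintype.linearCombination ℂ fun a =>
    (⟨restrDomain hR hd hα (reflect_kernelMode a), by
      have h := shifted_restr hn hR hd hα 0 (reflect_kernelMode a)
      rw [scale_symbol_kernelMode, map_zero] at h
      exact h⟩ : eigenspace (linearisation n hR hd α) 0)

theorem kernelMap_apply (hn : 1 ≤ n) (hR : 0 < R) (hd : 0 < d) (hα : α < 1)
    (c : Option (Fin n) → ℂ) :
    (((kernelMap hn hR hd hα c : eigenspace (linearisation n hR hd α) 0) :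
      (linearisation n hR hd α).domain) : LittleHolder (cylinder n R d) α)
      = ∑ a, c a • restr hR hα (kernelMode a) := by
  rw [kernelMap, Fintype.linearCombination_apply, Submodule.coe_sum, Submodule.coe_sum]
  rfl

theorem restr_kernelMode_apply (hR : 0 < R) (hd : 0 < d) (hα : α < 1)
    (ω : Metric.sphere (0 : EuclideanSpace ℝ (Fin n)) 1) (a : Option (Fin n)) :
    LittleHolder.toFun (restr hR hα (kernelMode a) : LittleHolder (cylinder n R d) α)
      (cylinderPoint hR (ω, ⟨0, le_rfl, hd.le⟩))
      = 2 * a.elim 1 fun k => ((ω : EuclideanSpace ℝ (Fin n)) k : ℂ) := by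
  cases a with
  | none => exact (restr_symmetrise_lof_apply hR hd hα 0 0 _ ω).trans (by simp)
  | some k => exact (restr_symmetrise_lof_apply hR hd hα 1 0 _ ω).trans (by simp)

/-- At the points ±e_k of the end z = 0 a vanishing combination reads c_0 ± c_k = 0. This works for
n = 1 as well, where the sphere consists of just these two points. -/
theorem injective_kernelMap (hn : 1 ≤ n) (hR : 0 < R) (hd : 0 < d) (hα : α < 1) :
    Function.Injective (kernelMap hn hR hd hα) := by
  rw [injective_iff_map_eq_zero]
  intro c hc
  have h0 : (∑ a, c a • restr hR hα (kernelMode a) : LittleHolder (cylinder n R d) α) = 0 := by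
    rw [← kernelMap_apply hn hR hd hα, hc]
    rfl
  have h1 : ∀ ω : Metric.sphere (0 : EuclideanSpace ℝ (Fin n)) 1,
      c none + ∑ k, c (some k) * ((ω : EuclideanSpace ℝ (Fin n)) k : ℂ) = 0 := fun ω => by
    have h2 := congrFun (congrArg LittleHolder.toFun h0) (cylinderPoint hR (ω, ⟨0, le_rfl, hd.le⟩))
    rw [map_sum, Finset.sum_apply, map_zero, Pi.zero_apply] at h2
    simp only [map_smul, Pi.smul_apply, smul_eq_mul, restr_kernelMode_apply hR hd hα ω,
      mul_left_comm _ (2 : ℂ), ← Finset.mul_sum] at h2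
    simpa [Fintype.sum_option] using h2
  have h3 : ∀ k, c none + c (some k) = 0 ∧ c none - c (some k) = 0 := fun k => by
    have ha := h1 ⟨EuclideanSpace.single k 1, by simp⟩
    have hb := h1 ⟨-EuclideanSpace.single k 1, by simp⟩
    simp only [PiLp.single_apply, PiLp.neg_apply, apply_ite Complex.ofReal, Complex.ofReal_one,
      Complex.ofReal_zero, Complex.ofReal_neg, mul_neg, Finset.sum_neg_distrib, mul_ite, mul_one,
      mul_zero, Finset.sum_ite_eq', Finset.mem_univ, if_true] at ha hb
    exact ⟨ha, by rw [sub_eq_add_neg]; exact hb⟩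
  have h4 : c none = 0 := by
    have := h3 ⟨0, hn⟩
    linear_combination (this.1 + this.2) / 2
  funext a
  cases a with
  | none => exact h4
  | some k => simpa [h4] using (h3 k).1

/-- The pairings of an element of the kernel with the constants and the coordinates. -/
def kernelPairing (hR : 0 < R) (hd : 0 < d) (hα : α < 1) :
    eigenspace (linearisation n hR hd α) 0 →ₗ[ℂ] (Option (Fin n) → ℂ) :=
  LinearMap.pi fun a => ((pairing hR d α).flip (restr hR hα (kernelMode a))).comp
    ((linearisation n hR hd α).domain.subtype.comp
      (eigenspace (linearisation n hR hd α) 0).subtype)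

theorem eq_sum_of_mem_Harm_one {h : MvPolynomial (Fin n) ℂ} (hh : h ∈ Harm n 1) :
    ∃ c : Fin n → ℂ, h = ∑ k, c k • MvPolynomial.X k := by
  have h1 := (mem_Harm.1 hh).1
  refine ⟨fun k => MvPolynomial.coeff 0 (MvPolynomial.pderiv k h), ?_⟩
  have h2 := h1.sum_X_mul_pderiv
  rw [one_smul] at h2
  conv_lhs => rw [← h2]
  refine Finset.sum_congr rfl fun k _ => ?_
  have h3 : (MvPolynomial.pderiv k h).IsHomogeneous 0 := h1.pderiv
  rw [← MvPolynomial.totalDegree_zero_iff_isHomogeneous,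
    MvPolynomial.totalDegree_eq_zero_iff_eq_C] at h3
  conv_lhs => rw [h3]
  rw [MvPolynomial.smul_eq_C_mul, mul_comm]

theorem symmetrise_lof_mem_span {i : ℕ × ℤ} (hi : i = (0, 0) ∨ i = (1, 0)) (h : Harm n i.1) :
    symmetrise (DirectSum.lof ℂ _ (fun i : ℕ × ℤ => Harm n i.1) i h)
      ∈ Submodule.span ℂ (range (kernelMode (n := n))) := by
  rcases hi with rfl | rfl
  · have h1 := (mem_Harm.1 h.2).1
    rw [← MvPolynomial.totalDegree_zero_iff_isHomogeneous,
      MvPolynomial.totalDegree_eq_zero_iff_eq_C] at h1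
    have e : h = MvPolynomial.coeff 0 h.1 • (⟨1, mem_Harm.2
        ⟨MvPolynomial.isHomogeneous_one _ _, by simp⟩⟩ : Harm n 0) := by
      apply Subtype.ext
      rw [Submodule.coe_smul, MvPolynomial.smul_eq_C_mul, mul_one]
      exact h1
    rw [e, map_smul, map_smul]
    exact Submodule.smul_mem _ _ (Submodule.subset_span ⟨none, rfl⟩)
  · obtain ⟨c, hc⟩ := eq_sum_of_mem_Harm_one h.2
    have e : h = ∑ k, c k • (⟨MvPolynomial.X k, X_mem_Harm k⟩ : Harm n 1) := by
      apply Subtype.ext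
      rw [Submodule.coe_sum]
      exact hc
    rw [e, map_sum, map_sum]
    refine Submodule.sum_mem _ fun k _ => ?_
    rw [map_smul, map_smul]
    exact Submodule.smul_mem _ _ (Submodule.subset_span ⟨some k, rfl⟩)

/-- An element of the kernel is orthogonal to all modes of nonzero symbol. By the radius condition
the remaining ones have type (0, 0) or (1, 0), which are spanned by the kernel modes, so vanishing
pairings with these force it to be zero. -/
theorem injective_kernelPairing (hn : 1 ≤ n) (hα0 : 0 < α) (hα1 : α < 1) (hR : 0 < R) (hd : 0 < d)
    (hRd : d * Real.sqrt ((n : ℝ) - 1) / Real.pi < R) :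
    Function.Injective (kernelPairing (n := n) hR hd hα1) := by
  rw [injective_iff_map_eq_zero]
  intro u hu
  have h1 : ∀ v ∈ Submodule.span ℂ (range (kernelMode (n := n))), pairing hR d α
      ((u : (linearisation n hR hd α).domain) : LittleHolder (cylinder n R d) α)
      (restr hR hα1 v) = 0 := by
    intro v hv
    induction hv using Submodule.span_induction with
    | mem v hv =>
      obtain ⟨a, rfl⟩ := hv
      exact congrFun hu a
    | zero => simp only [map_zero]
    | add v w _ _ hv hw => simp only [map_add, hv, hw, add_zero]
    | smul c v _ hv => simp only [map_smul, hv, smul_zero]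
  refine Subtype.ext (Subtype.ext (eq_zero_of_pairing_lof_eq_zero hn hα0 hα1 hR hd fun i h => ?_))
  by_cases hi : i = (0, 0) ∨ i = (1, 0)
  · exact h1 _ (symmetrise_lof_mem_span hi h)
  · push Not at hi
    refine pairing_eq_zero_of_ne hn hα0 hα1 hR hd u.2 (fun h0 => ?_) h
    rw [symbol_eq_lam hi.1, eq_comm, Complex.ofReal_eq_zero] at h0
    have h2 := eq_of_lam_eq_zero hn hR hd hRd (fun h2 => hi.1 (by
      rw [Prod.mk.injEq, Int.natAbs_eq_zero] at h2
      exact Prod.ext h2.1 h2.2)) h0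
    exact hi.2 (Prod.ext h2.1 (Int.natAbs_eq_zero.1 h2.2))

/-- The eigenvalue `0` has multiplicity `n + 1`. -/
theorem finrank_eigenspace_zero (hn : 1 ≤ n) (hα0 : 0 < α) (hα1 : α < 1) (hR : 0 < R) (hd : 0 < d)
    (hRd : d * Real.sqrt ((n : ℝ) - 1) / Real.pi < R) :
    Module.finrank ℂ (eigenspace (linearisation n hR hd α) 0) = n + 1 := by
  have h1 := injective_kernelPairing hn hα0 hα1 hR hd hRd
  have h2 := injective_kernelMap hn hR hd hα1
  -- Finite dimension must come first: `finrank` is 0 by convention in infinite dimension, and the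
  -- lower bound would not follow from injectivity alone.
  have := FiniteDimensional.of_injective _ h1
  have h3 := LinearMap.finrank_le_finrank_of_injective h1
  have h4 := LinearMap.finrank_le_finrank_of_injective h2
  rw [Module.finrank_fintype_fun_eq_card, Fintype.card_option, Fintype.card_fin] at h3 h4
  exact le_antisymm h3 h4

end Eigenvalues

end CylinderFlow

end

/-! ### The spectrum of the linearisation -/

theorem mainTheorem2 (n : ℕ) (hn : 1 ≤ n) (R d : ℝ) (hR : 0 < R) (hd : 0 < d)
    (hRd : d * Real.sqrt ((n : ℝ) - 1) / Real.pi < R)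
    (α : NNReal) (hα0 : 0 < α) (hα1 : α < 1) :
    -- the spectrum consists of eigenvalues
    (∀ μ : ℂ, μ ∈ CylinderFlow.spectrum (CylinderFlow.linearisation n hR hd α) ↔
      CylinderFlow.IsEigenvalue (CylinderFlow.linearisation n hR hd α) μ) ∧
    -- which form a sequence (a countably infinite set)
    (CylinderFlow.spectrum (CylinderFlow.linearisation n hR hd α)).Countable ∧
    (CylinderFlow.spectrum (CylinderFlow.linearisation n hR hd α)).Infinite ∧
    -- are isolated
    (∀ μ ∈ CylinderFlow.spectrum (CylinderFlow.linearisation n hR hd α), ∃ ε : ℝ, 0 < ε ∧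
      ∀ ν ∈ CylinderFlow.spectrum (CylinderFlow.linearisation n hR hd α),
        ‖ν - μ‖ < ε → ν = μ) ∧
    -- are real and non-positive
    (∀ μ ∈ CylinderFlow.spectrum (CylinderFlow.linearisation n hR hd α),
      μ.im = 0 ∧ μ.re ≤ 0) ∧
    -- and are exactly the numbers `λ_{l,m}` with `(l, m) ≠ (0, 0)`; on the two-point sphere
    -- (`n = 1`) only `l = 0, 1` occur
    CylinderFlow.spectrum (CylinderFlow.linearisation n hR hd α) =
      {μ : ℂ | ∃ l m : ℕ, (l, m) ≠ (0, 0) ∧ (n = 1 → l ≤ 1) ∧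
        μ = (CylinderFlow.lam n R d l m : ℂ)} ∧
    -- the eigenvalue `0` has multiplicity `n + 1`
    Module.finrank ℂ
      (CylinderFlow.eigenspace (CylinderFlow.linearisation n hR hd α) 0) = n + 1 := by
  have hset : CylinderFlow.spectrum (CylinderFlow.linearisation n hR hd α)
      = CylinderFlow.eigenvalueSet n R d := by
    ext μ
    rw [CylinderFlow.mem_spectrum_iff hn hα0 hα1 hR hd,
      CylinderFlow.isEigenvalue_iff hn hα0 hα1 hR hd]
    rfl
  refine ⟨CylinderFlow.mem_spectrum_iff hn hα0 hα1 hR hd, ?_⟩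
  rw [hset]
  refine ⟨CylinderFlow.countable_eigenvalueSet, CylinderFlow.infinite_eigenvalueSet hd,
    fun μ _ => CylinderFlow.isolated_eigenvalueSet hn hR hd μ, ?_, rfl,
    CylinderFlow.finrank_eigenspace_zero hn hα0 hα1 hR hd hRd⟩
  rintro _ ⟨l, m, h, -, rfl⟩
  exact ⟨Complex.ofReal_im _, CylinderFlow.lam_nonpos hn hR hd hRd h⟩
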